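/- For a finite simple graph $G$ let $$\mathrm{ABC}(G)=\sum_{uv\in E(G)}\sqrt{\frac{d(u)+d(v)-2}{d(u)d(v)}} .$$ A \emph{minimal-ABC tree} is a tree whose ABC index is minimal among all trees with the same number of vertices. Root a tree $G$ at a vertex $r$ of largest degree such that, among all vertices of largest degree, the sum of the degrees of the neighbours of $r$ is largest (for a greedy tree, its root is such a vertex). A \emph{pendant path} of length $l$ starts at a vertex of degree larger than $2$, has $l$ edges, inner vertices of degree $2$, and ends at a vertex of degree $1$. For $k\ge 2$, a vertex $u\ne r$ with exactly $k$ children is the root of a \emph{$B_k$-branch} if each child is the second vertex of a pendant path of length $2$ starting at $u$, and of a \emph{$B_k^*$-branch} if this holds except that exactly one of these pendant paths has length $3$. A \emph{$B_1$-branch} consists of the last two vertices $x,y$ of a pendant path $u\,x\,y$ of length $2$, where $x$ is a child of $u$ and $u$ is not the root of a $B_k$- or $B_k^*$-branch with $k\ge 2$. A \emph{$T_k$-branch} is the subtree consisting of a vertex with $k$ children that has degree at least $3$ and at which a pendant path of length $2$ or $3$ starts, together with all its descendants. \textbf{Theorem.} Let $G$ be a minimal-ABC tree with at least $10$ vertices,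 rooted as above. Then $G$ contains at most four $B_1$-branches. Moreover, if $G$ is itself a $T_k$-branch for some $k$, then $G$ contains at most three $B_1$-branches. -/

import Mathlib

open SimpleGraph

noncomputable section

namespace ABCTree

/-- The degree of a vertex of a finite graph. -/
def deg {V : Type*} [Fintype V] (G : SimpleGraph V) (v : V) : ℕ :=
  (G.neighborSet v).ncard

/-- The edge weight `f(x, y) = √((x + y - 2) / (x y))`. -/
def weight (x y : ℝ) : ℝ := Real.sqrt ((x + y - 2) / (x * y))

theorem weight_comm (x y : ℝ) : weight x y = weight y x := by
  unfold weight
  rw [add_comm x y, mul_comm x y]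

/-- The contribution of an (unordered) pair of vertices to the ABC index. -/
def edgeWeight {V : Type*} [Fintype V] (G : SimpleGraph V) : Sym2 V → ℝ :=
  Sym2.lift ⟨fun u v => weight (deg G u) (deg G v), fun _ _ => weight_comm _ _⟩

open Classical in
/-- The atom-bond connectivity index of a finite graph. -/
def abcIndex {V : Type*} [Fintype V] (G : SimpleGraph V) : ℝ :=
  ∑ e ∈ G.edgeFinset, edgeWeight G e

/-- `G` is a minimal-ABC tree: a tree whose ABC index is minimal among all trees with the same
number of vertices. (Every tree of that order is isomorphic to one with vertex type `V`.) -/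
def IsMinimalABC {V : Type*} [Fintype V] (G : SimpleGraph V) : Prop :=
  G.IsTree ∧ ∀ H : SimpleGraph V, H.IsTree → abcIndex G ≤ abcIndex H

/-- `r` is a greedy root of `G`: it has the largest degree and, among the vertices of largest
degree, its neighbours have the largest degrees in total. Every nonempty finite graph has such a
vertex. In a greedy tree the sorted neighbour degrees of the root dominate, entry by entry, those
of every other vertex of largest degree, so the root of a greedy tree is a greedy root. -/
def IsGreedyRoot {V : Type*} [Fintype V] (G : SimpleGraph V) (r : V) : Prop :=
  (∀ v, deg G v ≤ deg G r) ∧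
  ∀ v, deg G v = deg G r →
    ∑ᶠ w ∈ G.neighborSet v, deg G w ≤ ∑ᶠ w ∈ G.neighborSet r, deg G w

/-- In the tree `G` rooted at `r`, the vertex `c` is a child of `u`. -/
def IsChild {V : Type*} (G : SimpleGraph V) (r u c : V) : Prop :=
  G.Adj u c ∧ G.dist r c = G.dist r u + 1

/-- The children of `u`, in the tree `G` rooted at `r`. -/
def children {V : Type*} (G : SimpleGraph V) (r u : V) : Set V :=
  {c | IsChild G r u c}

/-- In the tree `G` rooted at `r`, the vertex `u` together with all its direct and indirect
children: the vertices `w` such that `u` lies on the path from `r` to `w`. -/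
def subtreeAt {V : Type*} (G : SimpleGraph V) (r u : V) : Set V :=
  {w | G.dist r w = G.dist r u + G.dist u w}

/-- A pendant path: it starts at a vertex of degree larger than two, its inner vertices have
degree two, and it ends at a vertex of degree one. Its length is its number of edges. -/
def IsPendantPath {V : Type*} [Fintype V] (G : SimpleGraph V) {u v : V} (p : G.Walk u v) : Prop :=
  p.IsPath ∧ 2 < deg G u ∧ deg G v = 1 ∧ ∀ w ∈ p.support, w ≠ u → w ≠ v → deg G w = 2

/-- A pendant path of length `l` starts at `u`, and its second vertex is `c`. -/
def HasPendantPath {V : Type*} [Fintype V] (G : SimpleGraph V) (l : ℕ) (u c : V) : Prop :=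
  ∃ (v : V) (p : G.Walk u v), IsPendantPath G p ∧ p.length = l ∧ p.snd = c

/-- A terminal vertex: a vertex of degree at least three that is adjacent to a pendant path of
length two or three. -/
def IsTerminal {V : Type*} [Fintype V] (G : SimpleGraph V) (u : V) : Prop :=
  3 ≤ deg G u ∧ ∃ c, HasPendantPath G 2 u c ∨ HasPendantPath G 3 u c

/-- In the tree `G` rooted at `r`, the vertex set `S` is a `T_k`-branch: it consists of a terminal
vertex with `k` children and of all the direct and indirect children of that vertex. (A terminal
vertex with `k` children has degree `k + 1`, or `k` if it is the root of the whole tree.) -/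
def IsTBranch {V : Type*} [Fintype V] (G : SimpleGraph V) (r : V) (k : ℕ) (S : Set V) : Prop :=
  ∃ u, IsTerminal G u ∧ (children G r u).ncard = k ∧ S = subtreeAt G r u

/-- In the tree `G` rooted at `r`, the vertex `u` is the root of a `B_k`-branch with `k ≥ 2`: it is
not the root of the tree, and it has `k` children, each of which starts a pendant path of length
two at `u`. -/
def IsBRoot {V : Type*} [Fintype V] (G : SimpleGraph V) (r : V) (k : ℕ) (u : V) : Prop :=
  2 ≤ k ∧ u ≠ r ∧ (children G r u).ncard = k ∧ ∀ c ∈ children G r u, HasPendantPath G 2 u c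

/-- In the tree `G` rooted at `r`, the vertex `u` is the root of a `B_k^*`-branch with `k ≥ 2`: a
`B_k`-branch one of whose pendant paths has been prolonged to length three. -/
def IsBStarRoot {V : Type*} [Fintype V] (G : SimpleGraph V) (r : V) (k : ℕ) (u : V) : Prop :=
  2 ≤ k ∧ u ≠ r ∧ (children G r u).ncard = k ∧
    ∃ c₀ ∈ children G r u, HasPendantPath G 3 u c₀ ∧
      ∀ c ∈ children G r u, c ≠ c₀ → HasPendantPath G 2 u c

/-- In the tree `G` rooted at `r`, the vertex `x` is the root of a `B_1`-branch: the parent `u`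
of `x` starts a pendant path `u x y` of length two, and this path is not one of the pendant paths
of a `B_k`-branch or `B_k^*`-branch with `k ≥ 2`. (The branch itself has the vertices `x, y`.) -/
def IsB1Root {V : Type*} [Fintype V] (G : SimpleGraph V) (r x : V) : Prop :=
  ∃ u, IsChild G r u x ∧ HasPendantPath G 2 u x ∧
    ∀ k, ¬ IsBRoot G r k u ∧ ¬ IsBStarRoot G r k u

/-- The number of `B_1`-branches of the tree `G` rooted at `r`. -/
def numB1 {V : Type*} [Fintype V] (G : SimpleGraph V) (r : V) : ℕ :=
  {x | IsB1Root G r x}.ncard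

end ABCTree

end

-- Write f(x, y) for the weight of an edge between degrees x and y. Three features of f carry the
-- argument. First, f(x, 2) = 1/√2 for all x, so the edges at an arm (a branch of degree two) are
-- indifferent to the degree of the vertex it hangs at. Second, f decreases in each variable while
-- the other is at least 2. Third, f has monotone differences (`wgt_supermod`): pairing large
-- degrees with large ones and small with small is cheapest. Hence exchanging branches between two
-- vertices of a minimal tree yields strong restrictions (`RTree.Min.exchange`), and exchanges
-- between vertices of equal degree cost nothing (`RTree.Min.swap`).
--
-- Minimal trees with at least ten vertices have no leaf at a branching vertex
-- (`RTree.Min.no_leaf`), only pendant paths of length two or three, and at most one of length three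
-- at a vertex. So a non-root branching vertex whose children all have degree at most two is the
-- root of a B_k- or B_k^*-branch, and a B_1-branch must be an arm at the root or at a mixed vertex,
-- one that also has a child of degree at least three (`numB1_le`). It remains to bound the number
-- of these arms (`RTree.Min.root_bound`).
--
-- Root the tree at a mixed vertex of degree d. By `RTree.Min.reg`, vertices with a large branch
-- have degree at least d and vertices with an arm have degree at most d; all mixed vertices thus
-- have degree d, and arms can be moved between them for free. Walk to a vertex next to a core leaf,
-- a branching vertex all of whose children are arms, and gather the arms there. An explicit local
-- move then lowers the index (`RTree.Min.final`) if four arms are available and no degree exceeds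
-- d, or if five are available in general.
--
-- If the root of the tree has an arm and two large branches, then d is the largest degree and at
-- most three arms are possible. If it has a single large branch, the greedy choice of the root
-- makes that branch a core leaf, and again at most three arms are possible. If it has no arm, a
-- walk to some mixed vertex gives the bound four. A tree that is itself a T_k-branch has an arm at
-- the root, whence the second claim.
--
-- The surgery takes place on plane rooted trees `RTree`, where moving the root or a branch is a
-- computation on lists. `exists_graph` realizes every such tree by a graph, so minimality passes
-- from the graph to its unfolding (`min_sub`).

noncomputable section

namespace ABCTree

/-! ### Weights of pairs of degrees -/

/-- The edge weight of a pair of degrees. -/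
def wgt (x y : ℕ) : ℝ := weight x y

theorem wgt_comm (x y : ℕ) : wgt x y = wgt y x := weight_comm _ _

theorem wgt_nonneg (x y : ℕ) : 0 ≤ wgt x y := Real.sqrt_nonneg _

theorem wgt_le {x y : ℕ} {b : ℝ} (hb : 0 ≤ b) (hx : 1 ≤ x) (hy : 1 ≤ y)
    (h : (x : ℝ) + y - 2 ≤ b ^ 2 * (x * y)) : wgt x y ≤ b := by
  have hx' : (0 : ℝ) < x := by exact_mod_cast hx
  have hy' : (0 : ℝ) < y := by exact_mod_cast hy
  exact Real.sqrt_le_iff.2 ⟨hb, (div_le_iff₀ (by positivity)).2 h⟩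

theorem le_wgt {x y : ℕ} {a : ℝ} (hx : 1 ≤ x) (hy : 1 ≤ y)
    (h : a ^ 2 * (x * y) ≤ (x : ℝ) + y - 2) : a ≤ wgt x y := by
  have hx' : (0 : ℝ) < x := by exact_mod_cast hx
  have hy' : (0 : ℝ) < y := by exact_mod_cast hy
  exact Real.le_sqrt_of_sq_le ((le_div_iff₀ (by positivity)).2 h)

theorem wgt_sq {x y : ℕ} (hx : 1 ≤ x) (hy : 1 ≤ y) :
    wgt x y ^ 2 = ((x : ℝ) + y - 2) / (x * y) := by
  have hx' : (1 : ℝ) ≤ x := by exact_mod_cast hx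
  have hy' : (1 : ℝ) ≤ y := by exact_mod_cast hy
  exact Real.sq_sqrt (div_nonneg (by linarith) (by positivity))

theorem wgt_pos {x y : ℕ} (hx : 1 ≤ x) (hy : 2 ≤ y) : 0 < wgt x y := by
  have hx' : (1 : ℝ) ≤ x := by exact_mod_cast hx
  have hy' : (2 : ℝ) ≤ y := by exact_mod_cast hy
  exact Real.sqrt_pos.2 (div_pos (by linarith) (by positivity))

/-- The factor x cancels in f(x, 2)² = x / (2x). This makes the edges at arms neutral in all later
moves. -/
theorem wgt_two_right {x : ℕ} (hx : 1 ≤ x) : wgt x 2 = wgt 2 2 := by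
  have hx' : (0 : ℝ) < x := by exact_mod_cast hx
  unfold wgt weight
  congr 1
  push_cast
  field_simp
  ring

theorem wgt_two_left {x : ℕ} (hx : 1 ≤ x) : wgt 2 x = wgt 2 2 := by
  rw [wgt_comm, wgt_two_right hx]

/-- Differences of weights in the second variable. -/
theorem wgt_sub {x y z : ℕ} (hx : 2 ≤ x) (hy : 1 ≤ y) (hz : 1 ≤ z) :
    (wgt x y - wgt x z) * (wgt x y + wgt x z) = (1 - 2 / (x : ℝ)) * (1 / y - 1 / z) := by
  have hx' : (0 : ℝ) < x := by exact_mod_cast (by omega : 0 < x)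
  have hy' : (0 : ℝ) < y := by exact_mod_cast hy
  have hz' : (0 : ℝ) < z := by exact_mod_cast hz
  have h1 := wgt_sq (by omega : 1 ≤ x) hy
  have h2 := wgt_sq (by omega : 1 ≤ x) hz
  have : (wgt x y - wgt x z) * (wgt x y + wgt x z) = wgt x y ^ 2 - wgt x z ^ 2 := by ring
  rw [this, h1, h2]
  field_simp
  ring

theorem wgt_add_pos {x y z : ℕ} (hx : 2 ≤ x) (hy : 1 ≤ y) (hz : 1 ≤ z) :
    0 < wgt x y + wgt x z := by
  have h1 : 0 < wgt x y := by rw [wgt_comm]; exact wgt_pos hy hx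
  have h2 : 0 < wgt x z := by rw [wgt_comm]; exact wgt_pos hz hx
  linarith

theorem wgt_anti {x y z : ℕ} (hx : 2 ≤ x) (hy : 1 ≤ y) (hyz : y ≤ z) : wgt x z ≤ wgt x y := by
  have h := wgt_sub hx hy (hy.trans hyz)
  have hp := wgt_add_pos hx hy (hy.trans hyz)
  have hx' : (2 : ℝ) ≤ x := by exact_mod_cast hx
  have hy' : (0 : ℝ) < y := by exact_mod_cast hy
  have hz' : (y : ℝ) ≤ z := by exact_mod_cast hyz
  have h1 : 0 ≤ 1 - 2 / (x : ℝ) := by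
    rw [sub_nonneg, div_le_one (by linarith)]; exact hx'
  have h2 : 0 ≤ 1 / (y : ℝ) - 1 / z := sub_nonneg.2 (one_div_le_one_div_of_le hy' hz')
  have := mul_nonneg h1 h2
  rw [← h] at this
  have := nonneg_of_mul_nonneg_left this hp
  linarith

theorem wgt_anti_left {x y z : ℕ} (hx : 2 ≤ x) (hy : 1 ≤ y) (hyz : y ≤ z) :
    wgt z x ≤ wgt y x := by
  rw [wgt_comm z, wgt_comm y]; exact wgt_anti hx hy hyz

theorem wgt_strictAnti {x y z : ℕ} (hx : 3 ≤ x) (hy : 1 ≤ y) (hyz : y < z) :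
    wgt x z < wgt x y := by
  have h := wgt_sub (by omega : 2 ≤ x) hy (hy.trans hyz.le)
  have hp := wgt_add_pos (by omega : 2 ≤ x) hy (hy.trans hyz.le)
  have hx' : (3 : ℝ) ≤ x := by exact_mod_cast hx
  have hy' : (0 : ℝ) < y := by exact_mod_cast hy
  have hz' : (y : ℝ) < z := by exact_mod_cast hyz
  have h1 : 0 < 1 - 2 / (x : ℝ) := by
    rw [sub_pos, div_lt_one (by linarith)]; linarith
  have h2 : 0 < 1 / (y : ℝ) - 1 / z := sub_pos.2 (one_div_lt_one_div_of_lt hy' hz')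
  have := mul_pos h1 h2
  rw [← h] at this
  have := pos_of_mul_pos_left this hp.le
  linarith

/-- Since f(x, 1)² = 1 − 1/x, monotonicity is reversed when the other end is a leaf. -/
theorem wgt_one_mono {x x' : ℕ} (hx : 1 ≤ x) (hxx : x ≤ x') : wgt x 1 ≤ wgt x' 1 := by
  have hx' : (1 : ℝ) ≤ x := by exact_mod_cast hx
  have hxx' : (x : ℝ) ≤ x' := by exact_mod_cast hxx
  refine Real.sqrt_le_sqrt ?_
  rw [div_le_div_iff₀ (by push_cast; linarith) (by push_cast; linarith)]
  push_cast
  nlinarith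

/-- Supermodularity of the weight, for degrees at least two. -/
theorem wgt_supermod_mul {x x' y z : ℕ} (hx : 2 ≤ x) (hxx : x ≤ x') (hy : 2 ≤ y) (hyz : y ≤ z) :
    (1 - 2 / (x' : ℝ)) * (1 / y - 1 / z) ≤
      (wgt x' y - wgt x' z) * (wgt x y + wgt x z) := by
  have hx2 : 2 ≤ x' := hx.trans hxx
  have h' := wgt_sub hx2 (by omega : 1 ≤ y) (by omega : 1 ≤ z)
  have hnn : 0 ≤ wgt x' y - wgt x' z := sub_nonneg.2 (wgt_anti hx2 (by omega) hyz)
  have h4 := wgt_anti_left hy (by omega : 1 ≤ x) hxx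
  have h5 := wgt_anti_left (hy.trans hyz) (by omega : 1 ≤ x) hxx
  rw [← h']
  gcongr

/-- In the factorization of `wgt_sub` the right-hand side grows with x, while for y ≥ 2 the sum of
the two weights shrinks, so their difference grows. For y = 1 < z the first weight grows by itself
and the second one shrinks. -/
theorem wgt_supermod {x x' y z : ℕ} (hx : 2 ≤ x) (hxx : x ≤ x') (hy : 1 ≤ y) (hyz : y ≤ z) :
    wgt x y - wgt x z ≤ wgt x' y - wgt x' z := by
  rcases Nat.lt_or_ge y 2 with hy1 | hy2
  · obtain rfl : y = 1 := by omega
    rcases Nat.lt_or_ge z 2 with hz1 | hz2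
    · obtain rfl : z = 1 := by omega
      simp
    · have h1 := wgt_one_mono (by omega : 1 ≤ x) hxx
      have h2 := wgt_anti_left hz2 (by omega : 1 ≤ x) hxx
      linarith
  have h := wgt_sub hx hy (hy.trans hyz)
  have hp := wgt_add_pos hx hy (hy.trans hyz)
  have hxr : (0 : ℝ) < x := by exact_mod_cast (by omega : 0 < x)
  have hxx' : (x : ℝ) ≤ x' := by exact_mod_cast hxx
  have hy' : (0 : ℝ) < y := by exact_mod_cast hy
  have hz' : (y : ℝ) ≤ z := by exact_mod_cast hyz
  have h2 : 0 ≤ 1 / (y : ℝ) - 1 / z := sub_nonneg.2 (one_div_le_one_div_of_le hy' hz')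
  have h3 : 2 / (x' : ℝ) ≤ 2 / x := div_le_div_of_nonneg_left (by norm_num) hxr hxx'
  have hle : (1 - 2 / (x : ℝ)) * (1 / y - 1 / z) ≤ (1 - 2 / (x' : ℝ)) * (1 / y - 1 / z) := by
    gcongr
  rw [← h] at hle
  exact le_of_mul_le_mul_right (hle.trans (wgt_supermod_mul hx hxx hy2 hyz)) hp

theorem wgt_supermod_strict {x x' y z : ℕ} (hx : 2 ≤ x) (hxx : x < x') (hy : 2 ≤ y)
    (hyz : y < z) : wgt x y - wgt x z < wgt x' y - wgt x' z := by
  have h := wgt_sub hx (by omega : 1 ≤ y) (by omega : 1 ≤ z)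
  have hp := wgt_add_pos hx (by omega : 1 ≤ y) (by omega : 1 ≤ z)
  have hxr : (0 : ℝ) < x := by exact_mod_cast (by omega : 0 < x)
  have hxx' : (x : ℝ) < x' := by exact_mod_cast hxx
  have hy' : (0 : ℝ) < y := by exact_mod_cast (by omega : 0 < y)
  have hz' : (y : ℝ) < z := by exact_mod_cast hyz
  have h2 : 0 < 1 / (y : ℝ) - 1 / z := sub_pos.2 (one_div_lt_one_div_of_lt hy' hz')
  have h3 : 2 / (x' : ℝ) < 2 / x := div_lt_div_of_pos_left (by norm_num) hxr hxx'
  have hle : (1 - 2 / (x : ℝ)) * (1 / y - 1 / z) < (1 - 2 / (x' : ℝ)) * (1 / y - 1 / z) := by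
    gcongr
  rw [← h] at hle
  exact lt_of_mul_lt_mul_right (hle.trans_le (wgt_supermod_mul hx hxx.le hy hyz.le)) hp.le

/-! ### Rooted plane trees -/

/-- Finite rooted plane trees. -/
inductive RTree : Type
  | node : List RTree → RTree

namespace RTree

/-- The list of branches at the root. -/
def kids : RTree → List RTree
  | node l => l

/-- The degree of the root of a branch, counting the edge to its parent. -/
def deg (t : RTree) : ℕ := t.kids.length + 1

@[simp] theorem kids_node (l : List RTree) : (node l).kids = l := rfl

@[simp] theorem node_kids (t : RTree) : node t.kids = t := by cases t; rfl

@[simp] theorem deg_node (l : List RTree) : (node l).deg = l.length + 1 := rfl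

theorem one_le_deg (t : RTree) : 1 ≤ t.deg := by simp [deg]

/-- Induction over rooted trees. -/
theorem ind {P : RTree → Prop} (h : ∀ l, (∀ t ∈ l, P t) → P (node l)) : ∀ t, P t
  | node l => h l fun t _ => ind h t

mutual
/-- The number of vertices. -/
def size : RTree → ℕ
  | node l => sizeL l + 1
/-- The number of vertices of a forest. -/
def sizeL : List RTree → ℕ
  | [] => 0
  | t :: l => size t + sizeL l
end

mutual
/-- The total weight of the edges below the root of a branch. -/
def inner : RTree → ℝ
  | node l => brL (l.length + 1) l
/-- The total weight of a list of branches together with the edges to their common parent, which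
has degree `D`. -/
def brL (D : ℕ) : List RTree → ℝ
  | [] => 0
  | t :: l => wgt D t.deg + inner t + brL D l
end

/-- The total weight of a branch together with the edge to its parent, which has degree `D`. -/
def br (D : ℕ) (t : RTree) : ℝ := wgt D t.deg + inner t

/-- The ABC index of a rooted tree. -/
def abc (t : RTree) : ℝ := brL t.kids.length t.kids

@[simp] theorem size_node (l : List RTree) : size (node l) = sizeL l + 1 := by rw [size]

theorem sizeL_eq (l : List RTree) : sizeL l = (l.map size).sum := by
  induction l with
  | nil => simp [sizeL]
  | cons t l ih => simp [sizeL, ih]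

@[simp] theorem sizeL_nil : sizeL [] = 0 := by rw [sizeL]

@[simp] theorem sizeL_cons (t : RTree) (l : List RTree) : sizeL (t :: l) = size t + sizeL l := by
  rw [sizeL]

@[simp] theorem sizeL_append (l m : List RTree) : sizeL (l ++ m) = sizeL l + sizeL m := by
  simp [sizeL_eq]

theorem inner_node (l : List RTree) : inner (node l) = brL (l.length + 1) l := by rw [inner]

@[simp] theorem brL_nil (D : ℕ) : brL D [] = 0 := by rw [brL]

@[simp] theorem brL_cons (D : ℕ) (t : RTree) (l : List RTree) :
    brL D (t :: l) = br D t + brL D l := by rw [brL, br]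

@[simp] theorem brL_append (D : ℕ) (l m : List RTree) : brL D (l ++ m) = brL D l + brL D m := by
  induction l with
  | nil => simp
  | cons t l ih => simp [ih, add_assoc]

theorem br_node (D : ℕ) (l : List RTree) :
    br D (node l) = wgt D (l.length + 1) + brL (l.length + 1) l := by
  rw [br, inner_node, deg_node]

theorem abc_node (l : List RTree) : abc (node l) = brL l.length l := rfl

theorem brL_perm {D : ℕ} {l m : List RTree} (h : l.Perm m) : brL D l = brL D m := by
  induction h with
  | nil => rfl
  | cons _ _ ih => simp [ih]
  | swap x y l => simp only [brL_cons]; ring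
  | trans _ _ h1 h2 => exact h1.trans h2

theorem sizeL_perm {l m : List RTree} (h : l.Perm m) : sizeL l = sizeL m := by
  rw [sizeL_eq, sizeL_eq]; exact (h.map size).sum_eq

theorem size_pos (t : RTree) : 0 < size t := by cases t; simp

/-- `t` has minimal ABC index among the rooted trees with the same number of vertices. -/
def Min (t : RTree) : Prop := ∀ t', size t' = size t → abc t ≤ abc t'

theorem Min.of_eq {t t' : RTree} (h : Min t) (hs : size t' = size t) (ha : abc t' ≤ abc t) :
    Min t' := fun u hu => ha.trans (h u (hu.trans hs))

theorem Min.perm {l m : List RTree} (h : Min (node l)) (p : l.Perm m) : Min (node m) :=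
  h.of_eq (by simp [sizeL_perm p]) (by rw [abc_node, abc_node, brL_perm p, p.length_eq])

/-- Moving the root along an edge. -/
theorem Min.reroot {l m : List RTree} (h : Min (node (node m :: l))) :
    Min (node (node l :: m)) := by
  refine h.of_eq (by simp; ring) (le_of_eq ?_)
  simp only [abc_node, brL_cons, br_node, List.length_cons]
  rw [wgt_comm]; ring

/-! ### Contexts -/

/-- A rooted tree with one hole in the place of a branch. -/
inductive Ctx : Type
  | hole : Ctx
  | sub (l₁ : List RTree) (C : Ctx) (l₂ : List RTree) : Ctx

namespace Ctx

/-- Fill the hole. -/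
def fill : Ctx → RTree → RTree
  | hole, t => t
  | sub l₁ C l₂, t => node (l₁ ++ C.fill t :: l₂)

/-- The degree of the parent of the hole, if the whole context is a branch at a vertex of
degree `k`. -/
def hdeg (k : ℕ) : Ctx → ℕ
  | hole => k
  | sub l₁ C l₂ => hdeg (l₁.length + l₂.length + 2) C

/-- Composition of contexts. -/
def comp : Ctx → Ctx → Ctx
  | hole, D => D
  | sub l₁ C l₂, D => sub l₁ (C.comp D) l₂

@[simp] theorem fill_hole (t : RTree) : hole.fill t = t := rfl

@[simp] theorem fill_sub (l₁ C l₂ t) : (sub l₁ C l₂).fill t = node (l₁ ++ C.fill t :: l₂) := rfl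

@[simp] theorem hdeg_hole (k : ℕ) : hole.hdeg k = k := rfl

@[simp] theorem hdeg_sub (k l₁ C l₂) :
    (sub l₁ C l₂).hdeg k = C.hdeg (l₁.length + l₂.length + 2) := rfl

theorem fill_comp (C D : Ctx) (t : RTree) : (C.comp D).fill t = C.fill (D.fill t) := by
  induction C with
  | hole => rfl
  | sub l₁ C l₂ ih => simp [comp, ih]

theorem hdeg_comp (k : ℕ) (C D : Ctx) : (C.comp D).hdeg k = D.hdeg (C.hdeg k) := by
  induction C generalizing k with
  | hole => rfl
  | sub l₁ C l₂ ih => simp [comp, ih]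

theorem size_fill (C : Ctx) (x y : RTree) :
    size (C.fill x) + size y = size (C.fill y) + size x := by
  induction C with
  | hole => simp [add_comm]
  | sub l₁ C l₂ ih => simp; omega

/-- The degrees along the context do not depend on what fills the hole, so only the branch in the
hole and the edge above it contribute to the change. Every move far from the root is computed
through this identity. -/
theorem br_fill (k : ℕ) (C : Ctx) (x y : RTree) :
    br k (C.fill x) - br k (C.fill y) = br (C.hdeg k) x - br (C.hdeg k) y := by
  induction C generalizing k with
  | hole => simp
  | sub l₁ C l₂ ih =>
    have := ih (l₁.length + l₂.length + 2)
    simp only [fill_sub, br_node, List.length_append, List.length_cons, brL_append, brL_cons,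
      hdeg_sub]
    rw [show l₁.length + (l₂.length + 1) + 1 = l₁.length + l₂.length + 2 by ring]
    linarith

theorem one_le_hdeg {k : ℕ} (hk : 1 ≤ k) (C : Ctx) : 1 ≤ C.hdeg k := by
  induction C generalizing k with
  | hole => exact hk
  | sub l₁ C l₂ ih => exact ih (by omega)

end Ctx

/-- Exchange of a branch at the root with a branch elsewhere. -/
theorem Min.exchange {l : List RTree} {C : Ctx} {x z : RTree} (h : Min (node (z :: C.fill x :: l))) :
    wgt (l.length + 2) z.deg + wgt (C.hdeg (l.length + 2)) x.deg ≤
      wgt (l.length + 2) x.deg + wgt (C.hdeg (l.length + 2)) z.deg := by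
  have h1 := h (node (x :: C.fill z :: l)) (by have := C.size_fill x z; simp; omega)
  have h2 := C.br_fill (l.length + 2) x z
  simp only [abc_node, brL_cons, List.length_cons, add_assoc, br] at h1 h2 ⊢
  norm_num at h1
  linarith

/-- Exchange of branches between two vertices of the same degree. -/
theorem Min.swap {l : List RTree} {C : Ctx} {x z : RTree} (h : Min (node (z :: C.fill x :: l)))
    (hd : C.hdeg (l.length + 2) = l.length + 2) : Min (node (x :: C.fill z :: l)) := by
  refine h.of_eq (by have := C.size_fill x z; simp; omega) (le_of_eq ?_)
  have h2 := C.br_fill (l.length + 2) x z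
  rw [hd] at h2
  simp only [abc_node, brL_cons, List.length_cons]
  norm_num [add_assoc] at h2 ⊢
  linarith

/-- Moving the root to an arbitrary vertex. -/
theorem Min.reroot_fill {l m : List RTree} {C : Ctx} (h : Min (node (C.fill (node m) :: l))) :
    ∃ u : RTree, Min (node (u :: m)) ∧ u.deg = C.hdeg (l.length + 1) ∧
      size (node (u :: m)) = size (node (C.fill (node m) :: l)) := by
  induction C generalizing l with
  | hole => exact ⟨node l, h.reroot, rfl, by simp; omega⟩
  | sub l₁ C l₂ ih =>
    have h1 : Min (node (C.fill (node m) :: node l :: (l₁ ++ l₂))) := by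
      refine (Min.reroot h).perm ?_
      refine (List.Perm.cons _ List.perm_middle).trans (List.Perm.swap _ _ _)
    obtain ⟨u, hu, hd, hs⟩ := ih h1
    refine ⟨u, hu, hd.trans (by simp), hs.trans (by simp; omega)⟩

end RTree

/-! ### Numerical estimates -/

theorem wgt_two_two_le : wgt 2 2 ≤ 0.7071068 :=
  wgt_le (by norm_num) (by norm_num) (by norm_num) (by norm_num)

theorem le_wgt_two_two : 0.7071067 ≤ wgt 2 2 :=
  le_wgt (by norm_num) (by norm_num) (by norm_num)

/-- From f(x, y)² = 1/x + (1 − 2/x)/y: the bound is the limit for y → ∞. -/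
theorem inv_sqrt_le_wgt {x y : ℕ} (hx : 2 ≤ x) (hy : 1 ≤ y) : (√(x : ℝ))⁻¹ ≤ wgt x y := by
  have hx' : (2 : ℝ) ≤ x := by exact_mod_cast hx
  have hy' : (1 : ℝ) ≤ y := by exact_mod_cast hy
  refine le_wgt (by omega) hy ?_
  rw [inv_pow, Real.sq_sqrt (by linarith)]
  field_simp
  linarith

theorem inv_sqrt_anti {x y : ℕ} (hx : 1 ≤ x) (hxy : x ≤ y) : (√(y : ℝ))⁻¹ ≤ (√(x : ℝ))⁻¹ := by
  have hx' : (0 : ℝ) < x := by exact_mod_cast hx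
  gcongr

/-- The loss at an edge whose other end has an arbitrary degree. -/
theorem wgt_sub_le_inv_sqrt {x y e : ℕ} (hx : 2 ≤ x) (hxy : x ≤ y) (he : 1 ≤ e) :
    wgt x e - wgt y e ≤ (√(x : ℝ))⁻¹ - (√(y : ℝ))⁻¹ := by
  have hx' : (0 : ℝ) < x := by exact_mod_cast (by omega : 0 < x)
  have hy' : (0 : ℝ) < y := by exact_mod_cast (by omega : 0 < y)
  have he' : (0 : ℝ) < e := by exact_mod_cast he
  have ha := inv_sqrt_le_wgt hx he
  have hb := inv_sqrt_le_wgt (hx.trans hxy) he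
  have hab := inv_sqrt_anti (by omega : 1 ≤ x) hxy
  have hap : 0 < (√(x : ℝ))⁻¹ := by positivity
  have hbp : 0 < (√(y : ℝ))⁻¹ := by positivity
  have hxy' : (x : ℝ) ≤ y := by exact_mod_cast hxy
  have h0 : 0 ≤ 1 / (x : ℝ) - 1 / y := sub_nonneg.2 (one_div_le_one_div_of_le hx' hxy')
  -- The difference of the squares is at most 1/x − 1/y because 1 − 2/e ≤ 1, and the sum of the
  -- weights is at least 1/√x + 1/√y. A larger difference of weights would violate the product of
  -- these.
  by_contra! hlt
  have h1 : (wgt x e - wgt y e) * (wgt x e + wgt y e) ≤ 1 / (x : ℝ) - 1 / y := by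
    have : (wgt x e - wgt y e) * (wgt x e + wgt y e) = wgt x e ^ 2 - wgt y e ^ 2 := by ring
    rw [this, wgt_sq (by omega) he, wgt_sq (by omega) he]
    have : ((x : ℝ) + e - 2) / (x * e) - (y + e - 2) / (y * e)
      = (1 / x - 1 / y) * (1 - 2 / e) := by field_simp; ring
    rw [this]
    have : (1 : ℝ) - 2 / e ≤ 1 := by
      have : 0 ≤ 2 / (e : ℝ) := by positivity
      linarith
    exact mul_le_of_le_one_right h0 this
  have h2 : ((√(x : ℝ))⁻¹ - (√(y : ℝ))⁻¹) * ((√(x : ℝ))⁻¹ + (√(y : ℝ))⁻¹) = 1 / (x : ℝ) - 1 / y := by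
    have : ((√(x : ℝ))⁻¹ - (√(y : ℝ))⁻¹) * ((√(x : ℝ))⁻¹ + (√(y : ℝ))⁻¹)
      = (√(x : ℝ))⁻¹ ^ 2 - (√(y : ℝ))⁻¹ ^ 2 := by ring
    rw [this, inv_pow, inv_pow, Real.sq_sqrt hx'.le, Real.sq_sqrt hy'.le]
    simp
  have h3 : ((√(x : ℝ))⁻¹ - (√(y : ℝ))⁻¹) * ((√(x : ℝ))⁻¹ + (√(y : ℝ))⁻¹)
      < (wgt x e - wgt y e) * (wgt x e + wgt y e) :=
    mul_lt_mul hlt (by linarith) (by positivity) (by linarith)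
  linarith

/-- With a = √x and b = √(x + 1) the bound exceeds the difference by (a − b)² / (2a²b), using b² −
a² = 1. -/
theorem inv_sqrt_sub_le {x : ℕ} (hx : 1 ≤ x) :
    (√(x : ℝ))⁻¹ - (√((x + 1 : ℕ) : ℝ))⁻¹ ≤ (√((x + 1 : ℕ) : ℝ))⁻¹ / (2 * x) := by
  have hx' : (0 : ℝ) < x := by exact_mod_cast hx
  have h1 : 0 < √(x : ℝ) := Real.sqrt_pos.2 hx'
  have h2 : 0 < √((x + 1 : ℕ) : ℝ) := Real.sqrt_pos.2 (by positivity)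
  have e1 : √(x : ℝ) ^ 2 = x := Real.sq_sqrt hx'.le
  have e2 : √((x + 1 : ℕ) : ℝ) ^ 2 = x + 1 := by rw [Real.sq_sqrt (by positivity)]; push_cast; ring
  generalize √(x : ℝ) = a at *
  generalize √((x + 1 : ℕ) : ℝ) = b at *
  rw [← e1, inv_sub_inv h1.ne' h2.ne', ← sub_nonneg]
  have : b⁻¹ / (2 * a ^ 2) - (b - a) / (a * b) = (a - b) ^ 2 / (2 * a ^ 2 * b) := by
    field_simp
    linear_combination e1 - e2
  rw [this]
  positivity

/-- Two leaves at a vertex of degree k become one path of length two: the gain is on the right, the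
loss at the k − 2 other neighbours is bounded by the left. For k ≥ 4 the loss is at most 1/4; only k
= 3 needs its own numbers. -/
theorem two_leaves_gain {k : ℕ} (hk : 3 ≤ k) :
    ((k : ℝ) - 2) * ((√((k - 1 : ℕ) : ℝ))⁻¹ - (√(k : ℝ))⁻¹) < 2 * (wgt k 1 - wgt 2 2) := by
  obtain ⟨x, rfl⟩ : ∃ x, k = x + 1 := ⟨k - 1, by omega⟩
  have hs := wgt_two_two_le
  have hx : (2 : ℝ) ≤ x := by exact_mod_cast (by omega : 2 ≤ x)
  have h1 := inv_sqrt_sub_le (by omega : 1 ≤ x)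
  have h2 : ((x : ℝ) + 1 - 2) * ((√((x + 1 : ℕ) : ℝ))⁻¹ / (2 * x)) ≤
      (x - 1) / (2 * x) * (√((x + 1 : ℕ) : ℝ))⁻¹ := by
    apply le_of_eq; ring
  have h3 := mul_le_mul_of_nonneg_left h1 (by linarith : 0 ≤ (x : ℝ) + 1 - 2)
  have hb : (x - 1 : ℝ) / (2 * x) ≤ 1 / 2 := by
    rw [div_le_div_iff₀ (by positivity) (by norm_num)]; linarith
  have hp : 0 < (√((x + 1 : ℕ) : ℝ))⁻¹ := by positivity
  simp only [Nat.add_sub_cancel]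
  push_cast at h1 h2 h3 hp ⊢
  rcases Nat.lt_or_ge x 3 with hx3 | hx3
  · obtain rfl : x = 2 := by omega
    have h4 : (0.816 : ℝ) ≤ wgt 3 1 := le_wgt (by norm_num) (by norm_num) (by norm_num)
    have h5 : (√(((2 : ℕ) : ℝ) + 1))⁻¹ ≤ 0.58 := by
      rw [inv_le_comm₀ (by positivity) (by norm_num)]
      exact Real.le_sqrt_of_sq_le (by norm_num)
    push_cast at *
    linarith
  · have h4 : (0.866 : ℝ) ≤ wgt (x + 1) 1 :=
      le_trans (le_wgt (by norm_num) (by norm_num) (by norm_num))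
        (wgt_one_mono (by norm_num : 1 ≤ 4) (by omega))
    have h5 : (√((x : ℝ) + 1))⁻¹ ≤ 1 / 2 := by
      rw [inv_le_comm₀ (by positivity) (by norm_num)]
      refine Real.le_sqrt_of_sq_le ?_
      have : (3 : ℝ) ≤ x := by exact_mod_cast hx3
      norm_num; linarith
    have h6 := mul_le_mul hb h5 hp.le (by norm_num)
    linarith

/-- An arm leaves a vertex of degree j, whose parent has degree h, and prolongs a leaf at a vertex
of degree k. The case k = j = 3 is excluded because the inequality fails there for large h. -/
theorem leaf_gain {k h j : ℕ} (hk : 3 ≤ k) (hh : 1 ≤ h) (hj : 3 ≤ j) (hkj : 4 ≤ k ∨ 4 ≤ j) :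
    wgt h (j - 1) - wgt h j < wgt k 1 - wgt 2 2 := by
  obtain ⟨x, rfl⟩ : ∃ x, j = x + 1 := ⟨j - 1, by omega⟩
  simp only [Nat.add_sub_cancel]
  have hs := wgt_two_two_le
  have h1 := wgt_sub_le_inv_sqrt (by omega : 2 ≤ x) (by omega : x ≤ x + 1) hh
  rw [wgt_comm h, wgt_comm h]
  have h2 := inv_sqrt_sub_le (by omega : 1 ≤ x)
  have hx : (2 : ℝ) ≤ x := by exact_mod_cast (by omega : 2 ≤ x)
  have hp : 0 < (√((x + 1 : ℕ) : ℝ))⁻¹ := by positivity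
  have ha : ∀ y : ℕ, 2 ≤ y → (y : ℝ) ≤ x → ∀ c : ℝ, 0 < c → 1 ≤ c ^ 2 * (y + 1) →
      (√((x + 1 : ℕ) : ℝ))⁻¹ / (2 * x) ≤ c / (2 * y) := by
    intro y hy hyx c hc hc2
    have hy' : (0 : ℝ) < y := by exact_mod_cast (by omega : 0 < y)
    have : (√((x + 1 : ℕ) : ℝ))⁻¹ ≤ c := by
      rw [inv_le_comm₀ (by positivity) hc]
      refine Real.le_sqrt_of_sq_le ?_
      push_cast
      rw [inv_pow, inv_le_iff_one_le_mul₀ (by positivity)]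
      nlinarith [sq_nonneg c]
    gcongr
  rcases hkj with hk4 | hj4
  · have h4 : (0.866 : ℝ) ≤ wgt k 1 :=
      le_trans (le_wgt (by norm_num) (by norm_num) (by norm_num))
        (wgt_one_mono (by norm_num : 1 ≤ 4) (by omega))
    have := ha 2 le_rfl (by exact_mod_cast hx) 0.58 (by norm_num) (by norm_num)
    norm_num at this h1 h2 ⊢
    linarith
  · have h4 : (0.816 : ℝ) ≤ wgt k 1 :=
      le_trans (le_wgt (by norm_num) (by norm_num) (by norm_num))
        (wgt_one_mono (by norm_num : 1 ≤ 3) (by omega))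
    have := ha 3 (by norm_num) (by exact_mod_cast (by omega : 3 ≤ x)) 0.5 (by norm_num)
      (by norm_num)
    norm_num at this h1 h2 ⊢
    linarith

namespace RTree

/-! ### Legs -/

/-- The path with `k + 1` vertices, rooted at an end. -/
def leg : ℕ → RTree
  | 0 => node []
  | k + 1 => node [leg k]

theorem leg_succ (k : ℕ) : leg (k + 1) = node [leg k] := rfl

theorem leg_zero : leg 0 = node [] := rfl

@[simp] theorem deg_leg_zero : (leg 0).deg = 1 := rfl

@[simp] theorem deg_leg_succ (k : ℕ) : (leg (k + 1)).deg = 2 := rfl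

@[simp] theorem size_leg (k : ℕ) : (leg k).size = k + 1 := by
  induction k with
  | zero => simp [leg]
  | succ k ih => simp [leg, ih]

theorem eq_leg_zero {t : RTree} (h : t.deg = 1) : t = leg 0 := by
  obtain ⟨l⟩ := t
  simp at h
  simp [h, leg]

theorem br_arm {D : ℕ} {t : RTree} (hD : 1 ≤ D) (h : t.deg = 2) :
    br D t = wgt 2 2 + inner t := by
  rw [br, h, wgt_two_right hD]

theorem br_singleton {D : ℕ} (hD : 1 ≤ D) (t : RTree) :
    br D (node [t]) = wgt 2 2 + (wgt 2 2 + inner t) := by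
  rw [br_arm hD rfl, inner_node]
  simp [br, wgt_two_left (one_le_deg t)]

theorem inner_leg_succ (k : ℕ) : inner (leg (k + 1)) = (k + 1) * wgt 2 2 := by
  induction k with
  | zero => simp [leg, inner_node, br, wgt_two_left]
  | succ k ih =>
    rw [leg_succ, inner_node]
    simp [br, ih]
    ring

theorem br_leg_succ {D : ℕ} (hD : 1 ≤ D) (k : ℕ) : br D (leg (k + 1)) = (k + 2) * wgt 2 2 := by
  rw [br_arm hD (deg_leg_succ k), inner_leg_succ]; ring

theorem inner_leg_zero : inner (leg 0) = 0 := by simp [leg, inner_node]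

theorem br_leg_zero (D : ℕ) : br D (leg 0) = wgt D 1 := by simp [br, inner_leg_zero]

theorem wgt_two_two_le_wgt_one {D : ℕ} (hD : 2 ≤ D) : wgt 2 2 ≤ wgt D 1 := by
  rw [← wgt_two_left (le_refl 1)]
  exact wgt_one_mono (by norm_num) hD

theorem le_br_leg {D : ℕ} (hD : 2 ≤ D) (k : ℕ) : (k + 1) * wgt 2 2 ≤ br D (leg k) := by
  cases k with
  | zero =>
    rw [br_leg_zero]
    have := wgt_two_two_le_wgt_one hD
    simpa
  | succ k => rw [br_leg_succ (by omega)]; push_cast; apply le_of_eq; ring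

theorem isLeg_of_deg_le {s : RTree} (h : ∀ C u, Ctx.fill C u = s → u.deg ≤ 2) :
    ∃ k, s = leg k := by
  induction s using ind with
  | h l ih =>
    have h1 := h .hole _ rfl
    simp at h1
    match l, h1 with
    | [], _ => exact ⟨0, rfl⟩
    | [c], _ =>
      obtain ⟨k, hk⟩ := ih c (by simp) fun C u hu => h (.sub [] C []) u (by simp [hu])
      exact ⟨k + 1, by rw [leg_succ, hk]⟩

/-- Both edges at the root weigh 1/√2 whatever hangs there. If b had a branching vertex s,
exchanging a with a child z of s would force z to have degree at least that of a, so z would branch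
as well, and so on without end. -/
theorem Min.isLeg {a b : RTree} (h : Min (node [a, b])) (ha : 3 ≤ a.deg) : ∃ k, b = leg k := by
  suffices H : ∀ s C, Ctx.fill C s = b → ¬ 3 ≤ s.deg from
    isLeg_of_deg_le fun C u hu => by have := H u C hu; omega
  intro s
  induction s using ind with
  | h l ih =>
    rintro C rfl h3
    match l, h3 with
    | z :: l', h3 =>
      simp at h3
      have h1 : Ctx.fill (C.comp (.sub [] .hole l')) z = C.fill (node (z :: l')) := by
        simp [Ctx.fill_comp]
      rw [← h1] at h
      have h2 := Min.exchange h
      simp only [Ctx.hdeg_comp, Ctx.hdeg_sub, Ctx.hdeg_hole, List.length_nil, zero_add] at h2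
      rw [wgt_two_left (one_le_deg _), wgt_two_left (one_le_deg _)] at h2
      refine ih z (by simp) _ h1 ?_
      by_contra hlt
      have := wgt_strictAnti (x := l'.length + 2) (y := z.deg) (z := a.deg) (by omega)
        (one_le_deg _) (by omega)
      linarith

/-- A tree with two adjacent vertices of degree three. -/
theorem exists_tree_two_branchings {n : ℕ} (hn : 10 ≤ n) :
    ∃ t : RTree, size t = n ∧ abc t = (n - 2) * wgt 2 2 + wgt 3 3 := by
  obtain ⟨m, rfl⟩ := Nat.exists_eq_add_of_le hn
  -- Four pendant paths of length at least two at two adjacent vertices of degree three need ten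
  -- vertices; this is what the hypothesis on n provides.
  refine ⟨node [leg 1, leg 1, node [leg 1, leg (m + 1)]], by simp; omega, ?_⟩
  simp only [abc_node, brL_cons, brL_nil, br_node, List.length_cons, List.length_nil]
  rw [br_leg_succ (by norm_num), br_leg_succ (by norm_num)]
  push_cast
  norm_num
  ring

theorem wgt_three_three : wgt 3 3 < wgt 2 2 := by
  have : wgt 3 3 ≤ 0.67 := wgt_le (by norm_num) (by norm_num) (by norm_num) (by norm_num)
  linarith [le_wgt_two_two]

theorem exists_perm_cons {l : List RTree} {b : RTree} (h : b ∈ l) : ∃ l', l.Perm (b :: l') := by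
  obtain ⟨l₁, l₂, rfl⟩ := List.append_of_mem h
  exact ⟨l₁ ++ l₂, List.perm_middle⟩

/-- Otherwise all branches are legs and every edge weighs at least 1/√2, whereas the tree of
`exists_tree_two_branchings` has one edge of weight 2/3 and all others of weight 1/√2. -/
theorem Min.exists_three_le_deg {l : List RTree} (h : Min (node l)) (hl : 3 ≤ l.length)
    (hs : 10 ≤ size (node l)) : ∃ b ∈ l, 3 ≤ b.deg := by
  by_contra! hc
  have hleg : ∀ b ∈ l, ∃ k, b = leg k := by
    intro b hb
    have h2 := hc b hb
    obtain ⟨m⟩ := b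
    obtain ⟨l', hl'⟩ := exists_perm_cons hb
    have hlen := hl'.length_eq
    simp at h2 hlen
    match m, h2 with
    | [], _ => exact ⟨0, rfl⟩
    | [c], _ =>
      obtain ⟨k, hk⟩ := (h.perm hl').reroot.isLeg (by simp; omega)
      exact ⟨k + 1, by rw [leg_succ, hk]⟩
  have hbr : ∀ m : List RTree, (∀ b ∈ m, ∃ k, b = leg k) →
      (sizeL m : ℝ) * wgt 2 2 ≤ brL l.length m := by
    intro m hm
    induction m with
    | nil => simp
    | cons b m ih =>
      have h1 := ih fun b hb => hm b (by simp [hb])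
      obtain ⟨k, rfl⟩ := hm b (by simp)
      have h2 := le_br_leg (by omega : 2 ≤ l.length) k
      simp
      linarith
  obtain ⟨t, ht, ha⟩ := exists_tree_two_branchings hs
  have h1 := h t ht
  have h2 := hbr l hleg
  rw [abc_node, ha, size_node] at h1
  push_cast at h1
  linarith [wgt_three_three]

/-! ### Excluding leaves at branching vertices -/

theorem Min.fill_perm {C : Ctx} {l m r : List RTree} (h : Min (node (C.fill (node l) :: r)))
    (p : l.Perm m) : Min (node (C.fill (node m) :: r)) := by
  refine h.of_eq ?_ (le_of_eq ?_)
  · have := C.size_fill (node l) (node m)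
    simp [sizeL_perm p] at this ⊢
    omega
  · have := C.br_fill (r.length + 1) (node l) (node m)
    rw [br_node, br_node, brL_perm p, p.length_eq] at this
    simp only [abc_node, brL_cons, List.length_cons]
    linarith

theorem brL_le_add {j k : ℕ} {c : ℝ} {l : List RTree}
    (h : ∀ b ∈ l, wgt j b.deg - wgt k b.deg ≤ c) : brL j l ≤ brL k l + l.length * c := by
  induction l with
  | nil => simp
  | cons b l ih =>
    have h1 := ih fun b hb => h b (by simp [hb])
    have h2 := h b (by simp)
    simp [br]
    linarith

theorem Min.not_two_leaves {l : List RTree} (h : Min (node (leg 0 :: leg 0 :: l)))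
    (hl : 1 ≤ l.length) : False := by
  have h1 := h (node (leg 1 :: l)) (by simp; omega)
  simp only [abc_node, brL_cons, List.length_cons, br_leg_zero] at h1
  rw [br_leg_succ (by omega)] at h1
  have h2 : brL (l.length + 1) l ≤ brL (l.length + 1 + 1) l + l.length *
      ((√((l.length + 1 : ℕ) : ℝ))⁻¹ - (√((l.length + 1 + 1 : ℕ) : ℝ))⁻¹) :=
    brL_le_add fun b _ => wgt_sub_le_inv_sqrt (by omega) (by omega) (one_le_deg _)
  have h3 := two_leaves_gain (by omega : 3 ≤ l.length + 1 + 1)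
  simp only [Nat.add_sub_cancel] at h3
  push_cast at *
  ring_nf at *
  linarith

/-- Descend through branching children as long as there are any. The last clause records that the
parent of the vertex reached branches too. -/
theorem exists_outer_branching {b : RTree} (hb : 3 ≤ b.deg) : ∃ C w, Ctx.fill C w = b ∧
    3 ≤ w.deg ∧ (∀ z ∈ w.kids, z.deg ≤ 2) ∧ ∀ k, 3 ≤ k → 3 ≤ C.hdeg k := by
  induction b using ind with
  | h l ih =>
    by_cases hc : ∃ z ∈ l, 3 ≤ z.deg
    · obtain ⟨z, hz, h3⟩ := hc
      obtain ⟨C, w, hC, hw, hk, hh⟩ := ih z hz h3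
      obtain ⟨l₁, l₂, rfl⟩ := List.append_of_mem hz
      refine ⟨.sub l₁ C l₂, w, by simp [hC], hw, hk, fun k _ => ?_⟩
      simp at hb
      exact hh _ (by omega)
    · push Not at hc
      exact ⟨.hole, _, rfl, hb, fun z hz => by have := hc z hz; omega, fun k hk => hk⟩

theorem brL_pred_le {j : ℕ} (hj : 1 ≤ j) {l : List RTree} (h : ∀ b ∈ l, b.deg ≤ 2) :
    brL j l ≤ brL (j + 1) l := by
  induction l with
  | nil => simp
  | cons b l ih =>
    have h1 := ih fun b hb => h b (by simp [hb])
    have h2 := h b (by simp)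
    have h3 := one_le_deg b
    simp only [brL_cons, br]
    obtain h4 | h4 : b.deg = 1 ∨ b.deg = 2 := by omega
    · rw [h4]
      linarith [wgt_one_mono hj (by omega : j ≤ j + 1)]
    · rw [h4, wgt_two_right hj, wgt_two_right (by omega : 1 ≤ j + 1)]
      linarith

/-- The arm z is cut off its vertex and hung below the leaf. Leaves among `zs` only become cheaper
when the degree of their parent drops, so the balance is the one in `leaf_gain`. -/
theorem Min.leaf_aux {l zs : List RTree} {C : Ctx} {z : RTree}
    (h : Min (node (leg 0 :: C.fill (node (z :: zs)) :: l))) (hl : 1 ≤ l.length)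
    (hz : z.deg = 2) (hzs : ∀ b ∈ zs, b.deg ≤ 2) (hlen : 1 ≤ zs.length)
    (hkj : 2 ≤ l.length ∨ 2 ≤ zs.length) : False := by
  have hh := C.one_le_hdeg (by omega : 1 ≤ l.length + 2)
  have h1 := h (node (node [z] :: C.fill (node zs) :: l)) (by
    have := C.size_fill (node (z :: zs)) (node zs)
    simp at this ⊢
    omega)
  have h2 := C.br_fill (l.length + 2) (node (z :: zs)) (node zs)
  simp only [abc_node, brL_cons, List.length_cons, br_leg_zero, br_node, add_assoc,
    Nat.reduceAdd] at h1 h2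
  have h3 := brL_pred_le (by omega : 1 ≤ zs.length + 1) hzs
  have h4 := leaf_gain (k := l.length + 2) (h := C.hdeg (l.length + 2)) (j := zs.length + 2)
    (by omega) hh (by omega) (by omega)
  simp only [Nat.add_succ_sub_one] at h4
  rw [br_arm (by omega) hz] at h2
  simp only [List.length_nil, brL_nil, Nat.zero_add] at h1
  rw [wgt_two_right (by omega), br_arm (by omega) hz] at h1
  linarith

theorem Min.not_two_leaves_fill {C : Ctx} {l zs : List RTree}
    (h : Min (node (C.fill (node (leg 0 :: leg 0 :: zs)) :: l))) : False := by
  obtain ⟨u, hu, -⟩ := h.reroot_fill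
  exact (hu.perm (((List.Perm.swap _ _ _).cons _).symm.trans (List.perm_append_comm
    (l₁ := [u]) (l₂ := leg 0 :: leg 0 :: zs)))).not_two_leaves (by simp)

/-- The kids of an outer branching vertex, up to order: an arm first. -/
theorem Min.outer_kids {C : Ctx} {l zs : List RTree} (h : Min (node (C.fill (node zs) :: l)))
    (h3 : 2 ≤ zs.length) (hz : ∀ z ∈ zs, z.deg ≤ 2) :
    ∃ z zs', zs.Perm (z :: zs') ∧ z.deg = 2 := by
  by_cases hc : ∃ z ∈ zs, z.deg = 2
  · obtain ⟨z, hzm, hz2⟩ := hc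
    obtain ⟨zs', hp⟩ := exists_perm_cons hzm
    exact ⟨z, zs', hp, hz2⟩
  · push Not at hc
    have : ∀ z ∈ zs, z = leg 0 := fun z hm => eq_leg_zero (by
      have := hz z hm; have := hc z hm; have := one_le_deg z; omega)
    match zs, h3 with
    | a :: b :: zs, _ =>
      rw [this a (by simp), this b (by simp)] at h
      exact h.not_two_leaves_fill.elim

theorem deg_fill_eq {C : Ctx} (hC : C ≠ .hole) (x y : RTree) :
    (C.fill x).deg = (C.fill y).deg := by
  cases C with
  | hole => exact absurd rfl hC
  | sub l₁ C l₂ => simp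

/-- Unless `leaf_aux` applies, the outer branching vertex has degree three like the root. Then the
arm y leaves the root, which becomes a vertex of degree two. If the outer vertex has a leaf z', the
arm prolongs it; otherwise the arm becomes a further child of the outer vertex. -/
theorem Min.leaf_arm {y b : RTree} (h : Min (node [leg 0, y, b])) (hy : y.deg = 2)
    (hs : 10 ≤ size (node [leg 0, y, b])) : False := by
  have hb : 3 ≤ b.deg := by
    obtain ⟨c, hc, h3⟩ := h.exists_three_le_deg (by simp) hs
    simp at hc
    rcases hc with rfl | rfl | rfl
    · simp at h3
    · omega
    · exact h3
  obtain ⟨C, ⟨zs⟩, rfl, hw, hk, hh⟩ := exists_outer_branching hb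
  replace h := h.perm (List.Perm.cons _ (List.Perm.swap _ _ _))
  replace hh := hh 3 le_rfl
  simp at hw hk
  have hp : [leg 0, C.fill (node zs), y].Perm [C.fill (node zs), leg 0, y] := List.Perm.swap _ _ _
  obtain ⟨z, zs', hzp, hz⟩ := (h.perm hp).outer_kids hw hk
  have hlen := hzp.length_eq
  have hk' : ∀ b ∈ zs', b.deg ≤ 2 := fun b hb => hk b (hzp.mem_iff.2 (by simp [hb]))
  replace h := (((h.perm hp).fill_perm hzp).perm (List.Perm.swap _ _ _))
  simp at hlen
  rcases Nat.lt_or_ge zs'.length 2 with hlt | hge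
  swap
  · exact h.leaf_aux (by simp) hz hk' (by omega) (Or.inr hge)
  match zs', hlt, hlen with
  | [], _, hlen => simp at hlen; omega
  | [z'], _, _ =>
    have hz' := hk' z' (by simp)
    have hs2 := wgt_two_two_le
    have hs1 := le_wgt_two_two
    have n1 : (0.81649 : ℝ) ≤ wgt 3 1 := le_wgt (by norm_num) (by norm_num) (by norm_num)
    have e3 : 3 ≤ (C.fill (node [z, z'])).deg := by
      by_cases hC : C = .hole
      · simp [hC]
      · rw [deg_fill_eq hC _ (node zs)]; exact hb
    have n2 : (0.57735 : ℝ) ≤ wgt 3 (C.fill (node [z, z'])).deg := by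
      refine le_wgt (by norm_num) (by omega) ?_
      have : (3 : ℝ) ≤ (C.fill (node [z, z'])).deg := by exact_mod_cast e3
      norm_num
      linarith
    obtain hz1 | hz2 : z'.deg = 1 ∨ z'.deg = 2 := by have := one_le_deg z'; omega
    · obtain rfl := eq_leg_zero hz1
      have h1 := h (node [leg 0, C.fill (node [z, node [y]])]) (by
        have := C.size_fill (node [z, leg 0]) (node [z, node [y]])
        simp at this ⊢
        omega)
      have h2 := C.br_fill 3 (node [z, leg 0]) (node [z, node [y]])
      have hdeg : (C.fill (node [z, leg 0])).deg = (C.fill (node [z, node [y]])).deg := by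
        by_cases hC : C = .hole
        · simp [hC]
        · exact deg_fill_eq hC _ _
      simp only [abc_node, brL_cons, List.length_cons, br_node, br_leg_zero, List.length_nil,
        brL_nil, Nat.reduceAdd, zero_add] at h1 h2
      simp only [br, hy, hz, hdeg] at h1 h2 n2
      rw [wgt_two_left (one_le_deg _), wgt_two_right (by norm_num : 1 ≤ 3)] at h1
      rw [wgt_two_right (by norm_num : 1 ≤ 3)] at h2
      rw [wgt_two_left le_rfl] at h1
      linarith
    · by_cases hC : C = .hole
      · subst hC
        have h1 := h (node [leg 0, node [y, z, z']]) (by simp; omega)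
        have n3 : (0.66 : ℝ) ≤ wgt 3 3 := le_wgt (by norm_num) (by norm_num) (by norm_num)
        simp only [Ctx.fill_hole, abc_node, brL_cons, List.length_cons, br_node, br_leg_zero,
          List.length_nil, brL_nil, Nat.reduceAdd, zero_add] at h1
        simp only [br, hy, hz, hz2] at h1
        rw [wgt_two_left (by norm_num : 1 ≤ 1), wgt_two_left (by norm_num : 1 ≤ 4),
          wgt_two_right (by norm_num : 1 ≤ 3), wgt_two_right (by norm_num : 1 ≤ 4)] at h1
        linarith
      · have h1 := h (node [leg 0, C.fill (node [y, z, z'])]) (by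
          have := C.size_fill (node [z, z']) (node [y, z, z'])
          simp at this ⊢
          omega)
        have h2 := C.br_fill 3 (node [z, z']) (node [y, z, z'])
        have hdeg := deg_fill_eq hC (node [z, z']) (node [y, z, z'])
        have n3 : (0.666666 : ℝ) ≤ wgt 3 3 := le_wgt (by norm_num) (by norm_num) (by norm_num)
        have n4 : wgt 3 4 ≤ 0.645498 :=
          wgt_le (by norm_num) (by norm_num) (by norm_num) (by norm_num)
        -- The unknown degree h of the parent of the outer vertex enters only through f(h, 3) − f(h,
        -- 4), which is smallest at h = 3.
        have n5 := wgt_supermod (by norm_num : 2 ≤ 3) hh (by norm_num : 1 ≤ 3)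
          (by norm_num : 3 ≤ 4)
        simp only [abc_node, brL_cons, List.length_cons, br_node, br_leg_zero, List.length_nil,
          brL_nil, Nat.reduceAdd, zero_add] at h1 h2
        simp only [br, hy, hz, hz2, hdeg] at h1 h2 n2
        rw [wgt_two_left (one_le_deg _), wgt_two_right (by norm_num : 1 ≤ 3)] at h1
        rw [wgt_two_right (by norm_num : 1 ≤ 3), wgt_two_right (by norm_num : 1 ≤ 4)] at h2
        rw [wgt_two_left le_rfl] at h1
        linarith

/-- What `leaf_aux` leaves open is that both vertices have degree three. If the third branch at the
root is large, the leaf can be exchanged for free with an arm of the outer vertex, which then has a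
leaf next to another leaf or to an arm; these cases are excluded already. -/
theorem Min.no_leaf {l : List RTree} (h : Min (node (leg 0 :: l))) (hl : 2 ≤ l.length)
    (hs : 10 ≤ size (node (leg 0 :: l))) : False := by
  obtain ⟨b, hbl, hb⟩ := h.exists_three_le_deg (by simp; omega) hs
  simp at hbl
  rcases hbl with rfl | hbl
  · simp at hb
  obtain ⟨l', hl'⟩ := exists_perm_cons hbl
  have hsz := sizeL_perm hl'
  have hlen := hl'.length_eq
  simp at hlen
  replace h := h.perm (hl'.cons _)
  obtain ⟨C, ⟨zs⟩, rfl, hw, hk, hh⟩ := exists_outer_branching hb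
  simp at hw hk
  have h' := h.perm (List.Perm.swap _ _ _)
  obtain ⟨z, zs', hzp, hz⟩ := h'.outer_kids hw hk
  have hk' : ∀ b ∈ zs', b.deg ≤ 2 := fun b hb => hk b (hzp.mem_iff.2 (by simp [hb]))
  have hlen2 := hzp.length_eq
  simp at hlen2
  replace h := (h'.fill_perm hzp).perm (List.Perm.swap _ _ _)
  have hsz' := C.size_fill (node zs) (node (z :: zs'))
  have hsz2 := sizeL_perm hzp
  by_cases hkj : 2 ≤ l'.length ∨ 2 ≤ zs'.length
  · exact h.leaf_aux (by omega) hz hk' (by omega) hkj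
  match l', zs', hkj, hlen2, hlen with
  | [], _, _, _, hlen => simp at hlen; omega
  | _ :: _ :: _, _, hkj, _, _ => simp at hkj
  | _, [], _, hlen2, _ => simp at hlen2; omega
  | _, _ :: _ :: _, hkj, _, _ => simp at hkj
  | [y], [z'], _, _, _ =>
    simp at hsz hsz' hsz2 hs
    rcases Nat.lt_or_ge y.deg 3 with hy | hy
    · obtain hy1 | hy2 : y.deg = 1 ∨ y.deg = 2 := by have := one_le_deg y; omega
      · obtain rfl := eq_leg_zero hy1
        exact (h.perm (List.Perm.cons _ (List.Perm.swap _ _ _))).not_two_leaves (by simp)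
      · exact (h.perm (List.Perm.cons _ (List.Perm.swap _ _ _))).leaf_arm hy2 (by simp; omega)
    · have h4 : Min (node (leg 0 :: (C.comp (.sub [] .hole [z'])).fill z :: [y])) := by
        simpa [Ctx.fill_comp] using h
      have h5 := h4.swap (by simp [Ctx.hdeg_comp])
      simp only [Ctx.fill_comp, Ctx.fill_sub, Ctx.fill_hole, List.nil_append] at h5
      have h6 := h5.perm (List.Perm.swap _ _ _)
      obtain ⟨u, hu, -, hsu⟩ := h6.reroot_fill
      have hp : [u, leg 0, z'].Perm [leg 0, z', u] := List.perm_append_comm (l₁ := [u])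
      have hz' := hk' z' (by simp)
      obtain hz1 | hz2 : z'.deg = 1 ∨ z'.deg = 2 := by have := one_le_deg z'; omega
      · obtain rfl := eq_leg_zero hz1
        exact (hu.perm hp).not_two_leaves (by simp)
      · refine (hu.perm hp).leaf_arm hz2 ?_
        have := C.size_fill (node [leg 0, z']) (node [z, z'])
        simp at this hsu ⊢
        omega

/-! ### Legs have one or two edges -/

/-- When the degree of the parent grows, arms keep their weight, and by monotone differences each
larger branch gains at least as much as one of degree three. -/
theorem brL_anti {D D' : ℕ} (hD : D ≤ D') (h1 : 1 ≤ D) {l : List RTree} (h : ∀ b ∈ l, 2 ≤ b.deg) :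
    brL D' l + l.countP (3 ≤ ·.deg) * (wgt D 3 - wgt D' 3) ≤ brL D l := by
  induction l with
  | nil => simp
  | cons b l ih =>
    have h2 := ih fun b hb => h b (by simp [hb])
    have h3 := h b (by simp)
    have h4 := wgt_anti_left h3 h1 hD
    simp only [brL_cons, br, List.countP_cons]
    split_ifs with h5
    · have := wgt_supermod (by norm_num : 2 ≤ 3) (of_decide_eq_true h5) h1 hD
      rw [wgt_comm 3, wgt_comm 3, wgt_comm b.deg, wgt_comm b.deg] at this
      push_cast
      linarith
    · simp
      linarith

theorem brL_strictAnti {D D' : ℕ} (hD : D < D') (h1 : 1 ≤ D) {l : List RTree}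
    (h : ∀ b ∈ l, 2 ≤ b.deg) (h3 : ∃ b ∈ l, 3 ≤ b.deg) : brL D' l < brL D l := by
  have h4 := brL_anti hD.le h1 h
  have h5 : (1 : ℝ) ≤ l.countP (3 ≤ ·.deg) := by
    exact_mod_cast List.countP_pos_iff.2 (by simpa using h3)
  have h6 := wgt_strictAnti (le_refl 3) h1 hD
  rw [wgt_comm, wgt_comm 3] at h6
  nlinarith

theorem Min.two_le_deg {l : List RTree} (h : Min (node l)) (hl : 3 ≤ l.length)
    (hs : 10 ≤ size (node l)) {b : RTree} (hb : b ∈ l) : 2 ≤ b.deg := by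
  by_contra! hlt
  obtain rfl := eq_leg_zero (by have := one_le_deg b; omega : b.deg = 1)
  obtain ⟨l', hl'⟩ := exists_perm_cons hb
  have := hl'.length_eq
  have hp := sizeL_perm hl'
  simp at this
  exact (h.perm hl').no_leaf (by omega) (by simp at hs hp ⊢; omega)

/-- Replacing two legs by three strictly decreases the ABC index. -/
theorem Min.no_split {l m m' : List RTree} (h : Min (node (m ++ l)))
    (hm : m'.length = m.length + 1) (hs' : sizeL m' = sizeL m) (hm2 : ∀ b ∈ m, b.deg = 2)
    (hb : ∀ D, 1 ≤ D → brL (D + 1) m' = brL D m)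
    (hl : 3 ≤ (m ++ l).length) (hs : 10 ≤ size (node (m ++ l))) : False := by
  have h1 := h (node (m' ++ l)) (by simp [hs'])
  have h2 := hb (m ++ l).length (by omega)
  simp only [abc_node, brL_append] at h1
  rw [show (m' ++ l).length = (m ++ l).length + 1 by simp [hm]; omega, h2] at h1
  have h3 : brL ((m ++ l).length + 1) l < brL (m ++ l).length l := by
    refine brL_strictAnti (by omega) (by omega)
      (fun b hb => h.two_le_deg hl hs (by simp [hb])) ?_
    obtain ⟨b, hb, h4⟩ := h.exists_three_le_deg hl hs
    rw [List.mem_append] at hb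
    rcases hb with hb | hb
    · have := hm2 b hb; omega
    · exact ⟨b, hb, h4⟩
  linarith

/-- A pendant path of length at least four is split into one of length two and one of length at
least two. -/
theorem Min.no_long_leg {l : List RTree} {k : ℕ} (h : Min (node (leg (k + 3) :: l)))
    (hl : 2 ≤ l.length) (hs : 10 ≤ size (node (leg (k + 3) :: l))) : False := by
  refine Min.no_split (m := [leg (k + 3)]) (m' := [leg 1, leg (k + 1)]) h rfl (by simp; omega)
    (by simp) (fun D hD => ?_) (by simp; omega) hs
  simp only [brL_cons, brL_nil]
  rw [br_leg_succ (by omega), br_leg_succ (by omega), br_leg_succ (by omega)]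
  push_cast; ring

/-- Two pendant paths of length three have as many vertices as three of length two. -/
theorem Min.no_two_long_legs {l : List RTree} (h : Min (node (leg 2 :: leg 2 :: l)))
    (hl : 1 ≤ l.length) (hs : 10 ≤ size (node (leg 2 :: leg 2 :: l))) : False := by
  refine Min.no_split (m := [leg 2, leg 2]) (m' := [leg 1, leg 1, leg 1]) h rfl (by simp)
    (by simp) (fun D hD => ?_) (by simp; omega) hs
  simp only [brL_cons, brL_nil]
  rw [br_leg_succ (by omega), br_leg_succ (by omega)]
  push_cast; ring

/-- Branches whose leaves all lie on legs with one or two edges. -/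
inductive Good : RTree → Prop
  | one : Good (leg 1)
  | two : Good (leg 2)
  | node (l : List RTree) : 2 ≤ l.length → (∀ b ∈ l, Good b) → Good (node l)

theorem Good.two_le_deg {b : RTree} (h : Good b) : 2 ≤ b.deg := by
  cases h <;> simp; omega

theorem Good.eq_leg {b : RTree} (h : Good b) (hd : b.deg = 2) : b = leg 1 ∨ b = leg 2 := by
  cases h with
  | one => simp
  | two => simp
  | node l hl _ => simp at hd; omega

theorem Good.kids {b c : RTree} (h : Good b) (hd : 3 ≤ b.deg) (hc : c ∈ b.kids) : Good c := by
  cases h with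
  | one => simp at hd
  | two => simp at hd
  | node l hl h => exact h c hc

/-- After rerooting, the statements about the root apply to every branching vertex; a branch with a
single child is a leg by `Min.isLeg`, since the old root is large as seen from it. -/
theorem Min.good {b : RTree} {l : List RTree} (h : Min (RTree.node (b :: l))) (hl : 2 ≤ l.length)
    (hs : 10 ≤ size (RTree.node (b :: l))) : Good b := by
  induction b using ind generalizing l with
  | h m ih =>
    rcases Nat.lt_or_ge m.length 2 with hlt | hge
    · match m, hlt with
      | [], _ => exact (h.no_leaf hl hs).elim
      | [c], _ =>
        obtain ⟨k, rfl⟩ := h.reroot.isLeg (by simp; omega)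
        rw [← leg_succ] at h hs ⊢
        match k, h, hs with
        | 0, _, _ => exact .one
        | 1, _, _ => exact .two
        | k + 2, h, hs => exact (h.no_long_leg hl hs).elim
    · refine .node m hge fun t ht => ?_
      obtain ⟨m', hm'⟩ := exists_perm_cons ht
      have h1 := h.reroot.perm ((hm'.cons _).trans (List.Perm.swap _ _ _))
      have h2 := hm'.length_eq
      have h3 := sizeL_perm hm'
      simp at h2
      exact ih t ht h1 (by simp; omega) (by simp at hs h3 ⊢; omega)

end RTree

/-! ### Estimates for local moves -/

/-- Linear upper bounds for the weights with a fixed second degree. -/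
theorem wgt_le_linear {x y : ℕ} {a b : ℝ} (hx : 1 ≤ x) (hy : 1 ≤ y) (ha : 0 ≤ a) (hb : 0 ≤ b)
    (h1 : 1 ≤ a ^ 2 * y) (h2 : (y : ℝ) - 2 ≤ 2 * a * b * y) : wgt x y ≤ a + b / x := by
  have hx' : (0 : ℝ) < x := by exact_mod_cast hx
  have hy' : (0 : ℝ) < y := by exact_mod_cast hy
  refine wgt_le (by positivity) hx hy ?_
  -- Later choices have a near 1/√y and b near (y − 2)/(2√y), the first two terms of the expansion
  -- of the weight in 1/x.
  have : (a + b / x) ^ 2 * (x * y) = a ^ 2 * y * x + 2 * a * b * y + b ^ 2 * y / x := by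
    field_simp
    ring
  rw [this]
  have h3 : 0 ≤ b ^ 2 * y / x := by positivity
  nlinarith

/-- Linear lower bounds for the weights with a fixed second degree. -/
theorem linear_le_wgt {x y n : ℕ} {a b : ℝ} (hn : 1 ≤ n) (hx : n ≤ x) (hy : 1 ≤ y)
    (h1 : a ^ 2 * y ≤ 1) (h2 : 2 * a * b * y + b ^ 2 * y / n ≤ y - 2) :
    a + b / x ≤ wgt x y := by
  have hn' : (0 : ℝ) < n := by exact_mod_cast hn
  have hx' : (n : ℝ) ≤ x := by exact_mod_cast hx
  have hx0 : (0 : ℝ) < x := by linarith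
  refine le_wgt (by omega) hy ?_
  have : (a + b / x) ^ 2 * (x * y) = a ^ 2 * y * x + 2 * a * b * y + b ^ 2 * y / x := by
    field_simp
    ring
  rw [this]
  have h3 : b ^ 2 * y / x ≤ b ^ 2 * y / n := by gcongr
  nlinarith

/-- The gain at an edge towards a vertex of degree three. -/
theorem le_wgt_three_sub {D : ℕ} {c : ℝ} (hD : 2 ≤ D) (hc : wgt D 3 ≤ c) :
    1 / (6 * c * (D * (D + 1))) ≤ wgt D 3 - wgt (D + 1) 3 := by
  have h := wgt_sub (by norm_num : 2 ≤ 3) (by omega : 1 ≤ D) (by omega : 1 ≤ D + 1)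
  rw [wgt_comm 3, wgt_comm 3] at h
  have h1 := wgt_anti_left (by norm_num : 2 ≤ 3) (by omega : 1 ≤ D) (by omega : D ≤ D + 1)
  have h0 : 0 < wgt D 3 := wgt_pos (by omega) (by norm_num)
  have hD' : (0 : ℝ) < D := by exact_mod_cast (by omega : 0 < D)
  have h2 : (1 - 2 / ((3 : ℕ) : ℝ)) * (1 / D - 1 / ((D + 1 : ℕ) : ℝ)) = 1 / (3 * (D * (D + 1))) := by
    push_cast; field_simp; ring
  rw [h2] at h
  have hc0 : 0 < c := h0.trans_le hc
  rw [div_le_iff₀ (by positivity)]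
  rw [eq_div_iff (by positivity)] at h
  have h3 : (wgt D 3 - wgt (D + 1) 3) * (wgt D 3 + wgt (D + 1) 3) ≤
      (wgt D 3 - wgt (D + 1) 3) * (2 * c) := by
    have : 0 ≤ wgt D 3 - wgt (D + 1) 3 := by linarith
    gcongr
    linarith
  nlinarith [mul_pos hD' (by linarith : (0 : ℝ) < D + 1)]

/-- An edge between degrees 3 and D is contracted and the vertex saved prolongs an arm, at the price
of one more edge of weight 1/√2. By monotone differences e₁ = e₂ = 3 is the worst case. -/
theorem contract_three_gain {D e₁ e₂ : ℕ} (hD : 3 ≤ D) (h1 : 3 ≤ e₁) (h2 : 3 ≤ e₂) :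
    wgt 2 2 + wgt (D + 1) e₁ + wgt (D + 1) e₂ < wgt D 3 + wgt 3 e₁ + wgt 3 e₂ := by
  have hs := wgt_two_two_le
  have m1 := wgt_supermod (by norm_num : 2 ≤ 3) h1 (by norm_num : 1 ≤ 3) (by omega : 3 ≤ D + 1)
  have m2 := wgt_supermod (by norm_num : 2 ≤ 3) h2 (by norm_num : 1 ≤ 3) (by omega : 3 ≤ D + 1)
  rw [wgt_comm e₁, wgt_comm e₁, wgt_comm 3 (D + 1)] at m1
  rw [wgt_comm e₂, wgt_comm e₂, wgt_comm 3 (D + 1)] at m2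
  have u4_3 : wgt 4 3 ≤ 0.6454973 :=
    wgt_le (by norm_num) (by norm_num) (by norm_num) (by norm_num)
  have u5_3 : wgt 5 3 ≤ 0.6324556 :=
    wgt_le (by norm_num) (by norm_num) (by norm_num) (by norm_num)
  have u6_3 : wgt 6 3 ≤ 0.6236096 :=
    wgt_le (by norm_num) (by norm_num) (by norm_num) (by norm_num)
  have l3_3 : 0.6666666 ≤ wgt 3 3 :=
    le_wgt (by norm_num) (by norm_num) (by norm_num)
  have l4_3 : 0.6454972 ≤ wgt 4 3 :=
    le_wgt (by norm_num) (by norm_num) (by norm_num)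
  obtain rfl | rfl | hD : D = 3 ∨ D = 4 ∨ 5 ≤ D := by omega
  · norm_num at *; linarith
  · norm_num at *; linarith
  · have m3 := wgt_anti_left (by norm_num : 2 ≤ 3) (by omega : 1 ≤ D) (by omega : D ≤ D + 1)
    have m4 := wgt_anti_left (by norm_num : 2 ≤ 3) (by norm_num : 1 ≤ 6) (by omega : 6 ≤ D + 1)
    linarith

/-- Contracting the edge between a vertex of degree four with one arm and a larger vertex. -/
theorem contract_four_gain {D e₁ e₂ : ℕ} (hD : 5 ≤ D) (h1 : e₁ = 3 ∨ e₁ = 4) (h2 : 3 ≤ e₂) :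
    wgt 2 2 + wgt (D + 1) (e₁ + 1) + wgt (D + 1) e₂ <
      wgt D 4 + wgt 4 e₁ + wgt 4 e₂ + (D - 1) * (wgt D 3 - wgt (D + 1) 3) := by
  have hs := wgt_two_two_le
  have hD' : (5 : ℝ) ≤ D := by exact_mod_cast hD
  have m2 := wgt_supermod (by norm_num : 2 ≤ 3) h2 (by norm_num : 1 ≤ 4) (by omega : 4 ≤ D + 1)
  rw [wgt_comm e₂, wgt_comm e₂, wgt_comm 3, wgt_comm 3] at m2
  have b3 : wgt (D + 1) 3 ≤ 0.57736 + 0.28868 / (D + 1 : ℕ) :=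
    wgt_le_linear (by omega) (by norm_num) (by norm_num) (by norm_num) (by norm_num) (by norm_num)
  have b3' : wgt D 3 ≤ 0.57736 + 0.28868 / D :=
    wgt_le_linear (by omega) (by norm_num) (by norm_num) (by norm_num) (by norm_num) (by norm_num)
  have hbon := le_wgt_three_sub (by omega) b3'
  have l4_3 : 0.6454972 ≤ wgt 4 3 :=
    le_wgt (by norm_num) (by norm_num) (by norm_num)
  have l4_4 : 0.6123724 ≤ wgt 4 4 :=
    le_wgt (by norm_num) (by norm_num) (by norm_num)
  rcases h1 with rfl | rfl
  · have h4 := wgt_sub (by norm_num : 2 ≤ 4) (by omega : 1 ≤ D) (by omega : 1 ≤ D + 1)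
    rw [wgt_comm 4, wgt_comm 4] at h4
    have h5 : wgt D 4 ≤ 0.592 := (wgt_anti_left (by norm_num) (by norm_num) hD).trans
      (wgt_le (by norm_num) (by norm_num) (by norm_num) (by norm_num))
    have h6 := wgt_anti_left (by norm_num : 2 ≤ 4) (by omega : 1 ≤ D) (by omega : D ≤ D + 1)
    have h7 : (0.42 : ℝ) / (D * (D + 1)) ≤ wgt D 4 - wgt (D + 1) 4 := by
      have e : (1 - 2 / ((4 : ℕ) : ℝ)) * (1 / D - 1 / ((D + 1 : ℕ) : ℝ)) = 0.5 / (D * (D + 1)) := by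
        push_cast; field_simp; norm_num
      rw [e, eq_div_iff (by positivity)] at h4
      rw [div_le_iff₀ (by positivity)]
      have h8 : (wgt D 4 - wgt (D + 1) 4) * (wgt D 4 + wgt (D + 1) 4) ≤
          (wgt D 4 - wgt (D + 1) 4) * 1.184 := by
        have : 0 ≤ wgt D 4 - wgt (D + 1) 4 := by linarith
        gcongr
        linarith
      nlinarith [mul_pos (by linarith : (0 : ℝ) < D) (by linarith : (0 : ℝ) < D + 1)]
    -- Both the coefficient 0.28868 in `b3` and 1/(6 · 0.57736) approximate 1/(2√3), so the bonus of
    -- the D − 1 edges nearly cancels the leading error term.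
    have h9 : (0.288 : ℝ) / (D + 1) - 0.433 / (D * (D + 1)) ≤
        (D - 1) * (1 / (6 * (0.57736 + 0.28868 / D) * (D * (D + 1)))) := by
      have : (D - 1 : ℝ) * (1 / (6 * (0.57736 + 0.28868 / D) * (D * (D + 1)))) -
          (0.288 / (D + 1) - 0.433 / (D * (D + 1))) =
          ((D - 1) * D - (0.288 * D - 0.433) * (6 * (0.57736 * D + 0.28868))) /
            ((6 * (0.57736 * D + 0.28868)) * (D * (D + 1))) := by
        field_simp
      rw [← sub_nonneg, this]
      apply div_nonneg
      · nlinarith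
      · positivity
    have h10 : (D - 1 : ℝ) * (1 / (6 * (0.57736 + 0.28868 / D) * (D * (D + 1)))) ≤
        (D - 1) * (wgt D 3 - wgt (D + 1) 3) := by
      have : (0 : ℝ) ≤ D - 1 := by linarith
      gcongr
    have h11 : (0.28868 : ℝ) / (D + 1 : ℕ) - 0.288 / (D + 1) + 0.433 / (D * (D + 1))
        - 0.42 / (D * (D + 1)) ≤ 0.001 := by
      have : (0.28868 : ℝ) / (D + 1 : ℕ) - 0.288 / (D + 1) + 0.433 / (D * (D + 1))
        - 0.42 / (D * (D + 1)) = (0.00068 * D + 0.013) / (D * (D + 1)) := by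
        push_cast
        field_simp
        norm_num
        ring
      rw [this, div_le_iff₀ (by positivity)]
      nlinarith
    linarith
  · rcases Nat.lt_or_ge D 9 with hlt | hge
    · clear b3 b3' hbon
      interval_cases D
      · have u6_5 : wgt 6 5 ≤ 0.5477226 :=
          wgt_le (by norm_num) (by norm_num) (by norm_num) (by norm_num)
        have u6_3 : wgt 6 3 ≤ 0.6236096 :=
          wgt_le (by norm_num) (by norm_num) (by norm_num) (by norm_num)
        have l5_4 : 0.5916079 ≤ wgt 5 4 :=
          le_wgt (by norm_num) (by norm_num) (by norm_num)
        have l5_3 : 0.6324555 ≤ wgt 5 3 :=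
          le_wgt (by norm_num) (by norm_num) (by norm_num)
        norm_num at *
        linarith
      · have u7_5 : wgt 7 5 ≤ 0.5345225 :=
          wgt_le (by norm_num) (by norm_num) (by norm_num) (by norm_num)
        have u7_3 : wgt 7 3 ≤ 0.6172134 :=
          wgt_le (by norm_num) (by norm_num) (by norm_num) (by norm_num)
        have l6_4 : 0.5773502 ≤ wgt 6 4 :=
          le_wgt (by norm_num) (by norm_num) (by norm_num)
        have l6_3 : 0.6236095 ≤ wgt 6 3 :=
          le_wgt (by norm_num) (by norm_num) (by norm_num)
        norm_num at *
        linarith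
      · have u8_5 : wgt 8 5 ≤ 0.5244045 :=
          wgt_le (by norm_num) (by norm_num) (by norm_num) (by norm_num)
        have u8_3 : wgt 8 3 ≤ 0.6123725 :=
          wgt_le (by norm_num) (by norm_num) (by norm_num) (by norm_num)
        have l7_4 : 0.5669467 ≤ wgt 7 4 :=
          le_wgt (by norm_num) (by norm_num) (by norm_num)
        have l7_3 : 0.6172133 ≤ wgt 7 3 :=
          le_wgt (by norm_num) (by norm_num) (by norm_num)
        norm_num at *
        linarith
      · have u9_5 : wgt 9 5 ≤ 0.5163978 :=
          wgt_le (by norm_num) (by norm_num) (by norm_num) (by norm_num)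
        have u9_3 : wgt 9 3 ≤ 0.6085807 :=
          wgt_le (by norm_num) (by norm_num) (by norm_num) (by norm_num)
        have l8_4 : 0.5590169 ≤ wgt 8 4 :=
          le_wgt (by norm_num) (by norm_num) (by norm_num)
        have l8_3 : 0.6123724 ≤ wgt 8 3 :=
          le_wgt (by norm_num) (by norm_num) (by norm_num)
        norm_num at *
        linarith
    · have b5 : wgt (D + 1) 5 ≤ 0.44722 + 0.6709 / (D + 1 : ℕ) :=
        wgt_le_linear (by omega) (by norm_num) (by norm_num) (by norm_num) (by norm_num)
          (by norm_num)
      have b4 : 0.5 + 0.475 / (D + 1 : ℕ) ≤ wgt (D + 1) 4 :=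
        linear_le_wgt (n := 10) (by norm_num) (by omega) (by norm_num) (by norm_num) (by norm_num)
      have h6 := wgt_anti_left (by norm_num : 2 ≤ 4) (by omega : 1 ≤ D) (by omega : D ≤ D + 1)
      have hD9 : (9 : ℝ) ≤ D := by exact_mod_cast hge
      have c3 : wgt D 3 ≤ 0.6095 := (wgt_anti_left (by norm_num) (by norm_num) hge).trans
        (wgt_le (by norm_num) (by norm_num) (by norm_num) (by norm_num))
      have hbon := le_wgt_three_sub (by omega) c3
      have h9 : (0.243 : ℝ) / (D + 1) ≤ (D - 1) * (1 / (6 * 0.6095 * (D * (D + 1)))) := by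
        rw [← sub_nonneg]
        have : (D - 1 : ℝ) * (1 / (6 * 0.6095 * (D * (D + 1)))) - 0.243 / (D + 1) =
          (D - 1 - 0.243 * 3.657 * D) / (3.657 * (D * (D + 1))) := by
          field_simp
          ring
        rw [this]
        apply div_nonneg
        · nlinarith
        · positivity
      have h10 : (D - 1 : ℝ) * (1 / (6 * 0.6095 * (D * (D + 1)))) ≤
          (D - 1) * (wgt D 3 - wgt (D + 1) 3) := by
        have : (0 : ℝ) ≤ D - 1 := by linarith
        gcongr
      have ht : (1 : ℝ) / (D + 1) ≤ 0.1 := by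
        rw [div_le_iff₀ (by linarith)]; linarith
      have ht0 : (0 : ℝ) ≤ 1 / (D + 1) := by positivity
      push_cast at *
      rw [div_eq_mul_one_div] at b3 b5 b4 h9
      norm_num at *
      linarith

/-- Moving a branch of degree at least three from a vertex with `k` arms to its neighbour. -/
theorem move_gain {k D e B : ℕ} (hk : k = 2 ∧ D = 4 ∨ (k = 3 ∨ k = 4) ∧ k + 2 ≤ D) (he : 3 ≤ e)
    (hB : 1 ≤ B) (hB' : k + 2 < D → D - 1 ≤ B) :
    wgt (D + 1) (k + 1) + wgt (D + 1) e <
      wgt D (k + 2) + wgt (k + 2) e + B * (wgt D 3 - wgt (D + 1) 3) := by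
  have m2 := wgt_supermod (by norm_num : 2 ≤ 3) he (by omega : 1 ≤ k + 2) (by omega : k + 2 ≤ D + 1)
  rw [wgt_comm e, wgt_comm e, wgt_comm 3, wgt_comm 3] at m2
  have h6 := wgt_anti_left (by norm_num : 2 ≤ 3) (by omega : 1 ≤ D) (by omega : D ≤ D + 1)
  obtain rfl | hlt : D = k + 2 ∨ k + 2 < D := by omega
  · have h7 : 1 * (wgt (k + 2) 3 - wgt (k + 2 + 1) 3) ≤
        B * (wgt (k + 2) 3 - wgt (k + 2 + 1) 3) := by
      have : (1 : ℝ) ≤ B := by exact_mod_cast hB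
      have : 0 ≤ wgt (k + 2) 3 - wgt (k + 2 + 1) 3 := by linarith
      gcongr
    obtain rfl | rfl | rfl : k = 2 ∨ k = 3 ∨ k = 4 := by omega
    · have u5_3 : wgt 5 3 ≤ 0.6324556 :=
        wgt_le (by norm_num) (by norm_num) (by norm_num) (by norm_num)
      have l4_4 : 0.6123724 ≤ wgt 4 4 :=
        le_wgt (by norm_num) (by norm_num) (by norm_num)
      have l4_3 : 0.6454972 ≤ wgt 4 3 :=
        le_wgt (by norm_num) (by norm_num) (by norm_num)
      norm_num at *
      linarith
    · have u6_4 : wgt 6 4 ≤ 0.5773503 :=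
        wgt_le (by norm_num) (by norm_num) (by norm_num) (by norm_num)
      have u6_3 : wgt 6 3 ≤ 0.6236096 :=
        wgt_le (by norm_num) (by norm_num) (by norm_num) (by norm_num)
      have l5_5 : 0.5656854 ≤ wgt 5 5 :=
        le_wgt (by norm_num) (by norm_num) (by norm_num)
      have l5_3 : 0.6324555 ≤ wgt 5 3 :=
        le_wgt (by norm_num) (by norm_num) (by norm_num)
      norm_num at *
      linarith
    · have u7_5 : wgt 7 5 ≤ 0.5345225 :=
        wgt_le (by norm_num) (by norm_num) (by norm_num) (by norm_num)
      have u7_3 : wgt 7 3 ≤ 0.6172134 :=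
        wgt_le (by norm_num) (by norm_num) (by norm_num) (by norm_num)
      have l6_6 : 0.5270462 ≤ wgt 6 6 :=
        le_wgt (by norm_num) (by norm_num) (by norm_num)
      have l6_3 : 0.6236095 ≤ wgt 6 3 :=
        le_wgt (by norm_num) (by norm_num) (by norm_num)
      norm_num at *
      linarith
  · have hB2 := hB' hlt
    have h7 : ((D : ℝ) - 1) * (wgt D 3 - wgt (D + 1) 3) ≤ B * (wgt D 3 - wgt (D + 1) 3) := by
      have : (D : ℝ) - 1 ≤ B := by
        have : ((D - 1 : ℕ) : ℝ) ≤ B := by exact_mod_cast hB2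
        rw [Nat.cast_sub (by omega)] at this
        simpa using this
      have : 0 ≤ wgt D 3 - wgt (D + 1) 3 := by linarith
      gcongr
    have b3 : wgt (D + 1) 3 ≤ 0.57736 + 0.28868 / (D + 1 : ℕ) :=
      wgt_le_linear (by omega) (by norm_num) (by norm_num) (by norm_num) (by norm_num)
        (by norm_num)
    have hD6 : 6 ≤ D := by omega
    have hD' : (6 : ℝ) ≤ D := by exact_mod_cast hD6
    have c3 : wgt D 3 ≤ 0.6237 := (wgt_anti_left (by norm_num) (by norm_num) hD6).trans
      (wgt_le (by norm_num) (by norm_num) (by norm_num) (by norm_num))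
    have hbon := le_wgt_three_sub (by omega) c3
    have h9 : (0.2226 : ℝ) / (D + 1) ≤ (D - 1) * (1 / (6 * 0.6237 * (D * (D + 1)))) := by
      rw [← sub_nonneg]
      have : (D - 1 : ℝ) * (1 / (6 * 0.6237 * (D * (D + 1)))) - 0.2226 / (D + 1) =
        (D - 1 - 0.2226 * 3.7422 * D) / (3.7422 * (D * (D + 1))) := by
        field_simp
        ring
      rw [this]
      apply div_nonneg
      · nlinarith
      · positivity
    have h10 : (D - 1 : ℝ) * (1 / (6 * 0.6237 * (D * (D + 1)))) ≤
        (D - 1) * (wgt D 3 - wgt (D + 1) 3) := by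
      have : (0 : ℝ) ≤ D - 1 := by linarith
      gcongr
    have ht0 : (0 : ℝ) ≤ 1 / (D + 1) := by positivity
    have ht : (1 : ℝ) / (D + 1) ≤ 1 / 7 := by
      apply one_div_le_one_div_of_le <;> linarith
    obtain rfl | rfl : k = 3 ∨ k = 4 := by omega
    · have b4 : wgt (D + 1) 4 ≤ 0.5 + 0.5 / (D + 1 : ℕ) :=
        wgt_le_linear (by omega) (by norm_num) (by norm_num) (by norm_num) (by norm_num)
          (by norm_num)
      have b5 : 0.4472 + 0.605 / (D + 1 : ℕ) ≤ wgt (D + 1) 5 :=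
        linear_le_wgt (n := 7) (by norm_num) (by omega) (by norm_num) (by norm_num) (by norm_num)
      have h5 := wgt_anti_left (by norm_num : 2 ≤ 5) (by omega : 1 ≤ D) (by omega : D ≤ D + 1)
      have l5_3 : 0.6324555 ≤ wgt 5 3 :=
        le_wgt (by norm_num) (by norm_num) (by norm_num)
      push_cast at *
      rw [div_eq_mul_one_div] at b3 b5 b4 h9
      norm_num at *
      have hti : (0 : ℝ) ≤ ((D : ℝ) + 1)⁻¹ := by positivity
      linarith
    · have b4 : wgt (D + 1) 5 ≤ 0.44722 + 0.6709 / (D + 1 : ℕ) :=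
        wgt_le_linear (by omega) (by norm_num) (by norm_num) (by norm_num) (by norm_num)
          (by norm_num)
      have b5 : 0.408 + 0.73 / (D + 1 : ℕ) ≤ wgt (D + 1) 6 :=
        linear_le_wgt (n := 8) (by norm_num) (by omega) (by norm_num) (by norm_num) (by norm_num)
      have h5 := wgt_anti_left (by norm_num : 2 ≤ 6) (by omega : 1 ≤ D) (by omega : D ≤ D + 1)
      have l6_3 : 0.6236095 ≤ wgt 6 3 :=
        le_wgt (by norm_num) (by norm_num) (by norm_num)
      push_cast at *
      rw [div_eq_mul_one_div] at b3 b5 b4 h9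
      norm_num at *
      have hti : (0 : ℝ) ≤ ((D : ℝ) + 1)⁻¹ := by positivity
      linarith

/-- The loss at an arbitrary neighbour is at most twice the loss at a neighbour of equal degree. -/
theorem wgt_sub_le_two_mul {x j D : ℕ} (hx : 2 ≤ x) (hj : j ≤ 2) (h7 : 7 ≤ x + j) (hD : 1 ≤ D) :
    wgt x D - wgt (x + j) D ≤ 2 * (wgt x (x + j) - wgt (x + j) (x + j)) := by
  refine (wgt_sub_le_inv_sqrt hx (by omega) hD).trans ?_
  have hx' : (2 : ℝ) ≤ x := by exact_mod_cast hx
  have hj' : (j : ℝ) ≤ 2 := by exact_mod_cast hj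
  have hj0 : (0 : ℝ) ≤ j := j.cast_nonneg
  have h7' : (7 : ℝ) ≤ (x + j : ℕ) := by exact_mod_cast h7
  have hab := inv_sqrt_anti (by omega : 1 ≤ x) (by omega : x ≤ x + j)
  have ha : 0 < (√(x : ℝ))⁻¹ := by positivity
  have hb : 0 < (√((x + j : ℕ) : ℝ))⁻¹ := by positivity
  have ha2 : (√(x : ℝ))⁻¹ ^ 2 = 1 / x := by rw [inv_pow, Real.sq_sqrt (by positivity), one_div]
  have hb2 : (√((x + j : ℕ) : ℝ))⁻¹ ^ 2 = 1 / (x + j : ℕ) := by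
    rw [inv_pow, Real.sq_sqrt (by positivity), one_div]
  have h := wgt_sub (by omega : 2 ≤ x + j) (by omega : 1 ≤ x) (by omega : 1 ≤ x + j)
  rw [wgt_comm (x + j) x] at h
  have w1 : wgt x (x + j) ≤ 1.4143 * (√(x : ℝ))⁻¹ := by
    refine wgt_le (by positivity) (by omega) (by omega) ?_
    rw [mul_pow, ha2]
    field_simp
    push_cast
    norm_num
    linarith
  have w2 : wgt (x + j) (x + j) ≤ 1.4143 * (√((x + j : ℕ) : ℝ))⁻¹ := by
    refine wgt_le (by positivity) (by omega) (by omega) ?_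
    rw [mul_pow, hb2]
    field_simp
    push_cast
    norm_num
    linarith
  have hm := wgt_anti_left (by omega : 2 ≤ x + j) (by omega : 1 ≤ x) (by omega : x ≤ x + j)
  rw [← ha2, ← hb2] at h
  -- The bound x + j ≥ 7 enters here: 5/7 divided by 1.4143 still exceeds 1/2, which gives the
  -- factor two.
  have h5 : (5 / 7 : ℝ) ≤ 1 - 2 / (x + j : ℕ) := by
    have : 2 / ((x + j : ℕ) : ℝ) ≤ 2 / 7 := by gcongr
    linarith
  generalize (√(x : ℝ))⁻¹ = a at *
  generalize (√((x + j : ℕ) : ℝ))⁻¹ = b at *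
  have h1 : (5 / 7 : ℝ) * (a - b) * (a + b) ≤
      (wgt x (x + j) - wgt (x + j) (x + j)) * (1.4143 * (a + b)) := by
    calc (5 / 7 : ℝ) * (a - b) * (a + b) = 5 / 7 * (a ^ 2 - b ^ 2) := by ring
      _ ≤ (1 - 2 / ((x + j : ℕ) : ℝ)) * (a ^ 2 - b ^ 2) := by
        have : 0 ≤ a ^ 2 - b ^ 2 := by nlinarith
        gcongr
      _ = _ := h.symm
      _ ≤ _ := by
        have : 0 ≤ wgt x (x + j) - wgt (x + j) (x + j) := by linarith
        gcongr
        linarith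
  have h2 : (5 / 7 : ℝ) * (a - b) ≤ (wgt x (x + j) - wgt (x + j) (x + j)) * 1.4143 := by
    refine le_of_mul_le_mul_right ?_ (by linarith : 0 < a + b)
    linarith
  linarith

/-- Moving an arm to a neighbour of degree three. -/
theorem feed_three_gain {x : ℕ} (hx : 4 ≤ x) :
    ((x : ℝ) - 4) * (wgt x (x + 1) - wgt (x + 1) (x + 1)) < wgt (x + 1) 3 - wgt x 4 := by
  have hx' : (4 : ℝ) ≤ x := by exact_mod_cast hx
  have h1 := wgt_sub (by omega : 2 ≤ x + 1) (by omega : 1 ≤ x) (by omega : 1 ≤ x + 1)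
  rw [wgt_comm (x + 1) x] at h1
  have hm := wgt_anti_left (by omega : 2 ≤ x + 1) (by omega : 1 ≤ x) (by omega : x ≤ x + 1)
  have b3 : wgt (x + 1) 3 ≤ 0.57736 + 0.28868 / (x + 1 : ℕ) :=
    wgt_le_linear (by omega) (by norm_num) (by norm_num) (by norm_num) (by norm_num) (by norm_num)
  have b4 : wgt x 4 ≤ 0.5 + 0.5 / x :=
    wgt_le_linear (by omega) (by norm_num) (by norm_num) (by norm_num) (by norm_num) (by norm_num)
  have p3 : 0 < wgt (x + 1) 3 := wgt_pos (by omega) (by norm_num)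
  have p4 : 0 < wgt x 4 := wgt_pos (by omega) (by norm_num)
  have s3 := wgt_sq (by omega : 1 ≤ x + 1) (by norm_num : 1 ≤ 3)
  have s4 := wgt_sq (by omega : 1 ≤ x) (by norm_num : 1 ≤ 4)
  have s0 := wgt_sq (by omega : 1 ≤ x + 1) (by omega : 1 ≤ x + 1)
  have p0 : 0 < wgt (x + 1) (x + 1) := wgt_pos (by omega) (by omega)
  have hkey : 6 * (1.07736 + 0.28868 / (x + 1) + 0.5 / x) * ((x - 4) * (x - 1)) <
      ((x + 2) * (x - 3)) * ((x + 1) * wgt (x + 1) (x + 1)) := by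
    have hq : ((x + 1) * wgt (x + 1) (x + 1)) ^ 2 = 2 * x := by
      rw [mul_pow, s0]; push_cast; field_simp; ring
    have hP : 0 < ((x : ℝ) + 2) * (x - 3) := by nlinarith
    refine lt_of_pow_lt_pow_left₀ 2 (mul_nonneg hP.le (by positivity)) ?_
    rw [mul_pow _ ((x + 1) * wgt (x + 1) (x + 1)), hq]
    -- From x = 23 on, (6 · 1.12)² = 45.1584 is below 2x; the smaller values are checked one by one.
    rcases Nat.lt_or_ge x 23 with hlt | hge
    · clear * - hx hlt
      interval_cases x <;> norm_num
    · have hx23 : (23 : ℝ) ≤ x := by exact_mod_cast hge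
      have hA : 1.07736 + 0.28868 / ((x : ℝ) + 1) + 0.5 / x ≤ 1.12 := by
        have : 0.28868 / ((x : ℝ) + 1) ≤ 0.28868 / 24 := by gcongr; linarith
        have : 0.5 / (x : ℝ) ≤ 0.5 / 23 := by gcongr
        norm_num at *; linarith
      have hQ : ((x : ℝ) - 4) * (x - 1) ≤ (x + 2) * (x - 3) := by nlinarith
      have hQ0 : 0 ≤ ((x : ℝ) - 4) * (x - 1) := by nlinarith
      calc _ ≤ (6 * 1.12 * (((x : ℝ) + 2) * (x - 3))) ^ 2 := by gcongr
        _ = ((x + 2) * (x - 3)) ^ 2 * 45.1584 := by ring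
        _ < _ := by gcongr; linarith
  have hS : wgt (x + 1) 3 + wgt x 4 ≤ 1.07736 + 0.28868 / (x + 1) + 0.5 / x := by
    push_cast at b3; linarith
  have hkey2 : 6 * (wgt (x + 1) 3 + wgt x 4) * ((x - 4) * (x - 1)) <
      ((x + 2) * (x - 3)) * ((x + 1) * wgt (x + 1) (x + 1)) := by
    refine lt_of_le_of_lt ?_ hkey
    have : 0 ≤ ((x : ℝ) - 4) * (x - 1) := by nlinarith
    gcongr
  have e1 : (wgt (x + 1) 3 - wgt x 4) * (wgt (x + 1) 3 + wgt x 4) =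
      ((x + 2) * (x - 3)) / (12 * x * (x + 1)) := by
    have : (wgt (x + 1) 3 - wgt x 4) * (wgt (x + 1) 3 + wgt x 4) =
      wgt (x + 1) 3 ^ 2 - wgt x 4 ^ 2 := by ring
    rw [this, s3, s4]
    push_cast
    field_simp
    ring
  have e2 : (wgt x (x + 1) - wgt (x + 1) (x + 1)) * (2 * wgt (x + 1) (x + 1)) ≤
      (x - 1) / (x * (x + 1) ^ 2) := by
    have : (1 - 2 / ((x + 1 : ℕ) : ℝ)) * (1 / x - 1 / ((x + 1 : ℕ) : ℝ)) =
      (x - 1) / (x * (x + 1) ^ 2) := by push_cast; field_simp; ring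
    rw [← this, ← h1]
    have : 0 ≤ wgt x (x + 1) - wgt (x + 1) (x + 1) := by linarith
    gcongr
    linarith
  have e3 : wgt x (x + 1) - wgt (x + 1) (x + 1) ≤
      (x - 1) / (x * (x + 1) ^ 2) / (2 * wgt (x + 1) (x + 1)) := by
    rwa [le_div_iff₀ (by positivity)]
  have e4 : wgt (x + 1) 3 - wgt x 4 =
      ((x + 2) * (x - 3)) / (12 * x * (x + 1)) / (wgt (x + 1) 3 + wgt x 4) := by
    rw [eq_div_iff (by positivity), e1]
  rw [e4]
  refine (mul_le_mul_of_nonneg_left e3 (by linarith)).trans_lt ?_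
  rw [lt_div_iff₀ (by positivity), lt_div_iff₀ (by positivity)]
  have : ((x : ℝ) - 4) * ((x - 1) / (x * (x + 1) ^ 2) / (2 * wgt (x + 1) (x + 1))) *
      (wgt (x + 1) 3 + wgt x 4) * (12 * x * (x + 1)) =
      6 * (wgt (x + 1) 3 + wgt x 4) * ((x - 4) * (x - 1)) / ((x + 1) * wgt (x + 1) (x + 1)) := by
    field_simp
    ring
  rw [this, div_lt_iff₀ (by positivity)]
  exact hkey2

/-- Since y² f(x, y)² = y(x + y − 2)/x: weights decay no faster than 1/y. -/
theorem mul_wgt_mono {x y z : ℕ} (hx : 2 ≤ x) (hy : 1 ≤ y) (hyz : y ≤ z) :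
    y * wgt x y ≤ z * wgt x z := by
  have hx' : (2 : ℝ) ≤ x := by exact_mod_cast hx
  have hy' : (1 : ℝ) ≤ y := by exact_mod_cast hy
  have hz' : (y : ℝ) ≤ z := by exact_mod_cast hyz
  refine le_of_sq_le_sq ?_ (mul_nonneg (by positivity) (wgt_nonneg _ _))
  rw [mul_pow, mul_pow, wgt_sq (by omega) hy, wgt_sq (by omega) (by omega)]
  have e1 : (y : ℝ) ^ 2 * ((x + y - 2) / (x * y)) = y * (x + y - 2) / x := by field_simp
  have e2 : (z : ℝ) ^ 2 * ((x + z - 2) / (x * z)) = z * (x + z - 2) / x := by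
    have : (0 : ℝ) < z := by linarith
    field_simp
  rw [e1, e2]
  gcongr
  linarith

/-- By `wgt_sub`, the step times e(e + 1)(f(x, e) + f(x, e + 1)) does not depend on e, and that
factor grows with e by `mul_wgt_mono`. So the step is largest at e = 4. -/
theorem wgt_step_le {x e : ℕ} (hx : 2 ≤ x) (he : 4 ≤ e) :
    wgt x e - wgt x (e + 1) ≤ wgt x 4 - wgt x 5 := by
  have hx' : (2 : ℝ) ≤ x := by exact_mod_cast hx
  have he' : (4 : ℝ) ≤ e := by exact_mod_cast he
  have h1 := wgt_sub hx (by omega : 1 ≤ e) (by omega : 1 ≤ e + 1)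
  have h2 := wgt_sub hx (by omega : 1 ≤ 4) (by omega : 1 ≤ 5)
  have m1 := mul_wgt_mono hx (by norm_num) he
  have m2 := mul_wgt_mono hx (by norm_num) (by omega : 5 ≤ e + 1)
  have hm := wgt_anti hx (by omega : 1 ≤ e) (by omega : e ≤ e + 1)
  have p := wgt_add_pos hx (by norm_num : 1 ≤ 4) (by norm_num : 1 ≤ 5)
  push_cast at *
  have h3 : (wgt x e - wgt x (e + 1)) * (20 * (wgt x 4 + wgt x 5)) ≤
      (wgt x e - wgt x (e + 1)) * (e * (e + 1) * (wgt x e + wgt x (e + 1))) := by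
    have : 0 ≤ wgt x e - wgt x (e + 1) := by linarith
    have k1 : 20 * wgt x 4 ≤ (e + 1) * (e * wgt x e) :=
      le_trans (by linarith) (mul_le_mul (by linarith : (5 : ℝ) ≤ e + 1) m1
        (by have := wgt_nonneg x 4; positivity) (by linarith))
    have k2 : 20 * wgt x 5 ≤ e * ((e + 1) * wgt x (e + 1)) :=
      le_trans (by linarith) (mul_le_mul he' m2
        (by have := wgt_nonneg x 5; positivity) (by linarith))
    exact mul_le_mul_of_nonneg_left (by linarith) this
  have h4 : (wgt x e - wgt x (e + 1)) * (e * (e + 1) * (wgt x e + wgt x (e + 1))) =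
      (wgt x 4 - wgt x 5) * (20 * (wgt x 4 + wgt x 5)) := by
    calc _ = e * (e + 1) * ((1 - 2 / (x : ℝ)) * (1 / e - 1 / (e + 1))) := by rw [← h1]; ring
      _ = 20 * ((1 - 2 / (x : ℝ)) * (1 / 4 - 1 / 5)) := by field_simp; ring
      _ = _ := by rw [← h2]; ring
  rw [h4] at h3
  exact le_of_mul_le_mul_right h3 (by positivity)

theorem wgt_four_sub_five_le {x : ℕ} (hx : 2 ≤ x) : wgt x 4 - wgt x 5 ≤ 0.0528 := by
  have h := wgt_sub hx (by norm_num : 1 ≤ 4) (by norm_num : 1 ≤ 5)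
  have hx' : (2 : ℝ) ≤ x := by exact_mod_cast hx
  have w4 : (0.5 : ℝ) ≤ wgt x 4 := by
    refine le_wgt (by omega) (by norm_num) ?_
    push_cast; linarith
  have w5 : (0.4472 : ℝ) ≤ wgt x 5 := by
    refine le_wgt (by omega) (by norm_num) ?_
    push_cast; linarith
  have h2 : 2 / (x : ℝ) ≥ 0 := by positivity
  push_cast at h
  have hm := wgt_anti hx (by norm_num : 1 ≤ 4) (by norm_num : 4 ≤ 5)
  nlinarith

/-- The square root equals (x + 2) f(x + 2, x + 2), and the sum of weights in `wgt_sub` is at least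
twice the smaller one. -/
theorem wgt_sub_two_le {x : ℕ} (hx : 2 ≤ x) :
    wgt x (x + 2) - wgt (x + 2) (x + 2) ≤ 1 / ((x + 2) * √(2 * (x + 1))) := by
  have hx' : (2 : ℝ) ≤ x := by exact_mod_cast hx
  have h1 := wgt_sub (by omega : 2 ≤ x + 2) (by omega : 1 ≤ x) (by omega : 1 ≤ x + 2)
  rw [wgt_comm (x + 2) x] at h1
  have hm := wgt_anti_left (by omega : 2 ≤ x + 2) (by omega : 1 ≤ x) (by omega : x ≤ x + 2)
  have p0 : 0 < wgt (x + 2) (x + 2) := wgt_pos (by omega) (by omega)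
  have hq : √(2 * ((x : ℝ) + 1)) = (x + 2) * wgt (x + 2) (x + 2) := by
    rw [Real.sqrt_eq_iff_mul_self_eq (by positivity) (by positivity), ← pow_two, mul_pow,
      wgt_sq (by omega) (by omega)]
    push_cast; field_simp; ring
  have : (1 - 2 / ((x + 2 : ℕ) : ℝ)) * (1 / x - 1 / ((x + 2 : ℕ) : ℝ)) = 2 / (x + 2) ^ 2 := by
    push_cast; field_simp; ring
  rw [this] at h1
  rw [hq, le_div_iff₀ (by positivity)]
  have h2 : (wgt x (x + 2) - wgt (x + 2) (x + 2)) * (2 * wgt (x + 2) (x + 2)) ≤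
      2 / (x + 2) ^ 2 := by
    rw [← h1]
    have : 0 ≤ wgt x (x + 2) - wgt (x + 2) (x + 2) := by linarith
    gcongr
    linarith
  rw [le_div_iff₀ (by positivity)] at h2
  linarith

/-- Bounds for the total loss at the other neighbours. -/
theorem mul_wgt_sub_two_le {x : ℕ} {a c : ℝ} (hx : 10 ≤ x) (hc : 0 ≤ c)
    (hax : a ≤ x) (h : (x - a) ^ 2 ≤ c ^ 2 * ((x + 2) ^ 2 * (2 * (x + 1)))) :
    ((x : ℝ) - a) * (wgt x (x + 2) - wgt (x + 2) (x + 2)) ≤ c := by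
  have hx' : (10 : ℝ) ≤ x := by exact_mod_cast hx
  refine (mul_le_mul_of_nonneg_left (wgt_sub_two_le (by omega)) (by linarith)).trans ?_
  rw [mul_one_div, div_le_iff₀ (by positivity)]
  refine le_of_sq_le_sq ?_ (by positivity)
  rw [mul_pow, mul_pow, Real.sq_sqrt (by positivity)]
  exact h

/-- The neighbour giving up an arm drops from degree four to three and so contributes, with the two
new branches, the third edge of weight f(x, 3). -/
theorem regroup_gain_four {x : ℕ} (hx : 4 ≤ x) :
    ((x : ℝ) - 3) * (wgt x (x + 2) - wgt (x + 2) (x + 2)) <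
      2 * wgt 2 2 + wgt (x + 2) 4 - 3 * wgt x 3 := by
  have hs := le_wgt_two_two
  rcases Nat.lt_or_ge x 10 with hlt | hge
  · interval_cases x
    · have u4_6 : wgt 4 6 ≤ 0.5773503 :=
        wgt_le (by norm_num) (by norm_num) (by norm_num) (by norm_num)
      have u4_3 : wgt 4 3 ≤ 0.6454973 :=
        wgt_le (by norm_num) (by norm_num) (by norm_num) (by norm_num)
      have l6_6 : 0.5270462 ≤ wgt 6 6 :=
        le_wgt (by norm_num) (by norm_num) (by norm_num)
      have l6_4 : 0.5773502 ≤ wgt 6 4 :=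
        le_wgt (by norm_num) (by norm_num) (by norm_num)
      norm_num at *
      linarith
    · have u5_7 : wgt 5 7 ≤ 0.5345225 :=
        wgt_le (by norm_num) (by norm_num) (by norm_num) (by norm_num)
      have u5_3 : wgt 5 3 ≤ 0.6324556 :=
        wgt_le (by norm_num) (by norm_num) (by norm_num) (by norm_num)
      have l7_7 : 0.4948716 ≤ wgt 7 7 :=
        le_wgt (by norm_num) (by norm_num) (by norm_num)
      have l7_4 : 0.5669467 ≤ wgt 7 4 :=
        le_wgt (by norm_num) (by norm_num) (by norm_num)
      norm_num at *
      linarith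
    · have u6_8 : wgt 6 8 ≤ 0.5000000 :=
        wgt_le (by norm_num) (by norm_num) (by norm_num) (by norm_num)
      have u6_3 : wgt 6 3 ≤ 0.6236096 :=
        wgt_le (by norm_num) (by norm_num) (by norm_num) (by norm_num)
      have l8_8 : 0.4677071 ≤ wgt 8 8 :=
        le_wgt (by norm_num) (by norm_num) (by norm_num)
      have l8_4 : 0.5590169 ≤ wgt 8 4 :=
        le_wgt (by norm_num) (by norm_num) (by norm_num)
      norm_num at *
      linarith
    · have u7_9 : wgt 7 9 ≤ 0.4714046 :=
        wgt_le (by norm_num) (by norm_num) (by norm_num) (by norm_num)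
      have u7_3 : wgt 7 3 ≤ 0.6172134 :=
        wgt_le (by norm_num) (by norm_num) (by norm_num) (by norm_num)
      have l9_9 : 0.4444444 ≤ wgt 9 9 :=
        le_wgt (by norm_num) (by norm_num) (by norm_num)
      have l9_4 : 0.5527707 ≤ wgt 9 4 :=
        le_wgt (by norm_num) (by norm_num) (by norm_num)
      norm_num at *
      linarith
    · have u8_10 : wgt 8 10 ≤ 0.4472136 :=
        wgt_le (by norm_num) (by norm_num) (by norm_num) (by norm_num)
      have u8_3 : wgt 8 3 ≤ 0.6123725 :=
        wgt_le (by norm_num) (by norm_num) (by norm_num) (by norm_num)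
      have l10_10 : 0.4242640 ≤ wgt 10 10 :=
        le_wgt (by norm_num) (by norm_num) (by norm_num)
      have l10_4 : 0.5477225 ≤ wgt 10 4 :=
        le_wgt (by norm_num) (by norm_num) (by norm_num)
      norm_num at *
      linarith
    · have u9_11 : wgt 9 11 ≤ 0.4264015 :=
        wgt_le (by norm_num) (by norm_num) (by norm_num) (by norm_num)
      have u9_3 : wgt 9 3 ≤ 0.6085807 :=
        wgt_le (by norm_num) (by norm_num) (by norm_num) (by norm_num)
      have l11_11 : 0.4065578 ≤ wgt 11 11 :=
        le_wgt (by norm_num) (by norm_num) (by norm_num)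
      have l11_4 : 0.5435573 ≤ wgt 11 4 :=
        le_wgt (by norm_num) (by norm_num) (by norm_num)
      norm_num at *
      linarith
  · have hx' : (10 : ℝ) ≤ x := by exact_mod_cast hge
    have h1 := mul_wgt_sub_two_le (a := 3) (c := 0.1315) hge (by norm_num)
      (by linarith) (by
        obtain ⟨y, hy⟩ : ∃ y : ℝ, (x : ℝ) = y + 10 := ⟨x - 10, by ring⟩
        have hy0 : 0 ≤ y := by linarith
        rw [hy]
        have := pow_nonneg hy0 2
        have := pow_nonneg hy0 3
        nlinarith)
    have b3 : wgt x 3 ≤ 0.57736 + 0.28868 / x :=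
      wgt_le_linear (by omega) (by norm_num) (by norm_num) (by norm_num) (by norm_num)
        (by norm_num)
    have b4 : 0.5 + 0.45 / (x + 2 : ℕ) ≤ wgt (x + 2) 4 :=
      linear_le_wgt (n := 12) (by norm_num) (by omega) (by norm_num) (by norm_num) (by norm_num)
    have h2 : 3 * (0.28868 / (x : ℝ)) - 0.45 / (x + 2 : ℕ) ≤ 0.0495 := by
      have : 3 * (0.28868 / (x : ℝ)) - 0.45 / (x + 2 : ℕ) =
          (0.41604 * x + 1.73208) / (x * (x + 2)) := by
        push_cast; field_simp; norm_num; ring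
      rw [this, div_le_iff₀ (by positivity)]
      nlinarith
    linarith

/-- One copy of the loss more than in `regroup_gain` accounts for the edge to the neighbour that
gives up an arm; what remains of its change is a step in the second variable, largest between 4 and
5. -/
theorem regroup_gain_large {x : ℕ} (hx : 4 ≤ x) :
    ((x : ℝ) - 2) * (wgt x (x + 2) - wgt (x + 2) (x + 2)) <
      2 * wgt 2 2 - 2 * wgt x 3 - (wgt x 4 - wgt x 5) := by
  have hs := le_wgt_two_two
  rcases Nat.lt_or_ge x 10 with hlt | hge
  · interval_cases x
    · have u4_6 : wgt 4 6 ≤ 0.5773503 :=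
        wgt_le (by norm_num) (by norm_num) (by norm_num) (by norm_num)
      have u4_3 : wgt 4 3 ≤ 0.6454973 :=
        wgt_le (by norm_num) (by norm_num) (by norm_num) (by norm_num)
      have u4_4 : wgt 4 4 ≤ 0.6123725 :=
        wgt_le (by norm_num) (by norm_num) (by norm_num) (by norm_num)
      have l6_6 : 0.5270462 ≤ wgt 6 6 :=
        le_wgt (by norm_num) (by norm_num) (by norm_num)
      have l4_5 : 0.5916079 ≤ wgt 4 5 :=
        le_wgt (by norm_num) (by norm_num) (by norm_num)
      norm_num at *
      linarith
    · have u5_7 : wgt 5 7 ≤ 0.5345225 :=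
        wgt_le (by norm_num) (by norm_num) (by norm_num) (by norm_num)
      have u5_3 : wgt 5 3 ≤ 0.6324556 :=
        wgt_le (by norm_num) (by norm_num) (by norm_num) (by norm_num)
      have u5_4 : wgt 5 4 ≤ 0.5916080 :=
        wgt_le (by norm_num) (by norm_num) (by norm_num) (by norm_num)
      have l7_7 : 0.4948716 ≤ wgt 7 7 :=
        le_wgt (by norm_num) (by norm_num) (by norm_num)
      have l5_5 : 0.5656854 ≤ wgt 5 5 :=
        le_wgt (by norm_num) (by norm_num) (by norm_num)
      norm_num at *
      linarith
    · have u6_8 : wgt 6 8 ≤ 0.5000000 :=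
        wgt_le (by norm_num) (by norm_num) (by norm_num) (by norm_num)
      have u6_3 : wgt 6 3 ≤ 0.6236096 :=
        wgt_le (by norm_num) (by norm_num) (by norm_num) (by norm_num)
      have u6_4 : wgt 6 4 ≤ 0.5773503 :=
        wgt_le (by norm_num) (by norm_num) (by norm_num) (by norm_num)
      have l8_8 : 0.4677071 ≤ wgt 8 8 :=
        le_wgt (by norm_num) (by norm_num) (by norm_num)
      have l6_5 : 0.5477225 ≤ wgt 6 5 :=
        le_wgt (by norm_num) (by norm_num) (by norm_num)
      norm_num at *
      linarith
    · have u7_9 : wgt 7 9 ≤ 0.4714046 :=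
        wgt_le (by norm_num) (by norm_num) (by norm_num) (by norm_num)
      have u7_3 : wgt 7 3 ≤ 0.6172134 :=
        wgt_le (by norm_num) (by norm_num) (by norm_num) (by norm_num)
      have u7_4 : wgt 7 4 ≤ 0.5669468 :=
        wgt_le (by norm_num) (by norm_num) (by norm_num) (by norm_num)
      have l9_9 : 0.4444444 ≤ wgt 9 9 :=
        le_wgt (by norm_num) (by norm_num) (by norm_num)
      have l7_5 : 0.5345224 ≤ wgt 7 5 :=
        le_wgt (by norm_num) (by norm_num) (by norm_num)
      norm_num at *
      linarith
    · have u8_10 : wgt 8 10 ≤ 0.4472136 :=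
        wgt_le (by norm_num) (by norm_num) (by norm_num) (by norm_num)
      have u8_3 : wgt 8 3 ≤ 0.6123725 :=
        wgt_le (by norm_num) (by norm_num) (by norm_num) (by norm_num)
      have u8_4 : wgt 8 4 ≤ 0.5590170 :=
        wgt_le (by norm_num) (by norm_num) (by norm_num) (by norm_num)
      have l10_10 : 0.4242640 ≤ wgt 10 10 :=
        le_wgt (by norm_num) (by norm_num) (by norm_num)
      have l8_5 : 0.5244044 ≤ wgt 8 5 :=
        le_wgt (by norm_num) (by norm_num) (by norm_num)
      norm_num at *
      linarith
    · have u9_11 : wgt 9 11 ≤ 0.4264015 :=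
        wgt_le (by norm_num) (by norm_num) (by norm_num) (by norm_num)
      have u9_3 : wgt 9 3 ≤ 0.6085807 :=
        wgt_le (by norm_num) (by norm_num) (by norm_num) (by norm_num)
      have u9_4 : wgt 9 4 ≤ 0.5527708 :=
        wgt_le (by norm_num) (by norm_num) (by norm_num) (by norm_num)
      have l11_11 : 0.4065578 ≤ wgt 11 11 :=
        le_wgt (by norm_num) (by norm_num) (by norm_num)
      have l9_5 : 0.5163977 ≤ wgt 9 5 :=
        le_wgt (by norm_num) (by norm_num) (by norm_num)
      norm_num at *
      linarith
  · have hx' : (10 : ℝ) ≤ x := by exact_mod_cast hge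
    have h1 := mul_wgt_sub_two_le (a := 2) (c := 0.1429) hge (by norm_num)
      (by linarith) (by
        obtain ⟨y, hy⟩ : ∃ y : ℝ, (x : ℝ) = y + 10 := ⟨x - 10, by ring⟩
        have hy0 : 0 ≤ y := by linarith
        rw [hy]
        have := pow_nonneg hy0 2
        have := pow_nonneg hy0 3
        nlinarith)
    have h3 : wgt x 3 ≤ 0.6056 := (wgt_anti_left (by norm_num) (by norm_num) hge).trans
      (wgt_le (by norm_num) (by norm_num) (by norm_num) (by norm_num))
    have h4 := wgt_four_sub_five_le (by omega : 2 ≤ x)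
    linarith

/-- Regrouping four arms and an arm of a neighbour of degree `c + 1` at least four. -/
theorem regroup_gain {x c : ℕ} (hx : 3 ≤ x) (hc : 3 ≤ c) (hcx : c ≤ x + 1) :
    ((x : ℝ) - 3) * (wgt x (x + 2) - wgt (x + 2) (x + 2)) <
      2 * wgt 2 2 + wgt (x + 2) (c + 1) - 2 * wgt x 3 - wgt x c := by
  have hs := le_wgt_two_two
  obtain rfl | hx4 : x = 3 ∨ 4 ≤ x := by omega
  · obtain rfl | rfl : c = 3 ∨ c = 4 := by omega
    · have u3_3 : wgt 3 3 ≤ 0.6666667 :=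
        wgt_le (by norm_num) (by norm_num) (by norm_num) (by norm_num)
      have l5_4 : 0.5916079 ≤ wgt 5 4 :=
        le_wgt (by norm_num) (by norm_num) (by norm_num)
      norm_num at *
      linarith
    · have u3_3 : wgt 3 3 ≤ 0.6666667 :=
        wgt_le (by norm_num) (by norm_num) (by norm_num) (by norm_num)
      have u3_4 : wgt 3 4 ≤ 0.6454973 :=
        wgt_le (by norm_num) (by norm_num) (by norm_num) (by norm_num)
      have l5_5 : 0.5656854 ≤ wgt 5 5 :=
        le_wgt (by norm_num) (by norm_num) (by norm_num)
      norm_num at *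
      linarith
  · obtain rfl | hc4 : c = 3 ∨ 4 ≤ c := by omega
    · have := regroup_gain_four hx4
      norm_num
      linarith
    · have h1 := regroup_gain_large hx4
      have h2 := wgt_step_le (by omega : 2 ≤ x) hc4
      have h3 := wgt_supermod (by omega : 2 ≤ c + 1) (by omega : c + 1 ≤ x + 2)
        (by omega : 1 ≤ x) (by omega : x ≤ x + 2)
      rw [wgt_comm (c + 1), wgt_comm (c + 1), wgt_comm (x + 2) x] at h3
      linarith

namespace RTree

/-! ### Counting arms -/

/-- The number of arms (branches of degree two) in a list of branches. -/
def armc (l : List RTree) : ℕ := (l.map deg).countP (· = 2)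

/-- The number of branches of degree at least three in a list of branches. -/
def ntc (l : List RTree) : ℕ := (l.map deg).countP (3 ≤ ·)

@[simp] theorem armc_nil : armc [] = 0 := rfl

@[simp] theorem ntc_nil : ntc [] = 0 := rfl

theorem armc_cons (b : RTree) (l : List RTree) :
    armc (b :: l) = armc l + if b.deg = 2 then 1 else 0 := by
  simp [armc, List.countP_cons]

theorem ntc_cons (b : RTree) (l : List RTree) :
    ntc (b :: l) = ntc l + if 3 ≤ b.deg then 1 else 0 := by
  simp [ntc, List.countP_cons]

@[simp] theorem armc_append (l m : List RTree) : armc (l ++ m) = armc l + armc m := by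
  simp [armc]

@[simp] theorem ntc_append (l m : List RTree) : ntc (l ++ m) = ntc l + ntc m := by
  simp [ntc]

theorem armc_perm {l m : List RTree} (h : l.Perm m) : armc l = armc m := (h.map deg).countP_eq _

theorem ntc_perm {l m : List RTree} (h : l.Perm m) : ntc l = ntc m := (h.map deg).countP_eq _

theorem armc_le_length (l : List RTree) : armc l ≤ l.length := by
  simpa [armc] using List.countP_le_length (p := (· = 2)) (l := l.map deg)

theorem armc_add_ntc_le (l : List RTree) : armc l + ntc l ≤ l.length := by
  induction l with
  | nil => simp
  | cons b l ih =>
    rw [armc_cons, ntc_cons]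
    simp only [List.length_cons]
    split_ifs <;> omega

theorem armc_add_ntc {l : List RTree} (h : ∀ b ∈ l, 2 ≤ b.deg) : armc l + ntc l = l.length := by
  induction l with
  | nil => simp
  | cons b l ih =>
    have h1 := ih fun b hb => h b (by simp [hb])
    have h2 := h b (by simp)
    rw [armc_cons, ntc_cons]
    simp only [List.length_cons]
    split_ifs <;> omega

theorem exists_of_armc_pos {l : List RTree} (h : 0 < armc l) : ∃ b ∈ l, b.deg = 2 := by
  simpa [armc, List.countP_pos_iff] using h

theorem exists_of_ntc_pos {l : List RTree} (h : 0 < ntc l) : ∃ b ∈ l, 3 ≤ b.deg := by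
  simpa [ntc, List.countP_pos_iff] using h

theorem ntc_pos {l : List RTree} {b : RTree} (h : b ∈ l) (hb : 3 ≤ b.deg) : 0 < ntc l := by
  simpa [ntc, List.countP_pos_iff] using ⟨b, h, hb⟩

theorem ntc_eq_countP (l : List RTree) : ntc l = l.countP (3 ≤ ·.deg) := by
  simp [ntc, List.countP_map, Function.comp_def]

theorem exists_arms {k : ℕ} {l : List RTree} (h : k ≤ armc l) :
    ∃ X m, l.Perm (X ++ m) ∧ X.length = k ∧ ∀ x ∈ X, x.deg = 2 := by
  induction k generalizing l with
  | zero => exact ⟨[], l, by simp, rfl, by simp⟩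
  | succ k ih =>
    obtain ⟨b, hb, hb2⟩ := exists_of_armc_pos (by omega : 0 < armc l)
    obtain ⟨l', hl'⟩ := exists_perm_cons hb
    rw [armc_perm hl', armc_cons, if_pos hb2] at h
    obtain ⟨X, m, hp, hX, hX2⟩ := ih (by omega : k ≤ armc l')
    exact ⟨b :: X, m, hl'.trans (hp.cons b), by simp [hX], by simpa [hb2] using hX2⟩

mutual
/-- The number of arms at vertices of degree `d` that also have a branch of degree at least
three. -/
def cntm (d : ℕ) : RTree → ℕ
  | node l => (if l.length + 1 = d ∧ 0 < ntc l then armc l else 0) + cntmL d l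
/-- The number of arms at vertices of degree `d` of a forest that also have a branch of degree at
least three. -/
def cntmL (d : ℕ) : List RTree → ℕ
  | [] => 0
  | t :: l => cntm d t + cntmL d l
end

theorem cntm_node (d : ℕ) (l : List RTree) : cntm d (node l) =
    (if l.length + 1 = d ∧ 0 < ntc l then armc l else 0) + cntmL d l := by rw [cntm]

@[simp] theorem cntmL_nil (d : ℕ) : cntmL d [] = 0 := by rw [cntmL]

@[simp] theorem cntmL_cons (d : ℕ) (t : RTree) (l : List RTree) :
    cntmL d (t :: l) = cntm d t + cntmL d l := by rw [cntmL]

@[simp] theorem cntmL_append (d : ℕ) (l m : List RTree) :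
    cntmL d (l ++ m) = cntmL d l + cntmL d m := by
  induction l with
  | nil => simp
  | cons b l ih => simp [ih, add_assoc]

theorem cntmL_perm {d : ℕ} {l m : List RTree} (h : l.Perm m) : cntmL d l = cntmL d m := by
  induction h with
  | nil => rfl
  | cons _ _ ih => simp [ih]
  | swap x y l => simp only [cntmL_cons]; omega
  | trans _ _ h1 h2 => exact h1.trans h2

theorem cntm_perm {d : ℕ} {l m : List RTree} (h : l.Perm m) :
    cntm d (node l) = cntm d (node m) := by
  rw [cntm_node, cntm_node, cntmL_perm h, ntc_perm h, armc_perm h, h.length_eq]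

theorem exists_of_cntmL_pos {d : ℕ} {l : List RTree} (h : 0 < cntmL d l) :
    ∃ b ∈ l, 0 < cntm d b := by
  induction l with
  | nil => simp at h
  | cons b l ih =>
    simp at h
    rcases h with h | h
    · exact ⟨b, by simp, h⟩
    · obtain ⟨c, hc, h⟩ := ih h
      exact ⟨c, by simp [hc], h⟩

theorem cntm_leg (d k : ℕ) : cntm d (leg k) = 0 := by
  induction k with
  | zero => simp [leg, cntm_node]
  | succ k ih =>
    rw [leg_succ, cntm_node]
    have : ntc [leg k] = 0 := by
      rw [ntc_cons]
      cases k <;> simp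
    simp [this, ih]

theorem cntm_fill {d : ℕ} (C : Ctx) {t t' : RTree} (h : t.deg = t'.deg) :
    cntm d (C.fill t) + cntm d t' = cntm d (C.fill t') + cntm d t := by
  induction C with
  | hole => simp [add_comm]
  | sub l₁ C l₂ ih =>
    have h1 : (C.fill t).deg = (C.fill t').deg := by
      by_cases hC : C = .hole
      · simpa [hC] using h
      · exact deg_fill_eq hC _ _
    simp only [Ctx.fill_sub, cntm_node, cntmL_append, cntmL_cons, ntc_append, ntc_cons,
      armc_append, armc_cons, List.length_append, List.length_cons, h1]
    omega

theorem kids_fill {C : Ctx} {t t' : RTree} (h : t.deg = t'.deg) (hC : C ≠ .hole) :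
    (C.fill t).kids.map deg = (C.fill t').kids.map deg := by
  cases C with
  | hole => exact absurd rfl hC
  | sub l₁ C l₂ =>
    have h1 : (C.fill t).deg = (C.fill t').deg := by
      by_cases hC : C = .hole
      · simpa [hC] using h
      · exact deg_fill_eq hC _ _
    simp [h1]

theorem Good.of_mem_kids {b c : RTree} (h : Good b ∨ b = leg 0) (hc : c ∈ b.kids) :
    Good c ∨ c = leg 0 := by
  rcases h with h | rfl
  · cases h with
    | one => simp [leg_succ] at hc; simp [hc]
    | two => rw [leg_succ] at hc; simp at hc; rw [hc]; exact .inl .one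
    | node l _ h => exact .inl (h c hc)
  · simp [leg_zero] at hc

theorem Good.of_fill {C : Ctx} {t : RTree} (h : Good (C.fill t) ∨ C.fill t = leg 0) :
    Good t ∨ t = leg 0 := by
  induction C with
  | hole => exact h
  | sub l₁ C l₂ ih => exact ih (Good.of_mem_kids h (by simp))

theorem cntm_arm {d : ℕ} {x : RTree} (h : Good x ∨ x = leg 0) (hx : x.deg = 2) :
    cntm d x = 0 := by
  rcases h with h | rfl
  · rcases h.eq_leg hx with rfl | rfl <;> exact cntm_leg _ _
  · simp at hx

/-- A vertex contributing to `cntm`. -/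
theorem exists_mixed {d : ℕ} {q : RTree} (h : 0 < cntm d q) : ∃ C m, Ctx.fill C (node m) = q ∧
    m.length + 1 = d ∧ 0 < ntc m ∧ 0 < armc m := by
  induction q using ind with
  | h l ih =>
    rw [cntm_node] at h
    by_cases hl : 0 < cntmL d l
    · obtain ⟨b, hb, h0⟩ := exists_of_cntmL_pos hl
      obtain ⟨C, m, hC, hm⟩ := ih b hb h0
      obtain ⟨l₁, l₂, rfl⟩ := List.append_of_mem hb
      exact ⟨.sub l₁ C l₂, m, by simp [hC], hm⟩
    · split_ifs at h with h1
      · exact ⟨.hole, l, rfl, h1.1, h1.2, by omega⟩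
      · omega

/-- Bringing an arm from elsewhere to the root, in exchange for a larger branch. -/
theorem Min.fetch_arm {d : ℕ} {q z : RTree} {R : List RTree} (h : Min (node (q :: z :: R)))
    (hR : 1 ≤ R.length) (hs : 10 ≤ size (node (q :: z :: R))) (hd : R.length + 2 = d)
    (hz : 3 ≤ z.deg) (hq : 0 < cntm d q) :
    ∃ q' x, Min (node (q' :: x :: R)) ∧ x.deg = 2 ∧ q'.deg = q.deg ∧ ntc q.kids ≤ ntc q'.kids ∧
      cntm d q ≤ cntm d q' + 1 ∧
      size (node (q' :: x :: R)) = size (node (q :: z :: R)) := by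
  have hg := h.good (by simp; omega) hs
  obtain ⟨C, m, rfl, hm, hn, ha⟩ := exists_mixed hq
  obtain ⟨x, hx, hx2⟩ := exists_of_armc_pos ha
  obtain ⟨m', hp⟩ := exists_perm_cons hx
  have hlen := hp.length_eq
  simp at hlen
  have h1 := (h.fill_perm hp).perm (List.Perm.swap _ _ _)
  have h2 : Min (node (z :: (C.comp (.sub [] .hole m')).fill x :: R)) := by
    simpa [Ctx.fill_comp] using h1
  have h3 := h2.swap (by simp [Ctx.hdeg_comp]; omega)
  simp only [Ctx.fill_comp, Ctx.fill_sub, Ctx.fill_hole, List.nil_append] at h3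
  have hgx : Good x ∨ x = leg 0 := Good.of_mem_kids (Good.of_fill (.inl hg)) (by simpa using hx)
  have hdeg : (node m).deg = (node (z :: m')).deg := by simp [hlen]
  -- The vertex losing the arm x keeps a large branch, namely z, so its other arms still count.
  have hc0 : cntm d (node m) ≤ cntm d (node (z :: m')) + 1 := by
    rw [cntm_perm hp, cntm_node, cntm_node, if_pos, if_pos]
    · rw [armc_cons, armc_cons, cntmL_cons, cntmL_cons, cntm_arm hgx hx2, if_pos hx2,
        if_neg (by omega)]
      omega
    · rw [ntc_cons, if_pos hz]; simp; omega
    · rw [← ntc_perm hp]; simp; omega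
  refine ⟨_, x, h3.perm (List.Perm.swap _ _ _), hx2, ?_, ?_, ?_, ?_⟩
  · by_cases hC : C = .hole
    · simp [hC, hlen]
    · exact deg_fill_eq hC _ _
  · by_cases hC : C = .hole
    · subst hC
      simp only [Ctx.fill_hole, kids_node]
      rw [ntc_perm hp, ntc_cons, ntc_cons, if_pos hz]
      split_ifs <;> omega
    · rw [ntc, ntc, kids_fill hdeg hC]
  · have := cntm_fill (d := d) C hdeg
    omega
  · have := C.size_fill (node m) (node (z :: m'))
    have := sizeL_perm hp
    simp at *
    omega

/-- Sending an arm of the root away, in exchange for a larger branch. -/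
theorem Min.send_arm {d : ℕ} {q x : RTree} {R : List RTree} (h : Min (node (q :: x :: R)))
    (hd : R.length + 2 = d) (hq : 0 < cntm d q) :
    ∃ q' y, Min (node (q' :: y :: R)) ∧ 3 ≤ y.deg ∧ q'.deg = q.deg ∧
      (q.deg ≠ d → ntc q'.kids = ntc q.kids) ∧
      size (node (q' :: y :: R)) = size (node (q :: x :: R)) := by
  obtain ⟨C, m, rfl, hm, hn, -⟩ := exists_mixed hq
  obtain ⟨y, hy, hy3⟩ := exists_of_ntc_pos hn
  obtain ⟨m', hp⟩ := exists_perm_cons hy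
  have hlen := hp.length_eq
  simp at hlen
  have h1 := (h.fill_perm hp).perm (List.Perm.swap _ _ _)
  have h2 : Min (node (x :: (C.comp (.sub [] .hole m')).fill y :: R)) := by
    simpa [Ctx.fill_comp] using h1
  have h3 := h2.swap (by simp [Ctx.hdeg_comp]; omega)
  simp only [Ctx.fill_comp, Ctx.fill_sub, Ctx.fill_hole, List.nil_append] at h3
  have hdeg : (node m).deg = (node (x :: m')).deg := by simp [hlen]
  refine ⟨_, y, h3.perm (List.Perm.swap _ _ _), hy3, ?_, fun hne => ?_, ?_⟩
  · by_cases hC : C = .hole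
    · simp [hC, hlen]
    · exact deg_fill_eq hC _ _
  · by_cases hC : C = .hole
    · subst hC
      simp at hne
      omega
    · rw [ntc, ntc, kids_fill hdeg hC]
  · have := C.size_fill (node m) (node (x :: m'))
    have := sizeL_perm hp
    simp at *
    omega

/-- Arms are fetched from q one at a time, each in exchange for a large branch of R. The total `armc
R + cntm d q` never drops, so the supply lasts until k arms are collected. -/
theorem Min.gather {d k : ℕ} {P : RTree → Prop} {q c : RTree} {R : List RTree}
    (h : Min (node (q :: c :: R))) (hs : 10 ≤ size (node (q :: c :: R))) (hd : R.length + 2 = d)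
    (hP : ∀ b ∈ R, b.deg = 2 ∨ 3 ≤ b.deg ∧ P b) (hkR : k ≤ R.length)
    (hk : k ≤ armc R + cntm d q) :
    ∃ q' R', Min (node (q' :: c :: R')) ∧ R'.length = R.length ∧
      (∀ b ∈ R', b.deg = 2 ∨ 3 ≤ b.deg ∧ P b) ∧ k ≤ armc R' ∧ q'.deg = q.deg ∧
      ntc q.kids ≤ ntc q'.kids ∧ armc R + cntm d q ≤ armc R' + cntm d q' ∧
      size (node (q' :: c :: R')) = size (node (q :: c :: R)) := by
  obtain ⟨n, hn⟩ : ∃ n, k - armc R = n := ⟨_, rfl⟩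
  induction n generalizing q R with
  | zero => exact ⟨q, R, h, rfl, hP, by omega, rfl, le_rfl, le_rfl, rfl⟩
  | succ n ih =>
    have hsum := armc_add_ntc (l := R) fun b hb => by rcases hP b hb with h | h <;> omega
    obtain ⟨z, hz, hz3⟩ := exists_of_ntc_pos (by omega : 0 < ntc R)
    obtain ⟨R₁, hp⟩ := exists_perm_cons hz
    have hlen := hp.length_eq
    have hsz := sizeL_perm hp
    simp at hlen hsz
    have hpp : (q :: c :: R).Perm (q :: z :: c :: R₁) :=
      ((hp.cons c).trans (List.Perm.swap _ _ _)).cons q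
    obtain ⟨q', x, h1, hx, hdq, hnt, hcn, hsq⟩ := (h.perm hpp).fetch_arm (d := d) (by simp)
      (by simp at hs ⊢; omega) (by simp; omega) hz3 (by omega)
    have harm : armc R = armc R₁ := by rw [armc_perm hp, armc_cons, if_neg (by omega)]; rfl
    have harm' : armc (x :: R₁) = armc R₁ + 1 := by rw [armc_cons, if_pos hx]
    obtain ⟨q'', R', h2, hl, hP', hk', hdq', hnt', hcn', hsq'⟩ := ih (q := q') (R := x :: R₁)
      (h1.perm ((List.Perm.swap _ _ _).cons _)) (by simp at *; omega) (by simp; omega)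
      (by
        intro b hb
        simp at hb
        rcases hb with rfl | hb
        · exact .inl hx
        · exact hP b (hp.mem_iff.2 (by simp [hb])))
      (by simp; omega) (by omega) (by omega)
    exact ⟨q'', R', h2, by simp at hl; omega, hP', hk', hdq'.trans hdq, hnt.trans hnt', by omega,
      by simp at *; omega⟩

/-! ### Local moves -/

theorem brL_arms {D D' : ℕ} (hD : 1 ≤ D) (hD' : 1 ≤ D') {l : List RTree}
    (h : ∀ b ∈ l, b.deg = 2) : brL D l = brL D' l := by
  induction l with
  | nil => simp
  | cons b l ih =>
    have h1 := h b (by simp)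
    simp [br_arm hD h1, br_arm hD' h1, ih fun b hb => h b (by simp [hb])]

/-- Branches of degree at least three all of whose children are arms. -/
def CL (b : RTree) : Prop := 3 ≤ b.deg ∧ ∀ z ∈ b.kids, z.deg = 2

/-- Arms lose nothing, and among the other branches, of degree at most d, one of degree exactly d
loses most. -/
theorem loss_le {j d : ℕ} (hj : 1 ≤ j) (hjd : j ≤ d) {l : List RTree}
    (h : ∀ b ∈ l, 2 ≤ b.deg ∧ b.deg ≤ d) :
    brL j l - brL d l ≤ ((l.length : ℝ) - armc l) * (wgt j d - wgt d d) := by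
  induction l with
  | nil => simp
  | cons b l ih =>
    have h1 := ih fun b hb => h b (by simp [hb])
    obtain ⟨h2, h3⟩ := h b (by simp)
    rw [armc_cons]
    simp only [brL_cons, br, List.length_cons]
    split_ifs with h4
    · rw [h4, wgt_two_right hj, wgt_two_right (hj.trans hjd)]
      push_cast
      linarith
    · have := wgt_supermod h2 h3 hj hjd
      rw [wgt_comm b.deg, wgt_comm b.deg, wgt_comm d j] at this
      push_cast
      linarith

/-- Moving an arm to a neighbouring vertex of degree three. -/
theorem Min.feed {x : RTree} {zs R : List RTree} (h : Min (node (x :: node zs :: R)))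
    (hx : x.deg = 2) (hzs : zs.length = 2) (hz : ∀ z ∈ zs, z.deg = 2) :
    wgt (R.length + 2) 3 - wgt (R.length + 1) 4 ≤
      brL (R.length + 1) R - brL (R.length + 2) R := by
  have h1 := h (node (node (x :: zs) :: R)) (by simp; omega)
  simp only [abc_node, brL_cons, List.length_cons, br_node, hzs] at h1
  rw [br_arm (by omega) hx, br_arm (by omega) hx,
    brL_arms (D := 2 + 1) (D' := 2 + 1 + 1) (by omega) (by omega) hz] at h1
  norm_num [add_assoc] at h1 ⊢
  linarith

/-- Regrouping four arms of the root and one arm of a neighbouring vertex. -/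
theorem Min.regroup {x₁ x₂ x₃ x₄ : RTree} {zs R : List RTree}
    (h : Min (node (x₁ :: x₂ :: x₃ :: x₄ :: node (leg 1 :: zs) :: R)))
    (h1 : x₁.deg = 2) (h2 : x₂.deg = 2) (h3 : x₃.deg = 2) (h4 : x₄.deg = 2)
    (hz : ∀ z ∈ zs, z.deg = 2) :
    2 * wgt 2 2 + wgt (R.length + 5) (zs.length + 2) - 2 * wgt (R.length + 3) 3 -
      wgt (R.length + 3) (zs.length + 1) ≤ brL (R.length + 3) R - brL (R.length + 5) R := by
  -- The two vertices of the removed `leg 1` become the two new vertices of degree three.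
  have h5 := h (node (node [x₁, x₂] :: node [x₃, x₄] :: node zs :: R)) (by simp; omega)
  simp only [abc_node, brL_cons, List.length_cons, br_node, List.length_nil, brL_nil,
    add_assoc, Nat.reduceAdd] at h5
  rw [br_leg_succ (by omega)] at h5
  rw [br_arm (by omega) h1, br_arm (by omega) h1, br_arm (by omega) h2, br_arm (by omega) h2,
    br_arm (by omega) h3, br_arm (by omega) h3, br_arm (by omega) h4, br_arm (by omega) h4,
    brL_arms (D := zs.length + 1) (D' := zs.length + 2) (by omega) (by omega) hz] at h5
  push_cast at h5
  linarith

/-- Moving a branch from a vertex, whose other branches are arms, to its neighbour. -/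
theorem Min.move {c : RTree} {qs A : List RTree} (h : Min (node (node qs :: c :: A)))
    (hA : ∀ a ∈ A, a.deg = 2) (hqs : ∀ b ∈ qs, 2 ≤ b.deg) :
    wgt (qs.length + 1) (A.length + 2) + wgt (A.length + 2) c.deg +
      ntc qs * (wgt (qs.length + 1) 3 - wgt (qs.length + 2) 3) ≤
      wgt (qs.length + 2) (A.length + 1) + wgt (qs.length + 2) c.deg := by
  have h1 := h (node (node A :: c :: qs)) (by simp; omega)
  have h2 := brL_anti (by omega : qs.length + 1 ≤ qs.length + 2) (by omega) hqs
  rw [← ntc_eq_countP] at h2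
  simp only [abc_node, brL_cons, br_node, List.length_cons, add_assoc, Nat.reduceAdd] at h1
  rw [br, br, brL_arms (D := A.length + 1) (D' := A.length + 2) (by omega) (by omega) hA,
    wgt_comm (A.length + 2) (qs.length + 1)] at h1
  linarith

/-- The root is merged into its neighbour with branches `qs`, and the vertex saved prolongs the arm
z. -/
theorem Min.contract_three {y z : RTree} {qs zs : List RTree}
    (h : Min (node [node qs, node (z :: zs), y])) (hz : z.deg = 2)
    (hqs : ∀ b ∈ qs, 2 ≤ b.deg) :
    wgt (qs.length + 1) 3 + wgt 3 (zs.length + 2) + wgt 3 y.deg ≤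
      wgt 2 2 + wgt (qs.length + 2) (zs.length + 2) + wgt (qs.length + 2) y.deg := by
  have h1 := h (node (node (node [z] :: zs) :: y :: qs)) (by simp; omega)
  have h2 := brL_anti (by omega : qs.length + 1 ≤ qs.length + 2) (by omega) hqs
  have h3 : 0 ≤ (qs.countP (3 ≤ ·.deg) : ℝ) * (wgt (qs.length + 1) 3 - wgt (qs.length + 2) 3) :=
    mul_nonneg (Nat.cast_nonneg _) (sub_nonneg.2 (wgt_anti_left (by omega) (by omega) (by omega)))
  simp only [abc_node, brL_cons, br_node (D := 3), br_node (D := qs.length + 2), List.length_cons,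
    List.length_nil, brL_nil, add_assoc, Nat.reduceAdd] at h1
  rw [br_singleton (by omega), br_arm (by omega) hz, br, br, wgt_comm 3 (qs.length + 1)] at h1
  linarith

/-- As in `contract_three`, but the prolonged arm x also moves to the second branch, whose degree
grows by one. -/
theorem Min.contract_four {x y : RTree} {qs zs : List RTree}
    (h : Min (node [node qs, node zs, y, x])) (hx : x.deg = 2) (hz : ∀ z ∈ zs, z.deg = 2)
    (hqs : ∀ b ∈ qs, 2 ≤ b.deg) :
    wgt (qs.length + 1) 4 + wgt 4 (zs.length + 1) + wgt 4 y.deg +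
      ntc qs * (wgt (qs.length + 1) 3 - wgt (qs.length + 2) 3) ≤
      wgt 2 2 + wgt (qs.length + 2) (zs.length + 2) + wgt (qs.length + 2) y.deg := by
  have h1 := h (node (node (node [x] :: zs) :: y :: qs)) (by simp; omega)
  have h2 := brL_anti (by omega : qs.length + 1 ≤ qs.length + 2) (by omega) hqs
  rw [← ntc_eq_countP] at h2
  simp only [abc_node, brL_cons, br_node (D := 4), br_node (D := qs.length + 2), List.length_cons,
    List.length_nil, brL_nil, add_assoc, Nat.reduceAdd] at h1
  rw [br_singleton (by omega), br_arm (by omega) hx, br, br, wgt_comm 4 (qs.length + 1),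
    brL_arms (D := zs.length + 2) (D' := zs.length + 1) (by omega) (by omega) hz] at h1
  linarith

/-- A vertex with four arms and a core leaf as neighbours, if the loss at the other neighbours is
small. -/
theorem Min.not_four_arms_of_loss {x₁ x₂ x₃ x₄ c : RTree} {R : List RTree}
    (h : Min (node (x₁ :: x₂ :: x₃ :: x₄ :: c :: R)))
    (hs : 10 ≤ size (node (x₁ :: x₂ :: x₃ :: x₄ :: c :: R)))
    (h1 : x₁.deg = 2) (h2 : x₂.deg = 2) (h3 : x₃.deg = 2) (h4 : x₄.deg = 2)
    (hc : CL c) (hcd : c.deg ≤ R.length + 5)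
    (hl1 : brL (R.length + 4) R - brL (R.length + 5) R ≤
      R.length * (wgt (R.length + 4) (R.length + 5) - wgt (R.length + 5) (R.length + 5)))
    (hl2 : brL (R.length + 3) R - brL (R.length + 5) R ≤
      R.length * (wgt (R.length + 3) (R.length + 5) - wgt (R.length + 5) (R.length + 5))) :
    False := by
  obtain ⟨zs⟩ := c
  obtain ⟨hc3, hz⟩ := hc
  simp at hc3 hz hcd
  -- A core leaf of degree three receives an arm. A larger one gives up a pendant path of length
  -- two, which it has since at most one of its paths has length three.
  rcases Nat.lt_or_ge zs.length 3 with hlt | hge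
  · have hp : (x₁ :: x₂ :: x₃ :: x₄ :: node zs :: R).Perm (x₁ :: node zs :: x₂ :: x₃ :: x₄ :: R) :=
      (List.perm_middle (l₁ := [x₂, x₃, x₄]) (a := node zs) (l₂ := R)).cons x₁
    have h5 := (h.perm hp).feed h1 (by omega) hz
    have h6 := feed_three_gain (by omega : 4 ≤ R.length + 4)
    simp only [List.length_cons, brL_cons, add_assoc, Nat.reduceAdd] at h5
    rw [br_arm (by omega) h2, br_arm (by omega) h2, br_arm (by omega) h3, br_arm (by omega) h3,
      br_arm (by omega) h4, br_arm (by omega) h4] at h5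
    push_cast at h6
    norm_num [add_assoc] at h6
    linarith
  · have hp : (x₁ :: x₂ :: x₃ :: x₄ :: node zs :: R).Perm (node zs :: x₁ :: x₂ :: x₃ :: x₄ :: R) :=
      List.perm_middle (l₁ := [x₁, x₂, x₃, x₄]) (a := node zs) (l₂ := R)
    have h7 := (h.perm hp).reroot
    have hs7 : 10 ≤ size (node (node (x₁ :: x₂ :: x₃ :: x₄ :: R) :: zs)) := by
      simp at hs ⊢; omega
    obtain ⟨z, hzm, hz1⟩ : ∃ z ∈ zs, z = leg 1 := by
      by_contra! hcon
      have hall : ∀ z ∈ zs, z = leg 2 := by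
        intro z hzm
        obtain ⟨zs', hzp⟩ := exists_perm_cons hzm
        have hpl := hzp.length_eq
        have hps := sizeL_perm hzp
        simp at hpl hps
        have hg := (h7.perm ((hzp.cons _).trans (List.Perm.swap _ _ _))).good
          (by simp; omega) (by simp at hs7 ⊢; omega)
        rcases hg.eq_leg (hz z hzm) with h8 | h8
        · exact absurd h8 (hcon z hzm)
        · exact h8
      match zs, hge, hall with
      | a :: b :: zs, _, hall =>
        rw [hall a (by simp), hall b (by simp)] at h7 hs7
        have hp3 : (node (x₁ :: x₂ :: x₃ :: x₄ :: R) :: leg 2 :: leg 2 :: zs).Perm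
            (leg 2 :: leg 2 :: node (x₁ :: x₂ :: x₃ :: x₄ :: R) :: zs) :=
          (List.perm_middle (l₁ := [leg 2, leg 2])).symm
        exact (h7.perm hp3).no_two_long_legs (by simp) (by simp at hs7 ⊢; omega)
    subst hz1
    obtain ⟨zs', hzp⟩ := exists_perm_cons hzm
    have hpl := hzp.length_eq
    simp at hpl
    have h8 := ((h.perm hp).fill_perm (C := .hole) hzp).perm
      (List.perm_middle (l₁ := [x₁, x₂, x₃, x₄]) (l₂ := R)).symm
    have h9 := Min.regroup (x₁ := x₁) (x₂ := x₂) (x₃ := x₃) (x₄ := x₄) h8 h1 h2 h3 h4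
      fun z hz' => hz z (hzp.mem_iff.2 (by simp [hz']))
    have h10 := regroup_gain (by omega : 3 ≤ R.length + 3) (by omega : 3 ≤ zs'.length + 1)
      (by omega)
    push_cast at h10
    norm_num [add_assoc] at h10
    linarith

theorem Min.not_four_arms {c : RTree} {A : List RTree} (h : Min (node (c :: A)))
    (hs : 10 ≤ size (node (c :: A))) (hA : 4 ≤ armc A) (hc : CL c) (hcd : c.deg ≤ A.length + 1)
    (hd : ∀ b ∈ A, 2 ≤ b.deg ∧ b.deg ≤ A.length + 1) : False := by
  obtain ⟨X, R, hp, hX, hX2⟩ := exists_arms hA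
  have hlen := hp.length_eq
  have hsz := sizeL_perm hp
  match X, hX with
  | [x₁, x₂, x₃, x₄], _ =>
    simp at hX2 hlen hsz
    have hp2 : (c :: A).Perm (x₁ :: x₂ :: x₃ :: x₄ :: c :: R) :=
      (hp.cons c).trans (List.perm_middle (l₁ := [x₁, x₂, x₃, x₄])).symm
    have hdR : ∀ b ∈ R, 2 ≤ b.deg ∧ b.deg ≤ R.length + 5 := fun b hb => by
      have := hd b (hp.mem_iff.2 (by simp [hb])); omega
    have hloss : ∀ j, 1 ≤ j → j ≤ R.length + 5 → brL j R - brL (R.length + 5) R ≤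
        R.length * (wgt j (R.length + 5) - wgt (R.length + 5) (R.length + 5)) := by
      intro j hj hjd
      refine (loss_le hj hjd hdR).trans ?_
      have := wgt_anti_left (by omega : 2 ≤ R.length + 5) hj hjd
      have : (0 : ℝ) ≤ armc R := Nat.cast_nonneg _
      nlinarith
    exact (h.perm hp2).not_four_arms_of_loss (by simp at hs hsz ⊢; omega) hX2.1 hX2.2.1 hX2.2.2.1
      hX2.2.2.2 hc (by omega) (hloss _ (by omega) (by omega)) (hloss _ (by omega) (by omega))

/-- The degree of q is arbitrary, so its loss is only known to be at most twice the loss at a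
neighbour of the same degree as the root. The fifth arm, which loses nothing, makes up for the
second copy. -/
theorem Min.not_five_arms {q c : RTree} {A : List RTree} (h : Min (node (q :: c :: A)))
    (hs : 10 ≤ size (node (q :: c :: A))) (hA : 5 ≤ armc A) (hc : CL c)
    (hcd : c.deg ≤ A.length + 2) (hd : ∀ b ∈ A, 2 ≤ b.deg ∧ b.deg ≤ A.length + 2) : False := by
  obtain ⟨X, R, hp, hX, hX2⟩ := exists_arms hA
  have hlen := hp.length_eq
  have hsz := sizeL_perm hp
  match X, hX with
  | [x₁, x₂, x₃, x₄, x₅], _ =>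
    simp at hX2 hlen hsz
    have hp2 : (q :: c :: A).Perm (x₁ :: x₂ :: x₃ :: x₄ :: c :: q :: x₅ :: R) := by
      refine (List.Perm.swap _ _ _).trans ?_
      refine List.Perm.trans ?_ (List.perm_middle (l₁ := [x₁, x₂, x₃, x₄])).symm
      refine List.Perm.cons _ ?_
      exact (hp.cons q).trans (List.perm_middle (l₁ := [x₁, x₂, x₃, x₄])).symm
    have hdR : ∀ b ∈ x₅ :: R, 2 ≤ b.deg ∧ b.deg ≤ R.length + 7 := by
      intro b hb
      have := hd b (hp.mem_iff.2 (by simp at hb ⊢; tauto))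
      omega
    have hloss : ∀ j, j ≤ 2 → 1 ≤ j → brL (R.length + 7 - j) (q :: x₅ :: R) -
        brL (R.length + 7) (q :: x₅ :: R) ≤ (R.length + 2) *
          (wgt (R.length + 7 - j) (R.length + 7) - wgt (R.length + 7) (R.length + 7)) := by
      intro j hj hj1
      have h1 := loss_le (by omega : 1 ≤ R.length + 7 - j) (by omega : _ ≤ R.length + 7) hdR
      have h2 := wgt_sub_le_two_mul (by omega : 2 ≤ R.length + 7 - j) hj (by omega)
        (one_le_deg q)
      rw [show R.length + 7 - j + j = R.length + 7 by omega] at h2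
      have h3 := wgt_anti_left (by omega : 2 ≤ R.length + 7) (by omega : 1 ≤ R.length + 7 - j)
        (by omega : _ ≤ R.length + 7)
      have h4 : (0 : ℝ) ≤ armc R := Nat.cast_nonneg _
      rw [armc_cons, if_pos hX2.2.2.2.2] at h1
      rw [brL_cons, brL_cons _ q, br, br]
      push_cast [List.length_cons] at h1
      nlinarith
    exact (h.perm hp2).not_four_arms_of_loss (by simp at hs hsz ⊢; omega) hX2.1 hX2.2.1 hX2.2.2.1
      hX2.2.2.2.1 hc (by simp; omega)
      (by simpa [add_assoc] using hloss 1 (by norm_num) le_rfl)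
      (by simpa [add_assoc] using hloss 2 le_rfl (by norm_num))

-- ### Contradictions at a neighbour of a core leaf

theorem Min.kids_two_le_deg {q : RTree} {l : List RTree} (h : Min (node (q :: l)))
    (hl : 2 ≤ l.length) (hs : 10 ≤ size (node (q :: l))) (hq : 3 ≤ q.deg) :
    ∀ b ∈ q.kids, 2 ≤ b.deg := fun _ hb => ((h.good hl hs).kids hq hb).two_le_deg

/-- If x is an arm, it is first traded for a large branch inside q. Then the edge between the root
and q is contracted. -/
theorem Min.final_three {q c x : RTree} (h : Min (node [q, c, x]))
    (hs : 10 ≤ size (node [q, c, x])) (hc : CL c) (hq3 : 3 ≤ q.deg)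
    (hx : 3 ≤ x.deg ∨ x.deg = 2 ∧ 0 < cntm 3 q) : False := by
  wlog hx3 : 3 ≤ x.deg generalizing q x
  · obtain ⟨-, hq⟩ : x.deg = 2 ∧ 0 < cntm 3 q := by tauto
    obtain ⟨q', y, h1, hy, hq', -, hs'⟩ := (h.perm ((List.Perm.swap _ _ _).cons q)).send_arm
      (by simp) hq
    exact this (h1.perm ((List.Perm.swap _ _ _).cons _)) (by simp at *; omega) (by omega)
      (.inl hy) hy
  have hk := h.kids_two_le_deg (by simp) hs hq3
  obtain ⟨qs⟩ := q
  obtain ⟨zs⟩ := c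
  obtain ⟨hc3, hz⟩ := hc
  match zs, hc3, hz with
  | z :: zs, hc3, hz =>
    simp at hc3 hq3
    have h1 := h.contract_three (hz z (by simp)) hk
    have h2 := contract_three_gain (by omega : 3 ≤ qs.length + 1) (by omega : 3 ≤ zs.length + 2) hx3
    linarith

/-- Again an arm y is first traded for a large branch inside q. The bound on `ntc` says that all
children of q are large, and each of their edges adds to the gain of the contraction; the trade
preserves it because q does not have degree four. -/
theorem Min.final_four {q c y x : RTree} (h : Min (node [q, c, y, x]))
    (hs : 10 ≤ size (node [q, c, y, x])) (hc : CL c) (hcd : c.deg ≤ 4) (hq : 4 < q.deg)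
    (hnt : q.deg - 1 ≤ ntc q.kids) (hx : x.deg = 2)
    (hy : 3 ≤ y.deg ∨ y.deg = 2 ∧ 0 < cntm 4 q) : False := by
  wlog hy3 : 3 ≤ y.deg generalizing q y
  · obtain ⟨-, hq0⟩ : y.deg = 2 ∧ 0 < cntm 4 q := by tauto
    obtain ⟨q', z, h1, hz, hq', hn, hs'⟩ := (h.perm ((List.Perm.swap _ _ _).cons q)).send_arm
      (by simp) hq0
    exact this (h1.perm ((List.Perm.swap _ _ _).cons _)) (by simp at *; omega) (by omega)
      (by rw [hn (by omega)]; omega) (.inl hz) hz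
  have hk := h.kids_two_le_deg (by simp) hs (by omega)
  obtain ⟨qs⟩ := q
  obtain ⟨zs⟩ := c
  obtain ⟨hc3, hz⟩ := hc
  simp at hc3 hcd hq hnt hz hk
  have h1 := h.contract_four hx hz hk
  have h2 := contract_four_gain (by omega : 5 ≤ qs.length + 1)
    (by omega : zs.length + 1 = 3 ∨ zs.length + 1 = 4) hy3
  have h3 : (qs.length : ℝ) ≤ ntc qs := by exact_mod_cast hnt
  have h4 := wgt_anti_left (by omega : 2 ≤ 3) (by omega : 1 ≤ qs.length + 1)
    (by omega : qs.length + 1 ≤ qs.length + 2)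
  push_cast [add_assoc] at h2
  norm_num [add_assoc] at h2
  nlinarith

/-- A vertex of degree `d` that has a core leaf as a neighbour, all but one of whose other
neighbours are arms or core leaves, cannot see too many arms at vertices of degree `d`. -/
theorem Min.final {d : ℕ} {q c : RTree} {R : List RTree} (h : Min (node (q :: c :: R)))
    (hs : 10 ≤ size (node (q :: c :: R))) (hd : R.length + 2 = d) (hd3 : 3 ≤ d) (hc : CL c)
    (hcd : c.deg ≤ d) (hR : ∀ b ∈ R, b.deg = 2 ∨ 3 ≤ b.deg ∧ CL b ∧ b.deg ≤ d)
    (hq3 : 3 ≤ q.deg)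
    (hq : q.deg = d ∧ 1 ≤ ntc q.kids ∧ 4 ≤ armc R + cntm d q ∨
      d < q.deg ∧ q.deg - 1 ≤ ntc q.kids ∧ 5 ≤ armc R + cntm d q) : False := by
  have gather : ∀ k, k ≤ R.length → k ≤ armc R + cntm d q → _ :=
    fun k h1 h2 => h.gather hs hd hR h1 h2
  have hsum := armc_add_ntc (l := R) fun b hb => by rcases hR b hb with h | h <;> omega
  -- For d ≥ 7 the list R has room for the four or five arms needed. For smaller d the edge to q is
  -- contracted if d = 3, or if d = 4 and q has larger degree; in the other cases R is filled with
  -- arms and c is moved to q.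
  rcases Nat.lt_or_ge d 7 with h7 | h7
  · obtain rfl | hd4 | hk : d = 3 ∨ (d = 4 ∧ 4 < q.deg) ∨
        (d = 4 ∧ q.deg = 4 ∨ (d = 5 ∨ d = 6) ∧ d ≤ q.deg) := by omega
    · match R, hd with
      | [x], _ =>
        refine h.final_three hs hc hq3 ?_
        have := armc_le_length [x]
        simp at this
        rcases hR x (by simp) with h1 | h1
        · exact .inr ⟨h1, by omega⟩
        · exact .inl h1.1
    · obtain ⟨rfl, hd4⟩ := hd4
      obtain ⟨q', R', h1, hl, hP, hk, hdq, hnt, hcn, hsz⟩ := gather 1 (by omega) (by omega)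
      obtain ⟨x, hx, hx2⟩ := exists_of_armc_pos hk
      obtain ⟨R₁, hp⟩ := exists_perm_cons hx
      have hpl := hp.length_eq
      match R₁, hpl with
      | [], hpl => simp at hpl; omega
      | _ :: _ :: _, hpl => simp at hpl; omega
      | [y], _ =>
        have hp' := hp.trans (List.Perm.swap _ _ _)
        have hsp := sizeL_perm hp'
        have := armc_le_length R'
        refine (h1.perm ((hp'.cons c).cons q')).final_four (by simp at *; omega) hc hcd
          (by omega) (by omega) hx2 ?_
        rcases hP y (hp.mem_iff.2 (by simp)) with h2 | h2
        · exact .inr ⟨h2, by omega⟩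
        · exact .inl h2.1
    · obtain ⟨q', R', h1, hl, hP, hk', hdq, hnt, hcn, hsz⟩ := gather (d - 2) (by omega) (by omega)
      have harm : ∀ b ∈ R', b.deg = 2 := by
        intro b hb
        by_contra h2
        have h3 := ntc_pos hb (by rcases hP b hb with h | h <;> omega)
        have := armc_add_ntc_le R'
        omega
      have hk2 := h1.kids_two_le_deg (by simp; omega) (by omega) (by omega)
      obtain ⟨qs⟩ := q'
      simp at hdq hnt hk2
      have h4 := h1.move harm hk2
      have h5 := move_gain (k := d - 2) (D := qs.length + 1) (e := c.deg) (B := ntc qs)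
        (by omega) hc.1 (by omega) (by omega)
      rw [show R'.length = d - 2 by omega] at h4
      linarith
  · rcases hq with ⟨hqd, hn, hK⟩ | ⟨hqd, hn, hK⟩
    · obtain ⟨q', R', h1, hl, hP, hk, hdq, -, -, hsz⟩ := gather 4 (by omega) (by omega)
      refine (h1.perm (List.Perm.swap _ _ _)).not_four_arms (by simp at *; omega)
        (by rw [armc_cons]; omega) hc (by simp; omega) ?_
      intro b hb
      simp at hb ⊢
      rcases hb with rfl | hb
      · omega
      · rcases hP b hb with h | h <;> omega
    · obtain ⟨q', R', h1, hl, hP, hk, hdq, -, -, hsz⟩ := gather 5 (by omega) (by omega)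
      refine h1.not_five_arms (by omega) hk hc (by omega) ?_
      intro b hb
      rcases hP b hb with h | h <;> omega

-- ### Mixed vertices, and moving the root between them

mutual
/-- The number of arms at vertices that also have a branch of degree at least three. -/
def mixed : RTree → ℕ
  | node l => (if 0 < ntc l then armc l else 0) + mixedL l
/-- The number of arms at vertices of a forest that also have a branch of degree at least three. -/
def mixedL : List RTree → ℕ
  | [] => 0
  | t :: l => mixed t + mixedL l
end

theorem mixed_node (l : List RTree) :
    mixed (node l) = (if 0 < ntc l then armc l else 0) + mixedL l := by rw [mixed]

@[simp] theorem mixedL_nil : mixedL [] = 0 := by rw [mixedL]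

@[simp] theorem mixedL_cons (t : RTree) (l : List RTree) :
    mixedL (t :: l) = mixed t + mixedL l := by rw [mixedL]

theorem mixedL_eq_sum (l : List RTree) : mixedL l = (l.map mixed).sum := by
  induction l with
  | nil => simp
  | cons b l ih => simp [ih]

theorem mixedL_perm {l m : List RTree} (h : l.Perm m) : mixedL l = mixedL m := by
  rw [mixedL_eq_sum, mixedL_eq_sum]; exact (h.map mixed).sum_eq

theorem exists_of_mixedL_pos {l : List RTree} (h : 0 < mixedL l) : ∃ b ∈ l, 0 < mixed b := by
  induction l with
  | nil => simp at h
  | cons b l ih =>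
    simp at h
    rcases h with h | h
    · exact ⟨b, by simp, h⟩
    · obtain ⟨c, hc, h⟩ := ih h
      exact ⟨c, by simp [hc], h⟩

/-- A property of the list of branches holds at every vertex. -/
inductive Everywhere (P : List RTree → Prop) : RTree → Prop
  | node (l : List RTree) : P l → (∀ b ∈ l, Everywhere P b) → Everywhere P (node l)

theorem Everywhere.of_fill {P : List RTree → Prop} {t : RTree}
    (h : ∀ C m, Ctx.fill C (RTree.node m) = t → P m) : Everywhere P t := by
  induction t using ind with
  | h l ih =>
    refine .node l (h .hole l rfl) fun b hb => ih b hb fun C m hm => ?_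
    obtain ⟨l₁, l₂, rfl⟩ := List.append_of_mem hb
    exact h (.sub l₁ C l₂) m (by simp [hm])

theorem Everywhere.here {P : List RTree → Prop} {l : List RTree} (h : Everywhere P (RTree.node l)) :
    P l := by
  cases h; assumption

theorem Everywhere.branches {P : List RTree → Prop} {l : List RTree} (h : Everywhere P (RTree.node l)) :
    ∀ b ∈ l, Everywhere P b := by
  cases h; assumption

/-- Vertices with a large branch have degree at least `d`, those with an arm at most `d`. -/
def Reg (d : ℕ) (l : List RTree) : Prop :=
  (0 < ntc l → d ≤ l.length + 1) ∧ (0 < armc l → l.length + 1 ≤ d)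

theorem everywhere_leg {P : List RTree → Prop} (h0 : P []) (h : ∀ k, P [leg k]) (k : ℕ) :
    Everywhere P (leg k) := by
  induction k with
  | zero => exact .node [] h0 (by simp)
  | succ k ih => exact .node _ (h k) (by simpa using ih)

theorem reg_leg {d : ℕ} (hd : 2 ≤ d) (k : ℕ) : Everywhere (Reg d) (leg k) := by
  refine everywhere_leg (by simp [Reg]) (fun k => ⟨fun h => ?_, fun _ => by simpa using hd⟩) k
  rw [ntc_cons] at h
  cases k <;> simp at h

/-- Under `Reg d` a vertex with both an arm and a large branch has degree exactly d. -/
theorem mixed_le_cntm {d : ℕ} {t : RTree} (h : Everywhere (Reg d) t) : mixed t ≤ cntm d t := by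
  induction h with
  | node l h1 _ ih =>
    have h2 : mixedL l ≤ cntmL d l := by
      clear h1
      induction l with
      | nil => simp
      | cons b l ihl =>
        have := ih b (by simp)
        have := ihl (by simp_all) fun b hb => ih b (by simp [hb])
        simp only [mixedL_cons, cntmL_cons]
        omega
    rw [mixed_node, cntm_node]
    by_cases h3 : 0 < ntc l ∧ 0 < armc l
    · have := h1.1 h3.1
      have := h1.2 h3.2
      rw [if_pos h3.1, if_pos ⟨by omega, h3.1⟩]
      omega
    · have : (if 0 < ntc l then armc l else 0) = 0 := by split_ifs <;> omega
      omega

theorem mixedL_le_cntmL {d : ℕ} {l : List RTree} (h : ∀ b ∈ l, Everywhere (Reg d) b) :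
    mixedL l ≤ cntmL d l := by
  induction l with
  | nil => simp
  | cons b l ih =>
    have := ih fun b hb => h b (by simp [hb])
    have := mixed_le_cntm (h b (by simp))
    simp only [mixedL_cons, cntmL_cons]
    omega

theorem mixed_le_of_deg_two {t : RTree} (h : Good t ∨ t = leg 0) (ht : t.deg ≤ 2) :
    mixed t = 0 := by
  have h0 : Everywhere (Reg 2) t := by
    rcases h with h | rfl
    · rcases h.eq_leg (by have := h.two_le_deg; omega) with rfl | rfl <;> exact reg_leg le_rfl _
    · exact reg_leg le_rfl _
  have h1 := mixed_le_cntm h0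
  have h2 : cntm 2 t = 0 := by
    rcases h with h | rfl
    · rcases h.eq_leg (by have := h.two_le_deg; omega) with rfl | rfl <;> exact cntm_leg _ _
    · exact cntm_leg _ _
  omega

theorem CL.cntm_eq_zero {b : RTree} (h : CL b) (hg : Good b) (d : ℕ) : cntm d b = 0 := by
  obtain ⟨l⟩ := b
  have h1 : ntc l = 0 := by
    by_contra h1
    obtain ⟨z, hz, hz3⟩ := exists_of_ntc_pos (Nat.pos_of_ne_zero h1)
    have := h.2 z hz
    omega
  have h2 : cntmL d l = 0 := by
    by_contra h2
    obtain ⟨z, hz, hz3⟩ := exists_of_cntmL_pos (Nat.pos_of_ne_zero h2)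
    rw [cntm_arm (.inl (hg.kids h.1 hz)) (h.2 z hz)] at hz3
    omega
  rw [cntm_node, h1, h2]
  simp

theorem Good.cl_or {b : RTree} (hg : Good b) (h3 : 3 ≤ b.deg) : CL b ∨ 0 < ntc b.kids := by
  by_cases h : ∃ z ∈ b.kids, 3 ≤ z.deg
  · obtain ⟨z, hz, hz3⟩ := h
    exact .inr (ntc_pos hz hz3)
  · refine .inl ⟨h3, fun z hz => ?_⟩
    have := (hg.kids h3 hz).two_le_deg
    push Not at h
    have := h z hz
    omega

theorem Min.good_of_mem {l : List RTree} (h : Min (node l)) (hl : 3 ≤ l.length)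
    (hs : 10 ≤ size (node l)) {b : RTree} (hb : b ∈ l) : Good b := by
  obtain ⟨l', hp⟩ := exists_perm_cons hb
  have h1 := hp.length_eq
  have h2 := sizeL_perm hp
  simp at h1 h2 hs
  exact (h.perm hp).good (by omega) (by simp; omega)

/-- The root moves away from q along large branches that are not core leaves; each vertex reached
has degree exactly d by `Reg` and the degree bound. The forest ahead shrinks, so the walk ends where
all large branches in it are core leaves, and `Min.final` applies. -/
theorem Min.descend {d : ℕ} {q : RTree} {L : List RTree} (h : Min (node (q :: L)))
    (hs : 10 ≤ size (node (q :: L))) (hd : L.length + 1 = d) (hd3 : 3 ≤ d) (hL : 0 < ntc L)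
    (hreg : ∀ b ∈ L, Everywhere (Reg d) b) (hmax : ∀ b ∈ L, Everywhere (·.length + 1 ≤ d) b)
    (hq3 : 3 ≤ q.deg)
    (hq : q.deg = d ∧ 1 ≤ ntc q.kids ∧ 4 ≤ cntm d q + armc L + cntmL d L ∨
      d < q.deg ∧ q.deg - 1 ≤ ntc q.kids ∧ 5 ≤ cntm d q + armc L + cntmL d L) : False := by
  obtain ⟨n, hn⟩ : ∃ n, sizeL L ≤ n := ⟨_, le_rfl⟩
  induction n generalizing q L with
  | zero =>
    obtain ⟨b, hb, -⟩ := exists_of_ntc_pos hL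
    obtain ⟨L', hp⟩ := exists_perm_cons hb
    have := sizeL_perm hp
    have := size_pos b
    simp at *
    omega
  | succ n ih =>
    have hgood : ∀ b ∈ L, Good b := fun b hb => h.good_of_mem (by simp; omega) hs (by simp [hb])
    by_cases hcl : ∀ b ∈ L, 3 ≤ b.deg → CL b
    · obtain ⟨c, hc, hc3⟩ := exists_of_ntc_pos hL
      obtain ⟨R, hp⟩ := exists_perm_cons hc
      have hlen := hp.length_eq
      have hsz := sizeL_perm hp
      have harm : armc L = armc R := by rw [armc_perm hp, armc_cons, if_neg (by omega)]; rfl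
      have h0 : cntmL d L = 0 := by
        by_contra h2
        obtain ⟨z, hz, hz3⟩ := exists_of_cntmL_pos (Nat.pos_of_ne_zero h2)
        have hg := hgood z hz
        rcases Nat.lt_or_ge z.deg 3 with h4 | h4
        · rw [cntm_arm (.inl hg) (by have := hg.two_le_deg; omega)] at hz3
          omega
        · rw [(hcl z hz h4).cntm_eq_zero hg] at hz3
          omega
      have hdeg : ∀ b ∈ L, b.deg ≤ d := by
        rintro ⟨m⟩ hb
        exact (hmax _ hb).here
      refine (h.perm (hp.cons q)).final (d := d) (by simp at *; omega) (by simp at *; omega) hd3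
        (hcl c hc hc3) (hdeg c hc) (fun b hb => ?_) hq3 (by omega)
      have hb' : b ∈ L := hp.mem_iff.2 (by simp [hb])
      rcases Nat.lt_or_ge b.deg 3 with h4 | h4
      · exact .inl (by have := (hgood b hb').two_le_deg; omega)
      · exact .inr ⟨h4, hcl b hb' h4, hdeg b hb'⟩
    · push Not at hcl
      obtain ⟨b, hb, hb3, hbc⟩ := hcl
      have hnt := ((hgood b hb).cl_or hb3).resolve_left hbc
      obtain ⟨m⟩ := b
      obtain ⟨L', hp⟩ := exists_perm_cons hb
      have hlen := hp.length_eq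
      have hsz := sizeL_perm hp
      simp at hnt hlen hsz hb3
      have h1 := (hreg _ hb).here.1 hnt
      have h2 := (hmax _ hb).here
      have harm : armc L = armc L' := by
        rw [armc_perm hp, armc_cons, if_neg (by simp; omega)]; rfl
      have hcnt := cntmL_perm (d := d) hp
      rw [cntmL_cons, cntm_node, if_pos ⟨by omega, hnt⟩] at hcnt
      have h3 := ((h.perm (hp.cons q)).perm (List.Perm.swap _ _ _)).reroot
      -- Seen from the new root, the old one has the large branch q, so its arms are still counted.
      have hntq : 0 < ntc (q :: L') := by rw [ntc_cons, if_pos hq3]; omega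
      refine ih h3 (by simp at *; omega) (by omega) hnt (hreg _ hb).branches (hmax _ hb).branches
        (by simp; omega) (.inl ⟨by simp; omega, hntq, ?_⟩) (by omega)
      rw [cntm_node, if_pos ⟨by simp; omega, hntq⟩, armc_cons, if_neg (by omega), cntmL_cons]
      omega

/-- Around a vertex of degree `d` with a neighbour of larger degree, there are no further vertices
of larger degree. -/
theorem Min.no_larger {d : ℕ} {q s : RTree} {L : List RTree} {C : Ctx}
    (h : Min (node (q :: C.fill s :: L)))
    (hs : 10 ≤ size (node (q :: C.fill s :: L))) (hd : L.length + 2 = d) (hd3 : 3 ≤ d)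
    (hq : d < q.deg) (hsd : d < s.deg) : False := by
  induction s using ind generalizing C with
  | h m ih =>
    simp at hsd
    have hg : Good (C.fill (node m)) := h.good_of_mem (by simp; omega) hs (by simp)
    match m, hsd with
    | [], hsd => simp at hsd; omega
    | x :: m, hsd =>
      simp at hsd
      have h1 : Min (node (q :: (C.comp (.sub [] .hole m)).fill x :: L)) := by
        simpa [Ctx.fill_comp] using h
      have hgx : Good x := by
        rcases Good.of_fill (.inl hg) with h2 | h2
        · exact h2.kids (by simp; omega) (by simp)
        · simp [leg_zero] at h2
      have h2 := h1.exchange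
      simp only [Ctx.hdeg_comp, Ctx.hdeg_sub, Ctx.hdeg_hole, List.length_nil, hd] at h2
      -- Otherwise the vertex of degree larger than d would carry the smaller of the branches x and
      -- q, and exchanging them would help. Hence x also has degree larger than d, and the descent
      -- cannot end.
      have hxq : q.deg ≤ x.deg := by
        by_contra! hlt
        have h3 := wgt_supermod_strict (by omega : 2 ≤ d) (by omega : d < 0 + m.length + 2)
          hgx.two_le_deg hlt
        linarith
      exact ih x (by simp) h1 (by simpa [Ctx.fill_comp] using hs) (by omega)

/-- The root moves towards a vertex of degree larger than d until it is adjacent to one. By `Reg`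
that neighbour has no arms, so all its branches are large, and by `no_larger` the other side has no
larger degrees. From there `descend` leads away from it. -/
theorem Min.climb {d : ℕ} {b : RTree} {L : List RTree} (h : Min (node (b :: L)))
    (hs : 10 ≤ size (node (b :: L))) (hd : L.length + 1 = d) (hd3 : 3 ≤ d) (hL : 0 < ntc L)
    (hregb : Everywhere (Reg d) b) (hreg : ∀ b ∈ L, Everywhere (Reg d) b)
    (hb : ¬ Everywhere (·.length + 1 ≤ d) b)
    (h5 : 5 ≤ cntm d b + armc L + cntmL d L) : False := by
  induction b using ind generalizing L with
  | h m ih =>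
    have hgood : ∀ x ∈ node m :: L, Good x := fun x hx =>
      h.good_of_mem (by simp; omega) hs hx
    rcases Nat.lt_or_ge d (m.length + 1) with hlt | hge
    · refine h.descend hs hd hd3 hL hreg (fun y hy => ?_) (by simp; omega)
        (.inr ⟨by simpa using hlt, ?_, h5⟩)
      · by_contra hcon
        refine hcon (Everywhere.of_fill fun C w hw => ?_)
        by_contra hw'
        obtain ⟨L', hp⟩ := exists_perm_cons hy
        have hlen := hp.length_eq
        have hsz := sizeL_perm hp
        have h1 := h.perm (hp.cons _)
        rw [← hw] at h1 hsz
        exact h1.no_larger (d := d) (by simp at *; omega) (by simp at *; omega) hd3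
          (by simpa using hlt) (by simp; omega)
      · have h0 : armc m = 0 := by
          by_contra h0
          have := hregb.here.2 (Nat.pos_of_ne_zero h0)
          omega
        have := armc_add_ntc (l := m) fun z hz =>
          ((hgood (node m) (by simp)).kids (by simp; omega) hz).two_le_deg
        simp
        omega
    · obtain ⟨b', hb', hbig⟩ : ∃ b' ∈ m, ¬ Everywhere (·.length + 1 ≤ d) b' := by
        by_contra! hcon
        exact hb (.node m hge hcon)
      have hm3 : 3 ≤ m.length + 1 := by
        by_contra! hlt
        rcases (hgood (node m) (by simp)).eq_leg (by
          have := List.length_pos_of_mem hb'; simp; omega) with h1 | h1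
        all_goals
          rw [h1] at hb
          exact hb (everywhere_leg (P := (·.length + 1 ≤ d)) (by simp; omega) (by simp; omega) _)
      have hgb' : Good b' := (hgood (node m) (by simp)).kids (by simpa using hm3) hb'
      have hb3 : 3 ≤ b'.deg := by
        by_contra! hlt
        rcases hgb'.eq_leg (by have := hgb'.two_le_deg; omega) with rfl | rfl
        all_goals
          exact hbig (everywhere_leg (P := (·.length + 1 ≤ d)) (by simp; omega) (by simp; omega) _)
      have hnt := ntc_pos hb' hb3
      have h1 := hregb.here.1 hnt
      obtain ⟨m', hp⟩ := exists_perm_cons hb'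
      have hlen := hp.length_eq
      have hsz := sizeL_perm hp
      have harm : armc m = armc m' := by
        rw [armc_perm hp, armc_cons, if_neg (by omega)]; rfl
      have hcnt := cntmL_perm (d := d) hp
      rw [cntm_node, if_pos ⟨by omega, hnt⟩] at h5
      rw [cntmL_cons] at hcnt
      have h2 := (h.reroot.perm (hp.cons _)).perm (List.Perm.swap _ _ _)
      refine ih b' hb' h2 (by simp at *; omega) (by simp at *; omega) ?_ (hregb.branches b' hb') ?_
        hbig ?_
      · rw [ntc_cons, if_pos (by simp; omega)]; omega
      · intro y hy
        simp at hy
        rcases hy with rfl | hy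
        · exact .node _ ⟨fun _ => by omega, fun _ => by omega⟩ hreg
        · exact hregb.branches y (hp.mem_iff.2 (by simp [hy]))
      · rw [armc_cons, if_neg (by simp; omega), cntmL_cons, cntm_node, if_pos ⟨by omega, hL⟩]
        omega

/-- An arm costs the same everywhere, while a large branch is cheaper at a vertex of larger degree.
Exchanging an arm of the root with a large branch elsewhere, or the reverse, gives the two bounds.
-/
theorem Min.reg {b : RTree} {l : List RTree} (h : Min (node (b :: l))) (hl : 2 ≤ l.length)
    (hs : 10 ≤ size (node (b :: l))) (ha : 0 < armc l ∨ b.deg = 2) (hn : 0 < ntc l) :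
    Everywhere (Reg (l.length + 1)) b := by
  have hg := h.good hl hs
  by_cases hb2 : b.deg = 2
  · rcases hg.eq_leg hb2 with rfl | rfl <;> exact reg_leg (by omega) _
  refine Everywhere.of_fill fun C m hm => ⟨fun hnt => ?_, fun harm => ?_⟩
  · obtain ⟨y, hy, hy3⟩ := exists_of_ntc_pos hnt
    obtain ⟨m', hp⟩ := exists_perm_cons hy
    obtain ⟨x, hx, hx2⟩ := exists_of_armc_pos (ha.resolve_right hb2)
    obtain ⟨l', hpl⟩ := exists_perm_cons hx
    have hl1 := hp.length_eq
    have hl2 := hpl.length_eq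
    rw [← hm] at h
    have h1 := ((h.fill_perm hp).perm (hpl.cons _)).perm (List.Perm.swap _ _ _)
    have h2 : Min (node (x :: (C.comp (.sub [] .hole m')).fill y :: l')) := by
      simpa [Ctx.fill_comp] using h1
    have h3 := h2.exchange
    simp only [Ctx.hdeg_comp, Ctx.hdeg_sub, Ctx.hdeg_hole, List.length_nil, hx2] at h3
    rw [wgt_two_right (by omega : 1 ≤ l'.length + 2),
      wgt_two_right (by omega : 1 ≤ 0 + m'.length + 2)] at h3
    by_contra! hlt
    simp at hl1 hl2
    have h4 := wgt_strictAnti hy3 (by omega : 1 ≤ 0 + m'.length + 2)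
      (by omega : 0 + m'.length + 2 < l'.length + 2)
    rw [wgt_comm y.deg, wgt_comm y.deg] at h4
    linarith
  · obtain ⟨x, hx, hx2⟩ := exists_of_armc_pos harm
    obtain ⟨m', hp⟩ := exists_perm_cons hx
    obtain ⟨z, hz, hz3⟩ := exists_of_ntc_pos hn
    obtain ⟨l', hpl⟩ := exists_perm_cons hz
    have hl1 := hp.length_eq
    have hl2 := hpl.length_eq
    rw [← hm] at h
    have h1 := ((h.fill_perm hp).perm (hpl.cons _)).perm (List.Perm.swap _ _ _)
    have h2 : Min (node (z :: (C.comp (.sub [] .hole m')).fill x :: l')) := by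
      simpa [Ctx.fill_comp] using h1
    have h3 := h2.exchange
    simp only [Ctx.hdeg_comp, Ctx.hdeg_sub, Ctx.hdeg_hole, List.length_nil, hx2] at h3
    rw [wgt_two_right (by omega : 1 ≤ l'.length + 2),
      wgt_two_right (by omega : 1 ≤ 0 + m'.length + 2)] at h3
    by_contra! hlt
    simp at hl1 hl2
    have h4 := wgt_strictAnti hz3 (by omega : 1 ≤ l'.length + 2)
      (by omega : l'.length + 2 < 0 + m'.length + 2)
    rw [wgt_comm z.deg, wgt_comm z.deg] at h4
    linarith

/-- Rooted at a vertex with an arm and two larger branches, a minimal tree has few arms at such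
vertices. -/
theorem Min.mixed_root {l : List RTree} (h : Min (node l)) (hl : 3 ≤ l.length)
    (hs : 10 ≤ size (node l)) (ha : 0 < armc l) (hn : 2 ≤ ntc l)
    (hK : 4 ≤ armc l + mixedL l ∧ (∀ b ∈ l, Everywhere (·.length + 1 ≤ l.length) b) ∨
      5 ≤ armc l + mixedL l) : False := by
  have hgood : ∀ x ∈ l, Good x := fun x hx => h.good_of_mem hl hs hx
  have hreg : ∀ b ∈ l, Everywhere (Reg l.length) b := by
    intro b hb
    obtain ⟨l', hp⟩ := exists_perm_cons hb
    have hlen := hp.length_eq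
    have hsz := sizeL_perm hp
    rw [armc_perm hp, armc_cons] at ha
    rw [ntc_perm hp, ntc_cons] at hn
    simp at hlen hsz hs
    have := (h.perm hp).reg (by omega) (by simp; omega)
      (by by_cases h : b.deg = 2 <;> simp_all) (by split_ifs at hn <;> omega)
    rwa [← hlen] at this
  have hle := mixedL_le_cntmL hreg
  by_cases hmax : ∀ b ∈ l, Everywhere (·.length + 1 ≤ l.length) b
  · have h4 : 4 ≤ armc l + cntmL l.length l := by omega
    have hdeg : ∀ b ∈ l, b.deg ≤ l.length := by
      rintro ⟨m⟩ hb
      exact (hmax _ hb).here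
    by_cases hcl : ∀ b ∈ l, 3 ≤ b.deg → CL b
    · have h0 : cntmL l.length l = 0 := by
        by_contra h2
        obtain ⟨z, hz, hz3⟩ := exists_of_cntmL_pos (Nat.pos_of_ne_zero h2)
        have hg := hgood z hz
        rcases Nat.lt_or_ge z.deg 3 with h4 | h4
        · rw [cntm_arm (.inl hg) (by have := hg.two_le_deg; omega)] at hz3
          omega
        · rw [(hcl z hz h4).cntm_eq_zero hg] at hz3
          omega
      obtain ⟨c, hc, hc3⟩ := exists_of_ntc_pos (by omega : 0 < ntc l)
      obtain ⟨A, hp⟩ := exists_perm_cons hc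
      have hlen := hp.length_eq
      have hsz := sizeL_perm hp
      have harm : armc l = armc A := by rw [armc_perm hp, armc_cons, if_neg (by omega)]; rfl
      have := hdeg c hc
      refine (h.perm hp).not_four_arms (by simp at *; omega) (by omega) (hcl c hc hc3)
        (by simp at *; omega) fun b hb => ?_
      have hb' : b ∈ l := hp.mem_iff.2 (by simp [hb])
      have := hdeg b hb'
      exact ⟨(hgood b hb').two_le_deg, by simp at *; omega⟩
    · push Not at hcl
      obtain ⟨b, hb, hb3, hbc⟩ := hcl
      have hnt := ((hgood b hb).cl_or hb3).resolve_left hbc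
      obtain ⟨m⟩ := b
      obtain ⟨l', hp⟩ := exists_perm_cons hb
      have hlen := hp.length_eq
      have hsz := sizeL_perm hp
      simp at hnt hlen hsz hb3
      have h1 := (hreg _ hb).here.1 hnt
      have h2 := (hmax _ hb).here
      have harm : armc l = armc l' := by
        rw [armc_perm hp, armc_cons, if_neg (by simp; omega)]; rfl
      have hcnt := cntmL_perm (d := l.length) hp
      rw [cntmL_cons, cntm_node, if_pos ⟨by omega, hnt⟩] at hcnt
      have hn' : 0 < ntc l' := by
        rw [ntc_perm hp, ntc_cons] at hn
        split_ifs at hn <;> omega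
      refine (h.perm hp).reroot.descend (d := l.length) (by simp at *; omega) (by omega) hl hnt
        (hreg _ hb).branches (hmax _ hb).branches (by simp; omega)
        (.inl ⟨by simp; omega, hn', ?_⟩)
      rw [cntm_node, if_pos ⟨by omega, hn'⟩]
      omega
  · have h5 : 5 ≤ armc l + cntmL l.length l := by
      rcases hK with hK | hK
      · exact absurd hK.2 hmax
      · omega
    push Not at hmax
    obtain ⟨b, hb, hbig⟩ := hmax
    obtain ⟨L, hp⟩ := exists_perm_cons hb
    have hlen := hp.length_eq
    have hsz := sizeL_perm hp
    have hb3 : 3 ≤ b.deg := by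
      by_contra! hlt
      have hg := hgood b hb
      rcases hg.eq_leg (by have := hg.two_le_deg; omega) with rfl | rfl
      all_goals
        exact hbig (everywhere_leg (P := (·.length + 1 ≤ l.length)) (by simp; omega)
          (by simp; omega) _)
    have harm : armc l = armc L := by rw [armc_perm hp, armc_cons, if_neg (by omega)]; rfl
    have hcnt := cntmL_perm (d := l.length) hp
    rw [cntmL_cons] at hcnt
    rw [ntc_perm hp, ntc_cons, if_pos hb3] at hn
    exact (h.perm hp).climb (d := l.length) (by simp at *; omega) (by simp at *; omega) hl
      (by omega) (hreg b hb) (fun y hy => hreg y (hp.mem_iff.2 (by simp [hy]))) hbig (by omega)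

/-- The root moves to a mixed vertex, where the branch back to the old root is large as well, so
that `mixed_root` applies. The count does not drop on the way. -/
theorem Min.walk {b : RTree} {L : List RTree} (h : Min (node (b :: L)))
    (hs : 10 ≤ size (node (b :: L))) (hL : 2 ≤ L.length) (hb : 0 < mixed b)
    (h5 : 5 ≤ mixed b + mixed (node L)) : False := by
  induction b using ind generalizing L with
  | h m ih =>
    have hg := h.good hL hs
    have hm3 : 3 ≤ (node m).deg := by
      by_contra! hlt
      rw [mixed_le_of_deg_two (.inl hg) (by omega)] at hb
      omega
    simp at hm3
    by_cases hmix : 0 < ntc m ∧ 0 < armc m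
    · rw [mixed_node, if_pos hmix.1] at h5
      refine h.reroot.mixed_root (by simp; omega) (by simp at *; omega) ?_ ?_ (.inr ?_)
      · rw [armc_cons]; omega
      · rw [ntc_cons, if_pos (by simp; omega)]; omega
      · rw [armc_cons, mixedL_cons]; omega
    · have h0 : mixed (node m) = mixedL m := by
        rw [mixed_node]
        have : (if 0 < ntc m then armc m else 0) = 0 := by split_ifs <;> omega
        omega
      obtain ⟨b', hb', hpos⟩ := exists_of_mixedL_pos (by omega : 0 < mixedL m)
      obtain ⟨m', hp⟩ := exists_perm_cons hb'
      have hlen := hp.length_eq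
      have hsz := sizeL_perm hp
      have hmx := mixedL_perm hp
      simp at hlen hsz hmx hs
      refine ih b' hb' ((h.reroot.perm (hp.cons _)).perm (List.Perm.swap _ _ _))
        (by simp; omega) (by simp; omega) hpos ?_
      rw [mixed_node (_ :: _), mixedL_cons]
      omega

/-- Arms are rare in minimal trees. -/
theorem Min.root_bound {cs : List RTree} (h : Min (node cs)) (hl : 3 ≤ cs.length)
    (hs : 10 ≤ size (node cs)) (hmax : ∀ b ∈ cs, Everywhere (·.length + 1 ≤ cs.length) b)
    (hsum : ∀ c ∈ cs, c.deg = cs.length → cs.length + (c.kids.map deg).sum ≤ (cs.map deg).sum) :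
    armc cs + mixedL cs ≤ 4 ∧ (0 < armc cs → armc cs + mixedL cs ≤ 3) := by
  have hgood : ∀ x ∈ cs, Good x := fun x hx => h.good_of_mem hl hs hx
  have htot := armc_add_ntc (l := cs) fun b hb => (hgood b hb).two_le_deg
  obtain ⟨c, hc, hc3⟩ := h.exists_three_le_deg hl hs
  obtain ⟨A, hp⟩ := exists_perm_cons hc
  have hlen := hp.length_eq
  have hsz := sizeL_perm hp
  have hmx := mixedL_perm hp
  have harm : armc cs = armc A := by rw [armc_perm hp, armc_cons, if_neg (by omega)]; rfl
  have hntA : ntc cs = ntc A + 1 := by rw [ntc_perm hp, ntc_cons, if_pos hc3]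
  have hcd : c.deg ≤ cs.length := by
    obtain ⟨m⟩ := c
    exact (hmax _ hc).here
  simp only [List.length_cons, sizeL_cons, mixedL_cons, size_node] at hlen hsz hmx hs
  -- Let c be the only large branch at the root. If it is no core leaf, exchanging one of its large
  -- children with an arm of the root shows that c has maximal degree too. Its neighbours then have
  -- a larger degree sum than those of the root, against the greedy choice.
  rcases Nat.lt_or_ge (ntc cs) 2 with h1 | h2
  · have hA2 : ∀ b ∈ A, b.deg = 2 := by
      intro b hb
      by_contra hne
      have := (hgood b (hp.mem_iff.2 (by simp [hb]))).two_le_deg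
      have := ntc_pos hb (by omega)
      omega
    have hmA : mixedL A = 0 := by
      by_contra h0
      obtain ⟨z, hz, hz0⟩ := exists_of_mixedL_pos (Nat.pos_of_ne_zero h0)
      rw [mixed_le_of_deg_two (.inl (hgood z (hp.mem_iff.2 (by simp [hz])))) (hA2 z hz).le] at hz0
      omega
    rcases (hgood c hc).cl_or hc3 with hcl | hnt
    · have hm0 : mixed c = 0 := by
        obtain ⟨m⟩ := c
        have h3 : ntc m = 0 := by
          by_contra h3
          obtain ⟨z, hz, hz3⟩ := exists_of_ntc_pos (Nat.pos_of_ne_zero h3)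
          have := hcl.2 z hz
          omega
        have h4 : mixedL m = 0 := by
          by_contra h0
          obtain ⟨z, hz, hz0⟩ := exists_of_mixedL_pos (Nat.pos_of_ne_zero h0)
          rw [mixed_le_of_deg_two (.inl ((hgood _ hc).kids hc3 hz)) (hcl.2 z hz).le] at hz0
          omega
        rw [mixed_node, h3, h4]
        simp
      have : armc A ≤ 3 := by
        by_contra! h4
        exact (h.perm hp).not_four_arms (by simp; omega) h4 hcl (by omega) fun b hb => by
          rw [hA2 b hb]; omega
      omega
    · exfalso
      have h3 : cs.length ≤ c.deg := by
        obtain ⟨m⟩ := c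
        obtain ⟨y, hy, hy3⟩ := exists_of_ntc_pos hnt
        obtain ⟨m', hpm⟩ := exists_perm_cons hy
        match A, hlen with
        | [], hlen => simp at hlen; omega
        | x :: A, hlen =>
          have h4 := ((h.perm hp).fill_perm (C := .hole) hpm).perm (List.Perm.swap _ _ _)
          have h5 := Min.exchange (C := .sub [] .hole m') h4
          simp only [Ctx.hdeg_sub, Ctx.hdeg_hole, List.length_nil, hA2 x (by simp)] at h5
          rw [wgt_two_right (by omega : 1 ≤ A.length + 2),
            wgt_two_right (by omega : 1 ≤ 0 + m'.length + 2)] at h5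
          by_contra! hlt
          have hl1 := hpm.length_eq
          simp at hl1 hlen hlt
          have h6 := wgt_strictAnti hy3 (by omega : 1 ≤ 0 + m'.length + 2)
            (by omega : 0 + m'.length + 2 < A.length + 2)
          rw [wgt_comm y.deg, wgt_comm y.deg] at h6
          linarith
      have h4 := hsum c hc (by omega)
      have h5 : (cs.map deg).sum = c.deg + (A.map deg).sum := by
        rw [(hp.map deg).sum_eq]; simp
      have h6 : (A.map deg).sum = A.length * 2 :=
        (List.sum_eq_card_nsmul _ 2 (by simpa using hA2)).trans (by simp)
      have h7 : c.kids.length * 2 < (c.kids.map deg).sum := by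
        have hk : ∀ z ∈ c.kids, 2 ≤ z.deg := fun z hz => ((hgood c hc).kids hc3 hz).two_le_deg
        revert hnt hk
        generalize c.kids = m
        intro hnt hk
        induction m with
        | nil => simp at hnt
        | cons a m ih =>
          have ha := hk a (by simp)
          rw [ntc_cons] at hnt
          by_cases hm : 0 < ntc m
          · have := ih hm fun z hz => hk z (by simp [hz])
            simp; omega
          · have h8 : m.length * 2 ≤ (m.map deg).sum := by
              have := List.card_nsmul_le_sum (m.map deg) 2 (by
                simpa using fun z hz => hk z (by simp [hz]))
              simpa using this
            split_ifs at hnt with h9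
            · simp; omega
            · omega
      have h8 : c.deg = c.kids.length + 1 := rfl
      omega
  -- With an arm and two large branches at a root of maximal degree, four arms are too many. Five
  -- arms in total therefore leave none at the root, and `walk` leads to a mixed vertex.
  · have key : 0 < armc cs → armc cs + mixedL cs ≤ 3 := by
      intro ha
      by_contra! h4
      exact h.mixed_root hl (by simpa using hs) ha h2 (.inl ⟨h4, hmax⟩)
    refine ⟨?_, key⟩
    by_contra! h5
    have ha : armc cs = 0 := by
      by_contra h0
      have := key (Nat.pos_of_ne_zero h0)
      omega
    obtain ⟨b, hb, hb0⟩ := exists_of_mixedL_pos (by omega : 0 < mixedL cs)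
    obtain ⟨L, hpL⟩ := exists_perm_cons hb
    have hlen := hpL.length_eq
    have hsz := sizeL_perm hpL
    have hmx := mixedL_perm hpL
    simp at hlen hsz hmx
    refine (h.perm hpL).walk (by simp; omega) (by omega) hb0 ?_
    rw [mixed_node]
    omega

end RTree

/-! ### Graphs -/

section

variable {V W : Type*}

/-- Joining two graphs by an edge. -/
def graft (G : SimpleGraph V) (H : SimpleGraph W) (a : V) (b : W) : SimpleGraph (V ⊕ W) :=
  G.sum H ⊔ edge (.inl a) (.inr b)

@[simp] theorem graft_adj_inl_inl {G : SimpleGraph V} {H : SimpleGraph W} {a : V} {b : W} {u v : V} :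
    (graft G H a b).Adj (.inl u) (.inl v) ↔ G.Adj u v := by
  simp [graft, edge_adj]

@[simp] theorem graft_adj_inr_inr {G : SimpleGraph V} {H : SimpleGraph W} {a : V} {b : W} {u v : W} :
    (graft G H a b).Adj (.inr u) (.inr v) ↔ H.Adj u v := by
  simp [graft, edge_adj]

@[simp] theorem graft_adj_inl_inr {G : SimpleGraph V} {H : SimpleGraph W} {a u : V} {b v : W} :
    (graft G H a b).Adj (.inl u) (.inr v) ↔ u = a ∧ v = b := by
  simp [graft, edge_adj]

@[simp] theorem graft_adj_inr_inl {G : SimpleGraph V} {H : SimpleGraph W} {a u : V} {b v : W} :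
    (graft G H a b).Adj (.inr v) (.inl u) ↔ u = a ∧ v = b := by
  rw [SimpleGraph.adj_comm, graft_adj_inl_inr]

end

section

variable {V W : Type*} [Fintype V] [Fintype W]

open Classical in
/-- The sum of a function over the pairs of adjacent vertices. -/
def adjSum {M : Type*} [AddCommMonoid M] (G : SimpleGraph V) (f : V → V → M) : M :=
  ∑ u, ∑ v, if G.Adj u v then f u v else 0

open Classical in
theorem deg_eq_sum (G : SimpleGraph V) (v : V) : deg G v = ∑ u, if G.Adj v u then 1 else 0 := by
  rw [deg, Set.ncard_eq_toFinset_card', ← Finset.card_filter]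
  congr 1
  ext u
  simp

theorem two_mul_abcIndex (G : SimpleGraph V) :
    2 * abcIndex G = adjSum G fun u v => wgt (deg G u) (deg G v) := by
  classical
  have h1 : adjSum G (fun u v => wgt (deg G u) (deg G v)) =
      ∑ p ∈ (Finset.univ : Finset (V × V)) with G.Adj p.1 p.2, edgeWeight G s(p.1, p.2) := by
    rw [adjSum, ← Fintype.sum_prod_type', Finset.sum_filter]
    rfl
  rw [h1, abcIndex, Finset.mul_sum, ← Finset.sum_fiberwise_of_maps_to
    (g := fun p : V × V => s(p.1, p.2)) (t := G.edgeFinset) (by simp)]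
  refine Finset.sum_congr rfl fun e he => ?_
  induction e using Sym2.ind with
  | _ u v =>
    have huv : G.Adj u v := by simpa using he
    have h2 : ({p ∈ {p ∈ (Finset.univ : Finset (V × V)) | G.Adj p.1 p.2} | s(p.1, p.2) = s(u, v)}) =
        {(u, v), (v, u)} := by
      ext ⟨a, b⟩
      simp only [Finset.mem_filter, Finset.mem_univ, true_and, Sym2.eq_iff, Finset.mem_insert,
        Finset.mem_singleton, Prod.mk.injEq]
      constructor
      · exact fun h => h.2
      · rintro (⟨rfl, rfl⟩ | ⟨rfl, rfl⟩)
        · simpa using huv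
        · simpa using huv.symm
    rw [h2, Finset.sum_pair (by simp [huv.ne]), Sym2.eq_swap (a := v), two_mul]

theorem isTree_iff_adjSum (G : SimpleGraph V) :
    G.IsTree ↔ G.Connected ∧ adjSum G (fun _ _ => 1) + 2 = 2 * Fintype.card V := by
  classical
  rw [isTree_iff_connected_and_card, Nat.card_eq_fintype_card, Nat.card_eq_fintype_card,
    ← edgeFinset_card]
  have h1 : adjSum G (fun _ _ => 1) = ∑ v, G.degree v := by
    refine Finset.sum_congr rfl fun v _ => ?_
    rw [← Finset.card_filter, ← G.card_neighborFinset_eq_degree]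
    congr 1
    ext u
    simp
  rw [h1, sum_degrees_eq_twice_card_edges]
  constructor <;> rintro ⟨h, h'⟩ <;> exact ⟨h, by omega⟩

open Classical in
theorem adjSum_graft {M : Type*} [AddCommMonoid M] (G : SimpleGraph V) (H : SimpleGraph W) (a : V)
    (b : W) (f : V ⊕ W → V ⊕ W → M) : adjSum (graft G H a b) f =
      adjSum G (fun u v => f (.inl u) (.inl v)) + adjSum H (fun u v => f (.inr u) (.inr v)) +
        (f (.inl a) (.inr b) + f (.inr b) (.inl a)) := by
  have h1 : ∀ (u : V), (∑ v : W, if u = a ∧ v = b then f (.inl u) (.inr v) else 0) =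
      if u = a then f (.inl u) (.inr b) else 0 := by
    intro u
    by_cases hu : u = a <;> simp [hu]
  have h2 : ∀ (v : W), (∑ u : V, if u = a ∧ v = b then f (.inr v) (.inl u) else 0) =
      if v = b then f (.inr v) (.inl a) else 0 := by
    intro v
    by_cases hv : v = b <;> simp [hv]
  simp only [adjSum, Fintype.sum_sum_type, graft_adj_inl_inl, graft_adj_inl_inr,
    graft_adj_inr_inl, graft_adj_inr_inr, h1, h2, Finset.sum_add_distrib]
  simp only [Finset.sum_ite_eq', Finset.mem_univ, if_true]
  abel

open Classical in
theorem deg_graft_inl (G : SimpleGraph V) (H : SimpleGraph W) (a : V) (b : W) (v : V) :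
    deg (graft G H a b) (.inl v) = deg G v + if v = a then 1 else 0 := by
  rw [deg_eq_sum, deg_eq_sum, Fintype.sum_sum_type]
  by_cases hv : v = a <;> simp [hv]

open Classical in
theorem deg_graft_inr (G : SimpleGraph V) (H : SimpleGraph W) (a : V) (b : W) (v : W) :
    deg (graft G H a b) (.inr v) = deg H v + if v = b then 1 else 0 := by
  rw [deg_eq_sum, deg_eq_sum, Fintype.sum_sum_type]
  by_cases hv : v = b <;> simp [hv, add_comm]

theorem isTree_graft {G : SimpleGraph V} {H : SimpleGraph W} (hG : G.IsTree) (hH : H.IsTree) (a : V)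
    (b : W) : (graft G H a b).IsTree := by
  rw [isTree_iff_adjSum] at *
  refine ⟨hG.1.sum_sup_edge hH.1, ?_⟩
  rw [adjSum_graft, Fintype.card_sum]
  omega

end

-- ### Realizing plane trees by graphs

open Classical in
/-- Every rooted plane tree is realized by a graph. -/
theorem exists_graph (t : RTree) : ∃ (W : Type) (_ : Fintype W) (H : SimpleGraph W) (w : W),
    H.IsTree ∧ Fintype.card W = t.size ∧ deg H w = t.kids.length ∧
      ∀ o, (adjSum H fun u v => wgt (deg H u + if u = w then o else 0)
        (deg H v + if v = w then o else 0)) = 2 * RTree.brL (t.kids.length + o) t.kids := by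
  induction t using RTree.ind with
  | h l ih =>
    -- Branches are grafted one at a time. The offset o stands for edges still to be attached at the
    -- root: the part built so far is used with o + 1, the new branch with 1.
    induction l with
    | nil =>
      refine ⟨Unit, inferInstance, ⊥, (), IsTree.of_subsingleton, by simp, ?_, fun o => ?_⟩
      · simp [deg]
      · simp [adjSum]
    | cons b l ihl =>
      obtain ⟨W₁, _, H₁, w₁, hT₁, hc₁, hd₁, hs₁⟩ := ihl fun t ht => ih t (by simp [ht])
      obtain ⟨W₂, _, H₂, w₂, hT₂, hc₂, hd₂, hs₂⟩ := ih b (by simp)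
      refine ⟨W₁ ⊕ W₂, inferInstance, graft H₁ H₂ w₁ w₂, .inl w₁, isTree_graft hT₁ hT₂ _ _, ?_, ?_,
        fun o => ?_⟩
      · simp at hc₁ hc₂ ⊢; omega
      · rw [deg_graft_inl, hd₁]; simp
      · have h1 := hs₁ (o + 1)
        have h2 := hs₂ 1
        rw [adjSum_graft]
        simp only [deg_graft_inl, deg_graft_inr, Sum.inl.injEq, reduceCtorEq, if_false, add_zero,
          if_true, hd₁, hd₂]
        have e1 : ∀ u : W₁, deg H₁ u + (if u = w₁ then 1 else 0) + (if u = w₁ then o else 0) =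
            deg H₁ u + if u = w₁ then o + 1 else 0 := by
          intro u; split_ifs <;> omega
        simp only [e1, h1, h2]
        obtain ⟨m⟩ := b
        simp only [RTree.kids_node, RTree.brL_cons, RTree.br_node, List.length_cons]
        rw [wgt_comm (m.length + 1), add_right_comm l.length 1 o, add_assoc l.length o 1]
        ring

section

variable {V W : Type*} [Fintype V] [Fintype W]

theorem deg_iso {G : SimpleGraph V} {H : SimpleGraph W} (e : G ≃g H) (v : V) :
    deg H (e v) = deg G v := by
  classical
  rw [deg_eq_sum, deg_eq_sum, ← e.toEquiv.sum_comp]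
  refine Finset.sum_congr rfl fun u _ => ?_
  exact if_congr e.map_adj_iff rfl rfl

theorem abcIndex_iso {G : SimpleGraph V} {H : SimpleGraph W} (e : G ≃g H) :
    abcIndex G = abcIndex H := by
  classical
  have h : 2 * abcIndex G = 2 * abcIndex H := by
    rw [two_mul_abcIndex, two_mul_abcIndex, adjSum, adjSum, ← e.toEquiv.sum_comp]
    refine Finset.sum_congr rfl fun u _ => ?_
    rw [← e.toEquiv.sum_comp]
    refine Finset.sum_congr rfl fun v _ => ?_
    refine if_congr e.map_adj_iff.symm ?_ rfl
    exact congrArg₂ wgt (deg_iso e u).symm (deg_iso e v).symm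
  linarith

theorem exists_isTree_abcIndex {t : RTree} (ht : t.size = Fintype.card V) :
    ∃ H : SimpleGraph V, H.IsTree ∧ abcIndex H = t.abc := by
  classical
  obtain ⟨W, _, H, w, hT, hc, hd, hs⟩ := exists_graph t
  let e : W ≃ V := Fintype.equivOfCardEq (by omega)
  let f : H ≃g H.map e.toEmbedding := Iso.map e H
  refine ⟨_, f.isTree_iff.1 hT, ?_⟩
  rw [← abcIndex_iso f]
  have h1 := hs 0
  simp only [ite_self, add_zero] at h1
  have h2 := two_mul_abcIndex H
  have h3 : t.abc = RTree.brL t.kids.length t.kids := rfl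
  linarith

end

open RTree

/-! ### Rooted trees as graphs -/

section

variable {V : Type*} {G : SimpleGraph V} {r : V}

theorem adj_iff_isChild (hG : G.IsTree) {u v : V} :
    G.Adj u v ↔ IsChild G r u v ∨ IsChild G r v u := by
  constructor
  · intro h
    rcases hG.dist_eq_dist_add_one_of_adj r h with h1 | h1
    · exact .inr ⟨h.symm, h1⟩
    · exact .inl ⟨h, h1⟩
  · rintro (h | h)
    · exact h.1
    · exact h.1.symm

theorem IsChild.not_isChild {u v : V} (h : IsChild G r u v) : ¬ IsChild G r v u := fun h' => by
  have := h.2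
  have := h'.2
  omega

theorem IsChild.ne_root {u v : V} (h : IsChild G r u v) : v ≠ r := by
  rintro rfl
  have := h.2
  simp at this

theorem isChild_root_iff {v : V} : IsChild G r r v ↔ G.Adj r v := by
  simp only [IsChild, dist_self, zero_add, dist_eq_one_iff_adj, and_self]

/-- Geodesics from r to the two parents, extended by the last edge, are paths with the same ends,
hence equal, and so are their penultimate vertices. -/
theorem IsChild.parent_eq (hG : G.IsTree) {u u' v : V} (h : IsChild G r u v)
    (h' : IsChild G r u' v) : u = u' := by
  obtain ⟨p, hp⟩ := hG.connected.exists_walk_length_eq_dist r u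
  obtain ⟨p', hp'⟩ := hG.connected.exists_walk_length_eq_dist r u'
  have h1 : (p.concat h.1).IsPath := Walk.isPath_of_length_eq_dist _ (by
    rw [Walk.length_concat, hp, h.2])
  have h2 : (p'.concat h'.1).IsPath := Walk.isPath_of_length_eq_dist _ (by
    rw [Walk.length_concat, hp', h'.2])
  have h3 := congrArg Subtype.val ((hG.isAcyclic.subsingleton_path r v).elim ⟨_, h1⟩ ⟨_, h2⟩)
  have h4 := congrArg Walk.penultimate h3
  simpa using h4

theorem exists_parent (hG : G.IsTree) {v : V} (hv : v ≠ r) : ∃ u, IsChild G r u v := by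
  obtain ⟨p, hp⟩ := hG.connected.exists_walk_length_eq_dist v r
  cases p with
  | nil => exact absurd rfl hv
  | cons h q =>
    rename_i w
    refine ⟨w, h.symm, ?_⟩
    have h1 := dist_le q
    rw [Walk.length_cons, dist_comm] at hp
    rw [dist_comm] at h1
    rcases hG.dist_eq_dist_add_one_of_adj r h with h2 | h2 <;> omega

variable [Fintype V]

theorem dist_lt_card (hG : G.IsTree) (v : V) : G.dist r v < Fintype.card V := by
  obtain ⟨p, hp, hl⟩ := hG.connected.exists_path_of_dist r v
  rw [← hl]
  exact hp.length_lt

open Classical in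
/-- The set of children as a finite set. -/
def childFinset (G : SimpleGraph V) (r u : V) : Finset V := {c | IsChild G r u c}

@[simp] theorem mem_childFinset {u c : V} : c ∈ childFinset G r u ↔ IsChild G r u c := by
  simp [childFinset]

theorem ncard_children (u : V) : (children G r u).ncard = (childFinset G r u).card := by
  rw [← Set.ncard_coe_finset]
  congr 1
  ext c
  simp [children]

/-- Recursion on the fuel |V| − dist(r, v), which is positive and drops by one from a vertex to its
children. -/
theorem exists_unfolding (hG : G.IsTree) (r : V) :
    ∃ sub : V → RTree, ∀ v, sub v = node ((childFinset G r v).toList.map sub) := by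
  let T : ℕ → V → RTree := fun n => n.rec (fun _ => node [])
    fun _ T v => node ((childFinset G r v).toList.map T)
  refine ⟨fun v => T (Fintype.card V - G.dist r v) v, fun v => ?_⟩
  have h1 := dist_lt_card (r := r) hG v
  obtain ⟨n, hn⟩ : ∃ n, Fintype.card V - G.dist r v = n + 1 := ⟨Fintype.card V - G.dist r v - 1, by
    omega⟩
  simp only [hn]
  change node _ = _
  congr 1
  refine List.map_congr_left fun c hc => ?_
  have h2 : G.dist r c = G.dist r v + 1 := (mem_childFinset.1 (Finset.mem_toList.1 hc)).2
  rw [show Fintype.card V - G.dist r c = n by omega]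

/-- Each vertex of level k + 1 has exactly one parent, on level k, so the recursion for S passes its
sum on to the next level. Levels from |V| on are empty, which starts the induction. -/
theorem sum_level (hG : G.IsTree) {M : Type*} [AddCommMonoid M] {S φ : V → M}
    (h : ∀ v, S v = φ v + ∑ c ∈ childFinset G r v, S c) (n k : ℕ) (hn : Fintype.card V ≤ n + k) :
    ∑ v with G.dist r v = k, S v = ∑ v with k ≤ G.dist r v, φ v := by
  induction n generalizing k with
  | zero =>
    rw [Finset.sum_eq_zero, Finset.sum_eq_zero]
    all_goals
      intro v hv
      have := dist_lt_card (r := r) hG v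
      simp at hv
      omega
  | succ n ih =>
    have h1 : ∑ v with G.dist r v = k, ∑ c ∈ childFinset G r v, S c =
        ∑ c with G.dist r c = k + 1, S c := by
      classical
      rw [Finset.sum_comm' (t' := Finset.univ.filter (G.dist r · = k + 1))
        (s' := fun c => Finset.univ.filter (IsChild G r · c))]
      · refine Finset.sum_congr rfl fun c hc => ?_
        have hc : G.dist r c = k + 1 := by simpa using hc
        obtain ⟨u, hu⟩ := exists_parent (r := r) hG (v := c) (by rintro rfl; simp at hc)
        have : Finset.univ.filter (IsChild G r · c) = {u} := by
          ext v
          simp only [Finset.mem_filter, Finset.mem_univ, true_and, Finset.mem_singleton]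
          exact ⟨fun hv => hv.parent_eq hG hu, fun hv => hv ▸ hu⟩
        rw [this, Finset.sum_singleton]
      · intro v c
        simp only [Finset.mem_filter, Finset.mem_univ, true_and, mem_childFinset]
        constructor
        · rintro ⟨h1, h2⟩
          exact ⟨h2, by rw [h2.2, h1]⟩
        · rintro ⟨h1, h2⟩
          have := h1.2
          exact ⟨by omega, h1⟩
    rw [Finset.sum_congr rfl fun v _ => h v, Finset.sum_add_distrib, h1, ih (k + 1) (by omega)]
    classical
    rw [← Finset.sum_union]
    · refine Finset.sum_congr ?_ fun _ _ => rfl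
      ext v
      simp
      omega
    · rw [Finset.disjoint_left]
      intro v
      simp
      omega

theorem sum_unfold (hG : G.IsTree) {M : Type*} [AddCommMonoid M] {S φ : V → M}
    (h : ∀ v, S v = φ v + ∑ c ∈ childFinset G r v, S c) : S r = ∑ v, φ v := by
  have h1 := sum_level hG h (Fintype.card V) 0 (by omega)
  have h2 : ({v | G.dist r v = 0} : Finset V) = {r} := by
    ext v
    simp [hG.connected.dist_eq_zero_iff, eq_comm]
  rw [h2, Finset.sum_singleton] at h1
  simpa using h1

open Classical in
theorem adjSum_eq_sum_children (hG : G.IsTree) {M : Type*} [AddCommMonoid M] (r : V)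
    (f : V → V → M) :
    adjSum G f = ∑ u, ∑ c ∈ childFinset G r u, f u c + ∑ u, ∑ c ∈ childFinset G r u, f c u := by
  have h1 : ∀ g : V → V → M, ∑ u, ∑ c ∈ childFinset G r u, g u c =
      ∑ u, ∑ c, if IsChild G r u c then g u c else 0 := fun g => by
    refine Finset.sum_congr rfl fun u _ => ?_
    rw [childFinset, Finset.sum_filter]
  rw [h1, h1, Finset.sum_comm (f := fun u c => if IsChild G r u c then f c u else 0),
    ← Finset.sum_add_distrib, adjSum]
  refine Finset.sum_congr rfl fun u _ => ?_
  rw [← Finset.sum_add_distrib]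
  refine Finset.sum_congr rfl fun v _ => ?_
  by_cases h2 : IsChild G r u v
  · rw [if_pos h2.1, if_pos h2, if_neg h2.not_isChild, add_zero]
  · by_cases h3 : IsChild G r v u
    · rw [if_pos h3.1.symm, if_neg h2, if_pos h3, zero_add]
    · rw [if_neg (fun h => ((adj_iff_isChild hG).1 h).elim h2 h3), if_neg h2, if_neg h3, add_zero]

theorem abcIndex_eq_sum (hG : G.IsTree) (r : V) :
    abcIndex G = ∑ u, ∑ c ∈ childFinset G r u, wgt (deg G u) (deg G c) := by
  have h1 := two_mul_abcIndex G
  rw [adjSum_eq_sum_children hG r] at h1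
  simp only [fun u c => wgt_comm (deg G c) (deg G u)] at h1
  linarith

open Classical in
theorem sum_neighbors (hG : G.IsTree) {M : Type*} [AddCommMonoid M] (f : V → M) (v : V) :
    ∑ u with G.Adj v u, f u = ∑ c ∈ childFinset G r v, f c + ∑ u with IsChild G r u v, f u := by
  rw [← Finset.sum_union]
  · refine Finset.sum_congr ?_ fun _ _ => rfl
    ext u
    simp [adj_iff_isChild (r := r) hG]
  · rw [Finset.disjoint_left]
    intro u hu
    simpa using (mem_childFinset.1 hu).not_isChild

open Classical in
theorem filter_parent (hG : G.IsTree) {u v : V} (h : IsChild G r u v) :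
    ({u | IsChild G r u v} : Finset V) = {u} := by
  ext w
  simp only [Finset.mem_filter, Finset.mem_univ, true_and, Finset.mem_singleton]
  exact ⟨fun hw => hw.parent_eq hG h, fun hw => hw ▸ h⟩

open Classical in
theorem filter_parent_root : ({u | IsChild G r u r} : Finset V) = ∅ := by
  ext w
  simpa using fun h : IsChild G r w r => h.ne_root rfl

theorem deg_root (hG : G.IsTree) (r : V) : deg G r = (childFinset G r r).card := by
  classical
  rw [deg_eq_sum, ← Finset.sum_filter, sum_neighbors (r := r) hG, filter_parent_root]
  simp

theorem deg_of_ne_root (hG : G.IsTree) {v : V} (hv : v ≠ r) :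
    deg G v = (childFinset G r v).card + 1 := by
  classical
  obtain ⟨u, hu⟩ := exists_parent hG hv
  rw [deg_eq_sum, ← Finset.sum_filter, sum_neighbors (r := r) hG, filter_parent hG hu]
  simp

theorem finsum_neighborSet (G : SimpleGraph V) [DecidableRel G.Adj] (f : V → ℕ) (v : V) :
    ∑ᶠ w ∈ G.neighborSet v, f w = ∑ w with G.Adj v w, f w := by
  rw [← finsum_mem_coe_finset]
  refine finsum_mem_congr (by ext; simp) fun _ _ => rfl

end

/-! ### The unfolding of a tree -/

theorem brL_map {α : Type*} (D : ℕ) (L : List α) (f : α → RTree) :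
    brL D (L.map f) = (L.map fun c => wgt D (f c).deg + inner (f c)).sum := by
  induction L with
  | nil => simp
  | cons a L ih => simp [ih, br]

theorem armc_map {α : Type*} (s : Finset α) (f : α → RTree) :
    armc (s.toList.map f) = {c ∈ s | (f c).deg = 2}.card := by
  rw [Finset.card_filter, ← Finset.sum_map_toList]
  generalize s.toList = L
  induction L with
  | nil => simp
  | cons a L ih => simp [armc_cons, ih, add_comm]

section

variable {V : Type*} [Fintype V] {G : SimpleGraph V} {r : V} {sub : V → RTree}

theorem kids_sub (hsub : ∀ v, sub v = node ((childFinset G r v).toList.map sub)) (v : V) :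
    (sub v).kids = (childFinset G r v).toList.map sub := by
  rw [hsub v]; rfl

theorem deg_sub (hG : G.IsTree) (hsub : ∀ v, sub v = node ((childFinset G r v).toList.map sub))
    {v : V} (hv : v ≠ r) : (sub v).deg = deg G v := by
  rw [hsub v, deg_of_ne_root hG hv]
  simp

theorem mem_kids_sub (hsub : ∀ v, sub v = node ((childFinset G r v).toList.map sub)) {v : V}
    {t : RTree} : t ∈ (sub v).kids ↔ ∃ c, IsChild G r v c ∧ sub c = t := by
  simp [kids_sub hsub]

theorem sub_induction (hG : G.IsTree)
    (hsub : ∀ v, sub v = node ((childFinset G r v).toList.map sub)) {Q : RTree → Prop}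
    (hQ : ∀ t, Q t → ∀ c ∈ t.kids, Q c) (h0 : ∀ c ∈ (sub r).kids, Q c) {v : V} (hv : v ≠ r) :
    Q (sub v) := by
  obtain ⟨n, hn⟩ : ∃ n, G.dist r v = n := ⟨_, rfl⟩
  induction n generalizing v with
  | zero => exact absurd (hG.connected.dist_eq_zero_iff.1 hn).symm hv
  | succ n ih =>
    obtain ⟨u, hu⟩ := exists_parent hG hv
    have h1 : sub v ∈ (sub u).kids := (mem_kids_sub hsub).2 ⟨v, hu, rfl⟩
    by_cases hur : u = r
    · subst hur
      exact h0 _ h1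
    · exact hQ _ (ih hur (by have := hu.2; omega)) _ h1

theorem size_sub (hG : G.IsTree) (hsub : ∀ v, sub v = node ((childFinset G r v).toList.map sub)) :
    (sub r).size = Fintype.card V := by
  have h1 : ∀ v, (sub v).size = 1 + ∑ c ∈ childFinset G r v, (sub c).size := fun v => by
    conv_lhs => rw [hsub v, size_node, sizeL_eq, List.map_map]
    rw [← Finset.sum_map_toList, add_comm]
    rfl
  rw [sum_unfold (S := fun v => (sub v).size) (φ := fun _ => 1) hG h1]
  simp

theorem abc_sub (hG : G.IsTree) (hsub : ∀ v, sub v = node ((childFinset G r v).toList.map sub)) :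
    (sub r).abc = abcIndex G := by
  classical
  -- The root is treated apart because it has no parent edge: its degree is its number of children,
  -- not one more.
  have h1 : ∀ v, (if v = r then (sub v).abc else (sub v).inner) =
      (∑ c ∈ childFinset G r v, wgt (deg G v) (deg G c)) +
        ∑ c ∈ childFinset G r v, if c = r then (sub c).abc else (sub c).inner := fun v => by
    have h2 : ∀ D, (∑ c ∈ childFinset G r v, wgt D (deg G c)) +
        ∑ c ∈ childFinset G r v, (if c = r then (sub c).abc else (sub c).inner) =
        brL D ((childFinset G r v).toList.map sub) := fun D => by
      rw [brL_map, Finset.sum_map_toList, ← Finset.sum_add_distrib]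
      refine Finset.sum_congr rfl fun c hc => ?_
      have hc := (mem_childFinset.1 hc).ne_root
      rw [if_neg hc, deg_sub hG hsub hc]
    rw [h2]
    split_ifs with hv
    · subst hv
      rw [hsub v, abc_node, deg_root hG, List.length_map, Finset.length_toList]
    · rw [hsub v, inner_node, deg_of_ne_root hG hv, List.length_map, Finset.length_toList]
  have h2 := sum_unfold hG h1
  rw [if_pos rfl] at h2
  rw [h2, abcIndex_eq_sum hG r]

theorem min_sub (hG : IsMinimalABC G)
    (hsub : ∀ v, sub v = node ((childFinset G r v).toList.map sub)) : RTree.Min (sub r) := by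
  intro t' ht'
  obtain ⟨H, hH, hH'⟩ := exists_isTree_abcIndex (V := V) (ht'.trans (size_sub hG.1 hsub))
  rw [abc_sub hG.1 hsub, ← hH']
  exact hG.2 H hH

open Classical in
theorem mixed_sub (hG : G.IsTree) (hsub : ∀ v, sub v = node ((childFinset G r v).toList.map sub)) :
    armc (sub r).kids + mixedL (sub r).kids = ∑ v,
      if v = r ∨ ∃ c, IsChild G r v c ∧ 3 ≤ deg G c then
        {c ∈ childFinset G r v | deg G c = 2}.card else 0 := by
  have h1 : ∀ v, (if v = r then armc (sub v).kids + mixedL (sub v).kids else (sub v).mixed) =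
      (if v = r ∨ ∃ c, IsChild G r v c ∧ 3 ≤ deg G c then
        {c ∈ childFinset G r v | deg G c = 2}.card else 0) +
        ∑ c ∈ childFinset G r v,
          if c = r then armc (sub c).kids + mixedL (sub c).kids else (sub c).mixed := fun v => by
    have h2 : mixedL ((childFinset G r v).toList.map sub) = ∑ c ∈ childFinset G r v,
        if c = r then armc (sub c).kids + mixedL (sub c).kids else (sub c).mixed := by
      rw [mixedL_eq_sum, List.map_map, Finset.sum_map_toList]
      refine Finset.sum_congr rfl fun c hc => ?_
      rw [if_neg (mem_childFinset.1 hc).ne_root]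
      rfl
    have h3 : armc ((childFinset G r v).toList.map sub) =
        {c ∈ childFinset G r v | deg G c = 2}.card := by
      rw [armc_map]
      congr 1
      refine Finset.filter_congr fun c hc => ?_
      rw [deg_sub hG hsub (mem_childFinset.1 hc).ne_root]
    rw [← h2, ← h3]
    by_cases hv : v = r
    · rw [if_pos hv, if_pos (.inl hv), kids_sub hsub]
    · rw [if_neg hv]
      conv_lhs => rw [hsub v, mixed_node]
      congr 1
      refine if_congr ?_ rfl rfl
      simp only [hv, false_or]
      constructor
      · intro h
        obtain ⟨b, hb, hb3⟩ := exists_of_ntc_pos h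
        simp only [List.mem_map, Finset.mem_toList, mem_childFinset] at hb
        obtain ⟨c, hc, rfl⟩ := hb
        rw [deg_sub hG hsub hc.ne_root] at hb3
        exact ⟨c, hc, hb3⟩
      · rintro ⟨c, hc, hc3⟩
        rw [← deg_sub hG hsub hc.ne_root] at hc3
        exact ntc_pos (List.mem_map_of_mem (by simpa using hc)) hc3
  have h2 := sum_unfold hG h1
  rwa [if_pos rfl] at h2

end

-- ### Pendant paths and B-branches in the unfolding

section

variable {V : Type*} [Fintype V] {G : SimpleGraph V} {r : V} {sub : V → RTree}

theorem HasPendantPath.spec {l : ℕ} {u c : V} (hl : 2 ≤ l) (h : HasPendantPath G l u c) :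
    G.Adj u c ∧ deg G c = 2 ∧ 3 ≤ deg G u := by
  obtain ⟨v, p, ⟨hp, hu, hv, hin⟩, hlen, rfl⟩ := h
  match p with
  | .nil => simp at hlen; omega
  | .cons h .nil => simp at hlen; omega
  | .cons (v := c) h (.cons h' q) =>
    refine ⟨by simpa using h, ?_, hu⟩
    rw [Walk.snd_cons]
    refine hin c (by simp) h.ne' ?_
    rintro rfl
    have := hp.support_nodup
    simp at this

theorem hasPendantPath_two {u c y : V} (huc : G.Adj u c) (hcy : G.Adj c y) (hu : 3 ≤ deg G u)
    (hc : deg G c = 2) (hy : deg G y = 1) : HasPendantPath G 2 u c := by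
  refine ⟨y, .cons huc (.cons hcy .nil), ⟨?_, hu, hy, ?_⟩, rfl, rfl⟩
  · have : u ≠ y := by rintro rfl; omega
    simp [Walk.isPath_def, huc.ne, hcy.ne, this]
  · simp
    tauto

theorem hasPendantPath_three {u c y z : V} (huc : G.Adj u c) (hcy : G.Adj c y) (hyz : G.Adj y z)
    (hu : 3 ≤ deg G u) (hc : deg G c = 2) (hy : deg G y = 2) (hz : deg G z = 1) :
    HasPendantPath G 3 u c := by
  refine ⟨z, .cons huc (.cons hcy (.cons hyz .nil)), ⟨?_, hu, hz, ?_⟩, rfl, rfl⟩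
  · have h1 : u ≠ y := by rintro rfl; omega
    have h2 : u ≠ z := by rintro rfl; omega
    have h3 : c ≠ z := by rintro rfl; omega
    simp [Walk.isPath_def, huc.ne, hcy.ne, hyz.ne, h1, h2, h3]
  · simp
    tauto

theorem exists_child_of_sub_eq_leg
    (hsub : ∀ v, sub v = node ((childFinset G r v).toList.map sub)) {c : V} {k : ℕ}
    (h : sub c = leg (k + 1)) : ∃ y, IsChild G r c y ∧ sub y = leg k :=
  (mem_kids_sub hsub).1 (by rw [h, leg_succ]; simp)

theorem hasPendantPath_of_sub_eq_leg_one (hG : G.IsTree)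
    (hsub : ∀ v, sub v = node ((childFinset G r v).toList.map sub)) {u c : V}
    (hu : 3 ≤ deg G u) (hc : IsChild G r u c) (h : sub c = leg 1) : HasPendantPath G 2 u c := by
  obtain ⟨y, hy, hy'⟩ := exists_child_of_sub_eq_leg hsub h
  exact hasPendantPath_two hc.1 hy.1 hu (by rw [← deg_sub hG hsub hc.ne_root, h]; rfl)
    (by rw [← deg_sub hG hsub hy.ne_root, hy']; rfl)

theorem hasPendantPath_of_sub_eq_leg_two (hG : G.IsTree)
    (hsub : ∀ v, sub v = node ((childFinset G r v).toList.map sub)) {u c : V}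
    (hu : 3 ≤ deg G u) (hc : IsChild G r u c) (h : sub c = leg 2) : HasPendantPath G 3 u c := by
  obtain ⟨y, hy, hy'⟩ := exists_child_of_sub_eq_leg hsub h
  obtain ⟨z, hz, hz'⟩ := exists_child_of_sub_eq_leg hsub hy'
  exact hasPendantPath_three hc.1 hy.1 hz.1 hu (by rw [← deg_sub hG hsub hc.ne_root, h]; rfl)
    (by rw [← deg_sub hG hsub hy.ne_root, hy']; rfl)
    (by rw [← deg_sub hG hsub hz.ne_root, hz']; rfl)

/-- The list of branches contains two pendant paths of length three. -/
def TwoLong (m : List RTree) : Prop := ∃ m', m.Perm (leg 2 :: leg 2 :: m')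

theorem RTree.Min.not_twoLong {l : List RTree} (h : RTree.Min (node l))
    (hs : 10 ≤ size (node l)) {b : RTree} (hb : b ∈ l) : Everywhere (¬ TwoLong ·) b := by
  refine Everywhere.of_fill fun C m hm => ?_
  rintro ⟨m', hm'⟩
  obtain ⟨l', hp⟩ := exists_perm_cons hb
  have hsz := sizeL_perm hp
  rw [← hm] at hp hsz
  obtain ⟨u, hu, -, hs'⟩ := ((h.perm hp).fill_perm hm').reroot_fill
  have h1 := C.size_fill (node m) (node (leg 2 :: leg 2 :: m'))
  have h2 := sizeL_perm hm'
  refine (hu.perm (List.perm_middle (l₁ := [leg 2, leg 2])).symm).no_two_long_legs (by simp) ?_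
  simp at *
  omega

/-- A vertex all of whose children have degree at most two carries a `B_k`- or `B_k^*`-branch. -/
theorem isBRoot_or_isBStarRoot (hG : IsMinimalABC G) (hV : 10 ≤ Fintype.card V)
    (hr : 3 ≤ deg G r) (hsub : ∀ v, sub v = node ((childFinset G r v).toList.map sub)) {u : V}
    (hur : u ≠ r) (hu : 3 ≤ deg G u) (hc : ∀ c, IsChild G r u c → deg G c ≤ 2) :
    ∃ k, IsBRoot G r k u ∨ IsBStarRoot G r k u := by
  classical
  have hmin := min_sub hG hsub
  have hsize := size_sub hG.1 hsub
  have hkids := deg_root hG.1 r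
  have hlen : 3 ≤ (sub r).kids.length := by
    rw [kids_sub hsub, List.length_map, Finset.length_toList]; omega
  have hs : 10 ≤ size (node (sub r).kids) := by rw [node_kids]; omega
  rw [← node_kids (sub r)] at hmin
  have hgood : Good (sub u) := by
    have := sub_induction hG.1 hsub (Q := fun t => Good t ∨ t = leg 0)
      (fun t ht c hc => Good.of_mem_kids ht hc)
      (fun c hc => .inl (hmin.good_of_mem hlen hs hc)) hur
    refine this.resolve_right fun h0 => ?_
    have := deg_sub hG.1 hsub hur
    rw [h0] at this
    simp at this
    omega
  have htwo : ¬ TwoLong (sub u).kids := by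
    have := sub_induction hG.1 hsub (Q := Everywhere (¬ TwoLong ·))
      (fun t ht c hc => by cases ht with | node l _ h => exact h c hc)
      (fun c hc => hmin.not_twoLong hs hc) hur
    rw [← node_kids (sub u)] at this
    exact this.here
  have hdu := deg_sub hG.1 hsub hur
  have hleg : ∀ c, IsChild G r u c → sub c = leg 1 ∨ sub c = leg 2 := fun c hcu => by
    have h1 := hgood.kids (by omega) ((mem_kids_sub hsub).2 ⟨c, hcu, rfl⟩)
    have h2 := hc c hcu
    rw [← deg_sub hG.1 hsub hcu.ne_root] at h2
    exact h1.eq_leg (by have := h1.two_le_deg; omega)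
  have hk : 2 ≤ (children G r u).ncard := by
    rw [ncard_children]
    have := deg_of_ne_root hG.1 hur
    omega
  refine ⟨(children G r u).ncard, ?_⟩
  by_cases h : ∃ c₀, IsChild G r u c₀ ∧ sub c₀ = leg 2
  · obtain ⟨c₀, h₀, h₂⟩ := h
    refine .inr ⟨hk, hur, rfl, c₀, h₀, hasPendantPath_of_sub_eq_leg_two hG.1 hsub hu h₀ h₂,
      fun c hcu hne => ?_⟩
    refine hasPendantPath_of_sub_eq_leg_one hG.1 hsub hu hcu ((hleg c hcu).resolve_right fun h3 => ?_)
    refine htwo ⟨(((childFinset G r u).toList.erase c₀).erase c).map sub, ?_⟩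
    rw [kids_sub hsub]
    have p1 := List.perm_cons_erase (a := c₀) (l := (childFinset G r u).toList) (by simpa using h₀)
    have p2 := List.perm_cons_erase (a := c) (l := (childFinset G r u).toList.erase c₀)
      ((List.mem_erase_of_ne hne).2 (Finset.mem_toList.2 (mem_childFinset.2 hcu)))
    simpa [h₂, h3] using (p1.trans (p2.cons c₀)).map sub
  · exact .inl ⟨hk, hur, rfl, fun c hcu => hasPendantPath_of_sub_eq_leg_one hG.1 hsub hu hcu
      ((hleg c hcu).resolve_right fun h3 => h ⟨c, hcu, h3⟩)⟩

/-- A B_1-branch is an arm. If its parent were neither the root nor had a large child,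
`isBRoot_or_isBStarRoot` would make the parent the root of a B_k- or B_k^*-branch. -/
theorem numB1_le (hG : IsMinimalABC G) (hV : 10 ≤ Fintype.card V)
    (hr : 3 ≤ deg G r) (hsub : ∀ v, sub v = node ((childFinset G r v).toList.map sub)) :
    numB1 G r ≤ armc (sub r).kids + mixedL (sub r).kids := by
  classical
  rw [mixed_sub hG.1 hsub]
  have h1 : {x | IsB1Root G r x} ⊆ (Finset.univ.biUnion fun v =>
      if v = r ∨ ∃ c, IsChild G r v c ∧ 3 ≤ deg G c then
        {c ∈ childFinset G r v | deg G c = 2} else ∅ : Finset V) := by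
    rintro x ⟨u, hux, hp, hB⟩
    obtain ⟨-, hx2, hu⟩ := hp.spec le_rfl
    simp only [Finset.coe_biUnion, Set.mem_iUnion, Finset.mem_coe, Finset.mem_univ]
    refine ⟨u, trivial, ?_⟩
    rw [if_pos]
    · simpa using ⟨hux, hx2⟩
    · by_contra! hcon
      obtain ⟨k, hk⟩ := isBRoot_or_isBStarRoot hG hV hr hsub hcon.1 hu
        fun c hc => by have := hcon.2 c hc; omega
      exact hk.elim (hB k).1 (hB k).2
  refine (Set.ncard_le_ncard h1 (Finset.finite_toSet _)).trans ?_
  rw [Set.ncard_coe_finset]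
  refine Finset.card_biUnion_le.trans (le_of_eq (Finset.sum_congr rfl fun v _ => ?_))
  split_ifs <;> simp

theorem sum_deg_kids (hG : G.IsTree) (hsub : ∀ v, sub v = node ((childFinset G r v).toList.map sub))
    (v : V) : ((sub v).kids.map RTree.deg).sum = ∑ c ∈ childFinset G r v, deg G c := by
  rw [kids_sub hsub, List.map_map, Finset.sum_map_toList]
  exact Finset.sum_congr rfl fun c hc => deg_sub hG hsub (mem_childFinset.1 hc).ne_root

theorem everywhere_degree_le (hG : G.IsTree)
    (hsub : ∀ v, sub v = node ((childFinset G r v).toList.map sub)) {d : ℕ}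
    (hd : ∀ v, deg G v ≤ d) {t : RTree} {v : V} (hv : v ≠ r) (ht : sub v = t) :
    Everywhere (·.length + 1 ≤ d) t := by
  induction t using RTree.ind generalizing v with
  | h l ih =>
    refine .node l ?_ fun b hb => ?_
    · have := deg_sub hG hsub hv
      rw [ht, RTree.deg_node] at this
      have := hd v
      omega
    · obtain ⟨c, hc, hcb⟩ := (mem_kids_sub hsub).1 (by rw [ht]; exact hb : b ∈ (sub v).kids)
      exact ih b hb hc.ne_root hcb

end

end ABCTree

end

theorem mainTheorem1 {V : Type*} [Fintype V] (hV : 10 ≤ Fintype.card V)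
    (G : SimpleGraph V) (hG : ABCTree.IsMinimalABC G)
    (r : V) (hr : ABCTree.IsGreedyRoot G r) :
    ABCTree.numB1 G r ≤ 4 ∧
    ((∃ k : ℕ, ABCTree.IsTBranch G r k Set.univ) → ABCTree.numB1 G r ≤ 3) := by
  classical
  open ABCTree ABCTree.RTree in
  rcases Nat.lt_or_ge (deg G r) 3 with hlt | hge
  · have h0 : numB1 G r = 0 := by
      rw [numB1, Set.ncard_eq_zero, Set.eq_empty_iff_forall_notMem]
      rintro x ⟨u, -, hp, -⟩
      have := (hp.spec le_rfl).2.2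
      have := hr.1 u
      omega
    omega
  · obtain ⟨sub, hsub⟩ := exists_unfolding hG.1 r
    have hlen : (sub r).kids.length = deg G r := by
      rw [kids_sub hsub, deg_root hG.1, List.length_map, Finset.length_toList]
    have hmin := min_sub hG hsub
    rw [← node_kids (sub r)] at hmin
    have hle := numB1_le hG hV hge hsub
    have hbound := hmin.root_bound (by omega)
      (by rw [node_kids, size_sub hG.1 hsub]; omega)
      (by
        intro b hb
        obtain ⟨c, hc, hcb⟩ := (mem_kids_sub hsub).1 hb
        exact everywhere_degree_le hG.1 hsub (by rw [hlen]; exact hr.1) hc.ne_root hcb)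
      (by
        intro b hb hbd
        obtain ⟨c, hc, rfl⟩ := (mem_kids_sub hsub).1 hb
        rw [hlen, deg_sub hG.1 hsub hc.ne_root] at hbd
        -- The neighbours of c are its children and its parent r, whose degree is the extra summand
        -- required by `root_bound`.
        have h1 := hr.2 c hbd
        rw [finsum_neighborSet, finsum_neighborSet, sum_neighbors (r := r) hG.1,
          sum_neighbors (r := r) hG.1, filter_parent hG.1 hc, filter_parent_root,
          Finset.sum_singleton, Finset.sum_empty] at h1
        rw [sum_deg_kids hG.1 hsub, sum_deg_kids hG.1 hsub, hlen]
        omega)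
    refine ⟨hle.trans hbound.1, ?_⟩
    rintro ⟨k, u, ⟨hu3, c, hc⟩, -, hu⟩
    refine hle.trans (hbound.2 ?_)
    -- A subtree that contains r starts at r. The pendant path of the terminal vertex is then an arm
    -- at the root, and the sharper bound applies.
    have hur : u = r := by
      have h1 : r ∈ subtreeAt G r u := hu ▸ Set.mem_univ r
      have h2 : G.dist r r = G.dist r u + G.dist u r := h1
      rw [dist_self] at h2
      exact (hG.1.connected.dist_eq_zero_iff.1 (by omega : G.dist r u = 0)).symm
    subst hur
    obtain ⟨h1, h2, -⟩ := hc.elim (·.spec le_rfl) (·.spec (by norm_num))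
    have h3 := isChild_root_iff.2 h1
    rw [kids_sub hsub, armc_map]
    refine Finset.card_pos.2 ⟨c, ?_⟩
    simp [h3, deg_sub hG.1 hsub h3.ne_root, h2]
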